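/- Let $n\in\mathbb N$, $s\ge 0$, $a_0\ge 0$, and let $a:(0,\infty)\to\mathbb R$ be measurable with $\int_0^\infty e^{\alpha t}|a(t)|\,dt<\infty$ for some $\alpha>0$, so that the Laplace transform $\tilde a(z)=\int_0^\infty e^{-zt}a(t)\,dt$ is given by an absolutely convergent integral on the closed half plane $\{\operatorname{Re} z\ge-\alpha\}$. Assume that $$\text{either}\quad a_0>0\ \text{ and }\ a_0+\operatorname{Re}\tilde a(i\omega)>0\ \text{ for all }\omega\in\mathbb R,\qquad\text{or}\quad \operatorname{Re}\tilde a(-\alpha+i\omega)\ge 0\ \text{ for all }\omega\in\mathbb R,$$ and that $a_0$ and $a$ do not both vanish (that is, $a_0\neq0$ or $a$ is not a.e. zero). Let $u_0\in L^1(\mathbb R^n)\cap H^s(\mathbb R^n)$, $U_0=\int_{\mathbb R^n}u_0(x)\,dx$ and $A_\infty=a_0+\int_0^\infty a(t)\,dt$. Let $u\in C([0,\infty),H^s(\mathbb R^n))$ be the solution, in the sense of distributions, of $$u_t(x,t)=a_0\Delta u(x,t)+\int_0^t a(t-\tau)\,\Delta u(x,\tau)\,d\tau\quad(x\in\mathbb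 R^n,\ t>0),\qquad u(\cdot,0)=u_0,$$ that is, $u(\cdot,0)=u_0$ and, for every $\Phi\in C_0^\infty(\mathbb R^n\times[0,\infty))$, $$\int_0^\infty\Big\langle u(\cdot,\tau),\ \Phi_t(\cdot,\tau)+a_0\Delta\Phi(\cdot,\tau)+\int_\tau^\infty a(t-\tau)\,\Delta\Phi(\cdot,t)\,dt\Big\rangle d\tau+\langle u_0,\Phi(\cdot,0)\rangle=0.$$ Let $$w(x,t)=U_0\,(4A_\infty\pi t)^{-n/2}\exp\!\Big(-\frac{|x|^2}{4A_\infty t}\Big)\quad(t>0),\qquad w(\cdot,0)=U_0\delta_0 .$$ Then for every $r<-n/2$, $w$ is the unique function in $C([0,\infty),H^r(\mathbb R^n))$ that solves the heat equation $w_t=A_\infty\Delta w$, $w(\cdot,0)=U_0\delta_0$, in the same sense of distributions. Moreover $u(\cdot,t)-w(\cdot,t)\in H^s(\mathbb R^n)$ for all $t>0$, and $$\|u(\cdot,t)-w(\cdot,t)\|_{H^s}=o\big(t^{-n/4}\big)\qquad(t\to\infty).$$ -/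

import Mathlib

open MeasureTheory TemperedDistribution Filter Set
open scoped SchwartzMap Topology ContDiff Laplacian

noncomputable section

namespace MemoryDiffusion

/-- The space `ℝⁿ` with its Euclidean norm. -/
abbrev Space (n : ℕ) : Type := EuclideanSpace ℝ (Fin n)

/-! ### The kernel -/

/-- The Laplace transform `∫₀^∞ e^{-zt} a(t) dt`. -/
def laplace (a : ℝ → ℝ) (z : ℂ) : ℂ :=
  ∫ t in Ioi (0 : ℝ), Complex.exp (-z * (t : ℂ)) * (a t : ℂ)

/-- The effective diffusivity `A_∞ = a₀ + ∫₀^∞ a(s) ds`. -/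
def diffusivity (a₀ : ℝ) (a : ℝ → ℝ) : ℝ := a₀ + ∫ t in Ioi (0 : ℝ), a t

/-! ### The norm of `H^s` -/

open Classical in
/-- The norm of `H^s(ℝⁿ)`: the `L²` norm of the Bessel potential of order `s` of `f`
(and `0` if `f` is not in `H^s`). The Bessel potential of Mathlib is
`(1 - (2π)⁻² Δ)^{s/2}`; this norm is equivalent to the one built from `(1 - Δ)^{s/2}`. -/
def sobolevNorm {n : ℕ} (s : ℝ) (f : 𝓢'(Space n, ℂ)) : ℝ :=
  if h : MemSobolev s 2 f then ‖h.choose‖ else 0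

theorem sobolevNorm_eq {n : ℕ} {s : ℝ} {f : 𝓢'(Space n, ℂ)}
    {g : Lp ℂ 2 (volume : Measure (Space n))}
    (hg : besselPotential (Space n) ℂ s f = g) : sobolevNorm s f = ‖g‖ := by
  have h : MemSobolev s 2 f := ⟨g, hg⟩
  have h1 : Lp.toTemperedDistributionCLM ℂ (volume : Measure (Space n)) 2 h.choose
      = Lp.toTemperedDistributionCLM ℂ (volume : Measure (Space n)) 2 g := by
    simpa using h.choose_spec.symm.trans hg
  have h2 : h.choose = g :=
    LinearMap.ker_eq_bot.1
      (Lp.ker_toTemperedDistributionCLM_eq_bot (F := ℂ) (μ := (volume : Measure (Space n)))) h1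
  rw [sobolevNorm, dif_pos h, h2]

/-! ### Test functions on space-time -/

/-- The time derivative of a function of `(x, t)`. -/
def timeDeriv {n : ℕ} (Φ : Space n × ℝ → ℂ) (p : Space n × ℝ) : ℂ :=
  fderiv ℝ Φ p (0, 1)

theorem contDiff_timeDeriv {n : ℕ} {Φ : Space n × ℝ → ℂ} (hΦ : ContDiff ℝ ∞ Φ) :
    ContDiff ℝ ∞ (timeDeriv Φ) :=
  (hΦ.fderiv_right (m := ∞) (by simp)).clm_apply contDiff_const

theorem hasCompactSupport_timeDeriv {n : ℕ} {Φ : Space n × ℝ → ℂ} (hc : HasCompactSupport Φ) :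
    HasCompactSupport (timeDeriv Φ) :=
  hc.fderiv_apply (𝕜 := ℝ) (0, 1)

theorem hasCompactSupport_slice {n : ℕ} {Φ : Space n × ℝ → ℂ} (hc : HasCompactSupport Φ) (t : ℝ) :
    HasCompactSupport (fun x => Φ (x, t)) := by
  refine HasCompactSupport.intro (hc.isCompact.image continuous_fst) fun x hx => ?_
  by_contra h
  exact hx ⟨(x, t), subset_tsupport _ h, rfl⟩

/-- The slice `Φ(·, t)` of a test function `Φ` on space-time, as a Schwartz function on `ℝⁿ`. -/
def slice {n : ℕ} (Φ : Space n × ℝ → ℂ) (hΦ : ContDiff ℝ ∞ Φ) (hc : HasCompactSupport Φ)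
    (t : ℝ) : 𝓢(Space n, ℂ) :=
  (hasCompactSupport_slice hc t).toSchwartzMap (hΦ.comp (contDiff_id.prodMk contDiff_const))

@[simp] theorem slice_apply {n : ℕ} (Φ : Space n × ℝ → ℂ) (hΦ : ContDiff ℝ ∞ Φ)
    (hc : HasCompactSupport Φ) (t : ℝ) (x : Space n) : slice Φ hΦ hc t x = Φ (x, t) := rfl

/-! ### Solutions of the integrodifferential equation -/

/-- `u ∈ C([0,∞), H^s(ℝⁿ))` is a solution in the sense of distributions of
`u_t(·,t) = a₀ Δu(·,t) + ∫₀ᵗ a(t-s) Δu(·,s) ds` with `u(·,0) = u₀`. The test functions on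
`ℝⁿ × [0,∞)` are the restrictions of the compactly supported smooth functions on `ℝⁿ × ℝ`.
Only the values `u t` with `t ≥ 0` matter. -/
structure IsSolution {n : ℕ} (s a₀ : ℝ) (a : ℝ → ℝ) (u₀ : 𝓢'(Space n, ℂ))
    (u : ℝ → 𝓢'(Space n, ℂ)) : Prop where
  memSobolev : ∀ t, 0 ≤ t → MemSobolev s 2 (u t)
  continuous : ∀ t₀, 0 ≤ t₀ →
    Tendsto (fun t => sobolevNorm s (u t - u t₀)) (𝓝[Ici 0] t₀) (𝓝 0)
  initial : u 0 = u₀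
  weak : ∀ (Φ : Space n × ℝ → ℂ) (hΦ : ContDiff ℝ ∞ Φ) (hc : HasCompactSupport Φ),
    (∫ τ in Ioi (0 : ℝ),
      (u τ (slice (timeDeriv Φ) (contDiff_timeDeriv hΦ) (hasCompactSupport_timeDeriv hc) τ)
        + (a₀ : ℂ) * u τ (Δ (slice Φ hΦ hc τ))
        + ∫ t in Ioi τ, (a (t - τ) : ℂ) * u τ (Δ (slice Φ hΦ hc t))))
      + u₀ (slice Φ hΦ hc 0) = 0

/-! ### The Gaussian -/

/-- The function `x ↦ U₀ (4 A π t)^{-n/2} exp(-|x|² / (4 A t))`. -/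
def gaussian {n : ℕ} (U₀ : ℂ) (A t : ℝ) (x : Space n) : ℂ :=
  U₀ * (((4 * A * Real.pi * t) ^ (-(n : ℝ) / 2) * Real.exp (-‖x‖ ^ 2 / (4 * A * t)) : ℝ) : ℂ)

theorem integrable_gaussian {n : ℕ} (U₀ : ℂ) {A t : ℝ} (hA : 0 < A) (ht : 0 < t) :
    Integrable (gaussian (n := n) U₀ A t) := by
  have hb : 0 < (((1 / (4 * A * t) : ℝ) : ℂ)).re := by
    rw [Complex.ofReal_re]; positivity
  have h := GaussianFourier.integrable_cexp_neg_mul_sq_norm_add (V := Space n) hb 0 0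
  refine (h.const_mul (U₀ * (((4 * A * Real.pi * t) ^ (-(n : ℝ) / 2) : ℝ) : ℂ))).congr
    (Eventually.of_forall fun x => ?_)
  simp only [gaussian, Complex.ofReal_mul, Complex.ofReal_exp, mul_assoc]
  congr 3
  push_cast
  ring

open Classical in
/-- The distribution `φ ↦ ∫ φ f` of an integrable function `f` (`0` if `f` is not integrable). -/
def ofIntegrable {n : ℕ} (f : Space n → ℂ) : 𝓢'(Space n, ℂ) :=
  if h : Integrable f then
    (((memLp_one_iff_integrable.2 h).toLp f : Lp ℂ 1 (volume : Measure (Space n))) :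
      𝓢'(Space n, ℂ))
  else 0

theorem ofIntegrable_apply {n : ℕ} {f : Space n → ℂ} (hf : Integrable f) (φ : 𝓢(Space n, ℂ)) :
    ofIntegrable f φ = ∫ x, φ x * f x := by
  rw [ofIntegrable, dif_pos hf, Lp.toTemperedDistribution_apply]
  refine integral_congr_ae ?_
  filter_upwards [(memLp_one_iff_integrable.2 hf).coeFn_toLp] with x hx
  rw [hx, smul_eq_mul]

/-- The family `w(·,t)`: the Gaussian at times `t > 0`, and `U₀ δ₀` at time `0`. -/
def heatFlow {n : ℕ} (U₀ : ℂ) (A t : ℝ) : 𝓢'(Space n, ℂ) :=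
  if 0 < t then ofIntegrable (gaussian U₀ A t) else U₀ • TemperedDistribution.delta 0

end MemoryDiffusion

end

open MeasureTheory TemperedDistribution Filter Set
open scoped SchwartzMap Topology ContDiff Laplacian

noncomputable section

namespace MemoryDiffusion

open FourierTransform Convolution

/-! ### Volterra operators with an integrable kernel on the half line -/

section Volterra

/-! In Fourier variables the equation decouples. With λ = 4π²|ξ|² the solution is û(ξ,t) = y_λ(t)
û₀(ξ), where y_λ solves the scalar equation y' = -λ(a₀ y + a∗y), y(0) = 1. The heat flow has Fourier
transform U₀ exp(-A_∞ λ t) with U₀ = û₀(0). Hence the squared error is the integral of (1+|ξ|²)^s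
|y_λ(t) û₀(ξ) - û₀(0) exp(-A_∞ λ t)|², and it must be o(t^{-n/2}).

Two facts on y_λ suffice: the uniform decay |y_λ(t)| ≤ 2 exp(-B min(1,λ) t)
(`exists_resolvent_decay`) and the parabolic limit y_{λ/t}(t) → exp(-A_∞ λ)
(`tendsto_resolvent_div`). For |ξ| > 1 the error decays exponentially. For |ξ| ≤ 1 the substitution
ξ = η/√t produces the factor t^{-n/2}; the rescaled integrand tends to 0 because û₀ is continuous at
0, and the decay supplies a Gaussian majorant.

The decay comes from positivity. Either sign hypothesis yields `SymbolBound`: on a strip to the left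
of the imaginary axis, Re(a₀ + ã) is at least of order 1/(1+y²), and y Im ã is bounded below in
terms of it. By Parseval a modified memory form is then non-negative, and an energy estimate for
e^{βt} y_λ(t) follows. The limit holds because y_λ varies slowly when λ is small, so that the memory
operator acts almost as multiplication by A_∞ (`abs_memOp_sub_le`).

To identify û, products θ(t)φ(x) are used as test functions, which gives a Volterra equation for the
pairing with φ. When the Fourier side of φ has compact support, iterating this equation reproduces
the power series of y_λ with a factorially small remainder (`IsSolution.tendsto_sum_fourier`). This
gives `IsSolution.hasSymbol` and also uniqueness, including that for the heat equation, which is the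
case of zero kernel. -/

theorem _root_.ContinuousOn.intervalIntegrable_of_Ici {E : Type*} [NormedAddCommGroup E]
    {f : ℝ → E} (hf : ContinuousOn f (Ici 0))
    {s t : ℝ} (hs : 0 ≤ s) (ht : 0 ≤ t) : IntervalIntegrable f volume s t :=
  (hf.mono fun _ hx => (le_inf hs ht).trans hx.1).intervalIntegrable

/-- Freezing the value at 0 for negative times makes results about continuous functions on the whole
line applicable. -/
theorem continuousOn_Ici_iff_continuous_max {E : Type*} [NormedAddCommGroup E]
    {f : ℝ → E} :
    ContinuousOn f (Ici 0) ↔ Continuous fun t => f (max 0 t) := by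
  constructor
  · intro h
    exact h.comp_continuous (by fun_prop) fun t => mem_Ici.2 (le_max_left _ _)
  · intro h
    refine h.continuousOn.congr fun t ht => ?_
    simp only [max_eq_right (show (0 : ℝ) ≤ t from ht)]

variable {E : Type*} [NormedAddCommGroup E] [NormedSpace ℝ E]

/-- The convolution `∫₀ᵗ k(s) f(t-s) ds`. -/
def causalConv (k : ℝ → ℝ) (f : ℝ → E) (t : ℝ) : E := ∫ s in (0 : ℝ)..t, k s • f (t - s)

/-- The memory operator `f ↦ a₀ f + a * f`. -/
def memOp (a₀ : ℝ) (a : ℝ → ℝ) (f : ℝ → E) (t : ℝ) : E := a₀ • f t + causalConv a f t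

/-- The integrated memory operator `f ↦ ∫₀ᵗ (a₀ f + a * f)`. -/
def volterra (a₀ : ℝ) (a : ℝ → ℝ) (f : ℝ → E) (t : ℝ) : E := ∫ τ in (0 : ℝ)..t, memOp a₀ a f τ

theorem causalConv_eq_indicator {k : ℝ → ℝ} {f : ℝ → E} {t : ℝ} (ht : 0 ≤ t) :
    causalConv k f t
      = ∫ s in (0 : ℝ)..t, (Ioi (0 : ℝ)).indicator k s • f (max 0 (t - s)) := by
  rw [causalConv, intervalIntegral.integral_of_le ht, intervalIntegral.integral_of_le ht]
  refine setIntegral_congr_fun measurableSet_Ioc fun s hs => ?_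
  simp only [indicator_of_mem (show s ∈ Ioi (0 : ℝ) from hs.1),
    max_eq_right (sub_nonneg.2 hs.2)]

theorem continuousOn_causalConv {k : ℝ → ℝ} {f : ℝ → E} (hk : IntegrableOn k (Ioi 0))
    (hf : ContinuousOn f (Ici 0)) : ContinuousOn (causalConv k f) (Ici 0) := by
  set k' : ℝ → ℝ := (Ioi (0 : ℝ)).indicator k with hk'
  have hk'i : Integrable k' := hk.integrable_indicator measurableSet_Ioi
  have hf' := continuousOn_Ici_iff_continuous_max.1 hf
  suffices h : Continuous fun t => ∫ s in (0 : ℝ)..t, k' s • f (max 0 (t - s)) from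
    h.continuousOn.congr fun t ht => causalConv_eq_indicator ht
  refine continuous_iff_continuousAt.2 fun t₀ => ?_
  -- For t < |t₀| + 1 and s > -(|t₀| + 1) the argument max 0 (t - s) stays in this interval.
  obtain ⟨C, hC⟩ := (isCompact_Icc (a := (0 : ℝ)) (b := 2 * |t₀| + 3)).exists_bound_of_continuousOn
    (hf.mono Icc_subset_Ici_self)
  have h0 : (0 : ℝ) ≤ 2 * |t₀| + 3 := by positivity
  -- Here t enters both the integrand and the upper limit. They are treated as independent
  -- variables, and continuity at (t₀, t₀) is then restricted to the diagonal.
  have key := intervalIntegral.continuousAt_parametric_primitive_of_dominated (μ := volume)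
    (F := fun (t s : ℝ) => k' s • f (max 0 (t - s))) (fun s => ‖k' s‖ * C)
    (-(|t₀| + 1)) (|t₀| + 1) (a₀ := 0) (b₀ := t₀) (x₀ := t₀)
    (fun t => (hk'i.aestronglyMeasurable.smul
      (hf'.comp (by fun_prop : Continuous fun s => t - s)).aestronglyMeasurable).restrict)
    ?_ (hk'i.norm.mul_const C).intervalIntegrable
    (ae_of_all _ fun s => by
      have : Continuous fun t => f (max 0 (t - s)) :=
        hf'.comp (by fun_prop : Continuous fun t => t - s)
      exact (this.const_smul (k' s)).continuousAt)
    ⟨by linarith [abs_nonneg t₀], by linarith [abs_nonneg t₀]⟩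
    ⟨by linarith [neg_abs_le t₀], by linarith [le_abs_self t₀]⟩ (by simp)
  · exact key.comp (f := fun t : ℝ => (t, t)) (by fun_prop)
  · filter_upwards [Iio_mem_nhds (show t₀ < |t₀| + 1 by linarith [le_abs_self t₀])] with t ht
    refine (ae_restrict_iff' measurableSet_uIoc).2 (ae_of_all _ fun s hs => ?_)
    rw [norm_smul]
    refine mul_le_mul_of_nonneg_left (hC _ ⟨le_max_left _ _, max_le h0 ?_⟩) (norm_nonneg _)
    rw [uIoc_of_le (by linarith [abs_nonneg t₀])] at hs
    have := hs.1
    have ht' : t < |t₀| + 1 := ht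
    linarith

theorem norm_causalConv_le {k : ℝ → ℝ} {f : ℝ → E} (hk : IntegrableOn k (Ioi 0)) {t C : ℝ}
    (ht : 0 ≤ t) (hC : ∀ s ∈ Icc 0 t, ‖f s‖ ≤ C) :
    ‖causalConv k f t‖ ≤ (∫ s in Ioi (0 : ℝ), |k s|) * C := by
  have hC0 : 0 ≤ C := (norm_nonneg _).trans (hC 0 ⟨le_rfl, ht⟩)
  have hk' : IntegrableOn (fun s => |k s|) (Ioi 0) := hk.abs
  rw [causalConv, intervalIntegral.integral_of_le ht]
  calc ‖∫ s in Ioc 0 t, k s • f (t - s)‖ ≤ ∫ s in Ioc 0 t, |k s| * C := by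
        refine norm_integral_le_of_norm_le ((hk'.mono_set Ioc_subset_Ioi_self).mul_const C) ?_
        refine (ae_restrict_iff' measurableSet_Ioc).2 (ae_of_all _ fun s hs => ?_)
        rw [norm_smul, Real.norm_eq_abs]
        exact mul_le_mul_of_nonneg_left
          (hC _ ⟨sub_nonneg.2 hs.2, by linarith [hs.1]⟩) (abs_nonneg _)
    _ = (∫ s in Ioc 0 t, |k s|) * C := integral_mul_const _ _
    _ ≤ _ := mul_le_mul_of_nonneg_right
        (setIntegral_mono_set hk' (ae_of_all _ fun _ => abs_nonneg _)
          Ioc_subset_Ioi_self.eventuallyLE) hC0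

/-- The bound of the memory operator in the supremum norm. -/
def memBound (a₀ : ℝ) (a : ℝ → ℝ) : ℝ := |a₀| + ∫ s in Ioi (0 : ℝ), |a s|

theorem memBound_nonneg (a₀ : ℝ) (a : ℝ → ℝ) : 0 ≤ memBound a₀ a :=
  add_nonneg (abs_nonneg _) (integral_nonneg fun _ => abs_nonneg _)

variable {a₀ : ℝ} {a : ℝ → ℝ}

theorem continuousOn_memOp {f : ℝ → E} (ha : IntegrableOn a (Ioi 0))
    (hf : ContinuousOn f (Ici 0)) : ContinuousOn (memOp a₀ a f) (Ici 0) :=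
  (hf.const_smul a₀).add (continuousOn_causalConv ha hf)

theorem norm_memOp_le {f : ℝ → E} (ha : IntegrableOn a (Ioi 0)) {t C : ℝ}
    (ht : 0 ≤ t) (hC : ∀ s ∈ Icc 0 t, ‖f s‖ ≤ C) :
    ‖memOp a₀ a f t‖ ≤ memBound a₀ a * C := by
  refine (norm_add_le _ _).trans ?_
  rw [memBound, add_mul, norm_smul, Real.norm_eq_abs]
  exact add_le_add (mul_le_mul_of_nonneg_left (hC t ⟨ht, le_rfl⟩) (abs_nonneg _))
    (norm_causalConv_le ha ht hC)

theorem causalConv_intervalIntegrable {k : ℝ → ℝ} {f : ℝ → E} (hk : IntegrableOn k (Ioi 0))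
    (hf : ContinuousOn f (Ici 0)) {t : ℝ} (ht : 0 ≤ t) :
    IntervalIntegrable (fun s => k s • f (t - s)) volume 0 t := by
  have h1 : IntervalIntegrable k volume 0 t :=
    (intervalIntegrable_iff_integrableOn_Ioc_of_le ht).2 (hk.mono_set Ioc_subset_Ioi_self)
  refine h1.smul_continuousOn (hf.comp (by fun_prop) fun s hs => ?_)
  rw [uIcc_of_le ht] at hs
  exact sub_nonneg.2 hs.2

theorem memOp_add {f g : ℝ → E} (ha : IntegrableOn a (Ioi 0)) (hf : ContinuousOn f (Ici 0))
    (hg : ContinuousOn g (Ici 0)) {t : ℝ} (ht : 0 ≤ t) :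
    memOp a₀ a (fun s => f s + g s) t = memOp a₀ a f t + memOp a₀ a g t := by
  simp only [memOp, causalConv, smul_add]
  rw [intervalIntegral.integral_add (causalConv_intervalIntegrable ha hf ht)
    (causalConv_intervalIntegrable ha hg ht)]
  abel

theorem memOp_const_mul {𝕜 : Type*} [RCLike 𝕜] (c : 𝕜) (f : ℝ → 𝕜) (t : ℝ) :
    memOp a₀ a (fun s => c * f s) t = c * memOp a₀ a f t := by
  simp only [memOp, causalConv, mul_add, mul_smul_comm]
  rw [← intervalIntegral.integral_const_mul]
  simp only [mul_smul_comm]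

theorem memOp_congr {f g : ℝ → E} {t : ℝ} (ht : 0 ≤ t) (h : ∀ s ∈ Icc 0 t, f s = g s) :
    memOp a₀ a f t = memOp a₀ a g t := by
  rw [memOp, memOp, h t ⟨ht, le_rfl⟩, causalConv, causalConv]
  congr 1
  refine intervalIntegral.integral_congr fun s hs => ?_
  rw [uIcc_of_le ht] at hs
  simp only [h (t - s) ⟨sub_nonneg.2 hs.2, by linarith [hs.1]⟩]

theorem volterra_congr {f g : ℝ → E} {t : ℝ} (ht : 0 ≤ t) (h : ∀ s ∈ Icc 0 t, f s = g s) :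
    volterra a₀ a f t = volterra a₀ a g t := by
  refine intervalIntegral.integral_congr fun s hs => ?_
  rw [uIcc_of_le ht] at hs
  exact memOp_congr hs.1 fun r hr => h r ⟨hr.1, hr.2.trans hs.2⟩

theorem volterra_add {f g : ℝ → E} (ha : IntegrableOn a (Ioi 0)) (hf : ContinuousOn f (Ici 0))
    (hg : ContinuousOn g (Ici 0)) {t : ℝ} (ht : 0 ≤ t) :
    volterra a₀ a (fun s => f s + g s) t = volterra a₀ a f t + volterra a₀ a g t := by
  rw [volterra, volterra, volterra, ← intervalIntegral.integral_add
    ((continuousOn_memOp ha hf).intervalIntegrable_of_Ici le_rfl ht)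
    ((continuousOn_memOp ha hg).intervalIntegrable_of_Ici le_rfl ht)]
  refine intervalIntegral.integral_congr fun s hs => ?_
  rw [uIcc_of_le ht] at hs
  exact memOp_add ha hf hg hs.1

theorem volterra_const_mul {𝕜 : Type*} [RCLike 𝕜] (c : 𝕜) (f : ℝ → 𝕜) (t : ℝ) :
    volterra a₀ a (fun s => c * f s) t = c * volterra a₀ a f t := by
  simp only [volterra, memOp_const_mul, intervalIntegral.integral_const_mul]

theorem hasDerivAt_primitive_of_Ici [CompleteSpace E] {g : ℝ → E} (hg : ContinuousOn g (Ici 0))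
    {t : ℝ} (ht : 0 < t) : HasDerivAt (fun t => ∫ s in (0 : ℝ)..t, g s) (g t) t := by
  refine intervalIntegral.integral_hasDerivAt_right
    (hg.intervalIntegrable_of_Ici le_rfl ht.le) ?_ (hg.continuousAt (Ici_mem_nhds ht))
  exact (hg.mono Ioi_subset_Ici_self).stronglyMeasurableAtFilter isOpen_Ioi _ ht

theorem continuousOn_primitive_of_Ici {g : ℝ → E} (hg : ContinuousOn g (Ici 0)) :
    ContinuousOn (fun t => ∫ s in (0 : ℝ)..t, g s) (Ici 0) := by
  have h := continuousOn_Ici_iff_continuous_max.1 hg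
  have h2 : Continuous fun t => ∫ s in (0 : ℝ)..t, g (max 0 s) :=
    intervalIntegral.continuous_primitive (fun _ _ => h.intervalIntegrable _ _) 0
  refine h2.continuousOn.congr fun t ht => ?_
  refine intervalIntegral.integral_congr fun s hs => ?_
  rw [uIcc_of_le ht] at hs
  simp only [max_eq_right hs.1]

theorem continuousOn_volterra {f : ℝ → E} (ha : IntegrableOn a (Ioi 0))
    (hf : ContinuousOn f (Ici 0)) : ContinuousOn (volterra a₀ a f) (Ici 0) :=
  continuousOn_primitive_of_Ici (continuousOn_memOp ha hf)

theorem continuousOn_volterra_iterate {f : ℝ → E} (ha : IntegrableOn a (Ioi 0))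
    (hf : ContinuousOn f (Ici 0)) (k : ℕ) : ContinuousOn ((volterra a₀ a)^[k] f) (Ici 0) := by
  induction k with
  | zero => exact hf
  | succ k ih =>
    rw [Function.iterate_succ_apply']
    exact continuousOn_volterra ha ih

/-- Each application costs a factor `memBound` and one more integration in time, whence the
factorial. This makes the resolvent series converge for every λ and kills the remainder when the
equation of a solution is iterated. -/
theorem norm_volterra_iterate_le {f : ℝ → E} (ha : IntegrableOn a (Ioi 0)) {T C : ℝ}
    (hC : ∀ s ∈ Icc 0 T, ‖f s‖ ≤ C) (k : ℕ) :
    ∀ t ∈ Icc 0 T, ‖(volterra a₀ a)^[k] f t‖ ≤ C * ((memBound a₀ a * t) ^ k / k.factorial) := by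
  induction k with
  | zero => intro t ht; simpa using hC t ht
  | succ k ih =>
    intro t ht
    have hL := memBound_nonneg a₀ a
    have hC0 : 0 ≤ C := (norm_nonneg _).trans (hC t ht)
    rw [Function.iterate_succ_apply', volterra, intervalIntegral.integral_of_le ht.1]
    set L := memBound a₀ a
    have hcont : Continuous fun s : ℝ => L * (C * ((L * s) ^ k / k.factorial)) := by fun_prop
    have hint : ∫ s in (0 : ℝ)..t, L * (C * ((L * s) ^ k / k.factorial))
        = C * ((L * t) ^ (k + 1) / (k + 1).factorial) := by
      have : ∀ s : ℝ, L * (C * ((L * s) ^ k / k.factorial))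
          = (L ^ (k + 1) * C / k.factorial) * s ^ k := fun s => by rw [mul_pow]; ring
      simp_rw [this]
      rw [intervalIntegral.integral_const_mul, integral_pow, Nat.factorial_succ]
      push_cast
      field_simp
      ring
    rw [← hint, intervalIntegral.integral_of_le ht.1]
    refine norm_integral_le_of_norm_le
      ((intervalIntegrable_iff_integrableOn_Ioc_of_le ht.1).1 (hcont.intervalIntegrable _ _)) ?_
    refine (ae_restrict_iff' measurableSet_Ioc).2 (ae_of_all _ fun s hs => ?_)
    refine norm_memOp_le ha hs.1.le fun r hr => ?_
    refine (ih r ⟨hr.1, hr.2.trans (hs.2.trans ht.2)⟩).trans ?_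
    have := hr.1
    have := hr.2
    gcongr

end Volterra

/-! ### The scalar resolvent as a power series in the spectral parameter -/

section Resolvent

/-- The solution of `y' = -lam (a₀ y + a * y)`, `y(0) = 1`, as a power series in `lam`. -/
def resolvent (a₀ : ℝ) (a : ℝ → ℝ) (lam t : ℝ) : ℝ :=
  ∑' k : ℕ, (-lam) ^ k * (volterra a₀ a)^[k] (fun _ => 1) t

variable {a₀ : ℝ} {a : ℝ → ℝ}

theorem norm_resolvent_term_le (ha : IntegrableOn a (Ioi 0)) {Λ T lam t : ℝ} (hl : |lam| ≤ Λ)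
    (ht : t ∈ Icc 0 T) (k : ℕ) :
    ‖(-lam) ^ k * (volterra a₀ a)^[k] (fun _ => (1 : ℝ)) t‖
      ≤ (Λ * (memBound a₀ a * T)) ^ k / k.factorial := by
  have h := norm_volterra_iterate_le (a₀ := a₀) (f := fun _ => (1 : ℝ)) (C := 1) (T := T) ha
    (by simp) k t ht
  have hL := memBound_nonneg a₀ a
  have hT : 0 ≤ T := ht.1.trans ht.2
  rw [norm_mul, norm_pow, norm_neg, Real.norm_eq_abs, mul_pow, mul_div_assoc]
  refine mul_le_mul (pow_le_pow_left₀ (abs_nonneg _) hl k) (h.trans ?_) (norm_nonneg _)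
    (pow_nonneg ((abs_nonneg _).trans hl) _)
  rw [one_mul]
  have := ht.1
  have := ht.2
  gcongr

theorem summable_resolvent_bound (x : ℝ) : Summable fun k : ℕ => x ^ k / k.factorial :=
  Real.summable_pow_div_factorial x

/-- The partial sums of the resolvent. -/
def resolventSum (a₀ : ℝ) (a : ℝ → ℝ) (N : ℕ) (lam t : ℝ) : ℝ :=
  ∑ k ∈ Finset.range N, (-lam) ^ k * (volterra a₀ a)^[k] (fun _ => 1) t

theorem tendsto_resolventSum (ha : IntegrableOn a (Ioi 0)) (lam : ℝ) {t : ℝ} (ht : 0 ≤ t) :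
    Tendsto (fun N => resolventSum a₀ a N lam t) atTop (𝓝 (resolvent a₀ a lam t)) :=
  (Summable.of_norm_bounded (summable_resolvent_bound _)
    (norm_resolvent_term_le ha le_rfl ⟨ht, le_rfl⟩)).hasSum.tendsto_sum_nat

theorem tendstoUniformlyOn_resolventSum (ha : IntegrableOn a (Ioi 0)) (lam T : ℝ) :
    TendstoUniformlyOn (fun N t => resolventSum a₀ a N lam t) (resolvent a₀ a lam) atTop
      (Icc 0 T) :=
  tendstoUniformlyOn_tsum_nat (summable_resolvent_bound _)
    fun k _ ht => norm_resolvent_term_le ha le_rfl ht k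

theorem abs_resolventSum_le (ha : IntegrableOn a (Ioi 0)) {Λ lam t : ℝ} (hl : |lam| ≤ Λ)
    (ht : 0 ≤ t) (N : ℕ) :
    |resolventSum a₀ a N lam t| ≤ Real.exp (Λ * (memBound a₀ a * t)) := by
  refine (Finset.abs_sum_le_sum_abs _ _).trans ?_
  refine (Finset.sum_le_sum fun k _ => norm_resolvent_term_le ha hl ⟨ht, le_rfl⟩ k).trans ?_
  have h0 : 0 ≤ Λ * (memBound a₀ a * t) :=
    mul_nonneg ((abs_nonneg _).trans hl) (mul_nonneg (memBound_nonneg _ _) ht)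
  exact Real.sum_le_exp_of_nonneg h0 N

theorem continuousOn_resolventSum (ha : IntegrableOn a (Ioi 0)) (N : ℕ) (lam : ℝ) :
    ContinuousOn (resolventSum a₀ a N lam) (Ici 0) :=
  continuousOn_finsetSum _ fun k _ => continuousOn_const.mul
    (continuousOn_volterra_iterate ha continuousOn_const k)

theorem continuousOn_resolvent (ha : IntegrableOn a (Ioi 0)) (lam : ℝ) :
    ContinuousOn (resolvent a₀ a lam) (Ici 0) := by
  intro t ht
  have h : ContinuousOn (resolvent a₀ a lam) (Icc 0 (t + 1)) :=
    (tendstoUniformlyOn_resolventSum ha lam (t + 1)).continuousOn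
      (Frequently.of_forall fun N => (continuousOn_resolventSum ha N lam).mono Icc_subset_Ici_self)
  refine (h t ⟨ht, by linarith⟩).mono_of_mem_nhdsWithin ?_
  rw [← Ici_inter_Iic]
  exact inter_mem_nhdsWithin _ (Iic_mem_nhds (by linarith))

/-- The partial sums are the Picard iterates of y ↦ 1 - λ V y. -/
theorem resolventSum_succ (ha : IntegrableOn a (Ioi 0)) (N : ℕ) (lam : ℝ) :
    ∀ t, 0 ≤ t →
    resolventSum a₀ a (N + 1) lam t = 1 - lam * volterra a₀ a (resolventSum a₀ a N lam) t := by
  induction N with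
  | zero =>
    intro t ht
    have : volterra a₀ a (resolventSum a₀ a 0 lam) t = 0 := by
      have : resolventSum a₀ a 0 lam = fun s => (0 : ℝ) * 1 := by
        ext s; simp [resolventSum]
      rw [this, volterra_const_mul, zero_mul]
    rw [this]
    simp [resolventSum]
  | succ N ih =>
    intro t ht
    have h1 : resolventSum a₀ a (N + 1) lam = fun s => resolventSum a₀ a N lam s
        + (-lam) ^ N * (volterra a₀ a)^[N] (fun _ => 1) s := by
      ext s; rw [resolventSum, Finset.sum_range_succ]; rfl
    have h2 : volterra a₀ a (resolventSum a₀ a (N + 1) lam) t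
        = volterra a₀ a (resolventSum a₀ a N lam) t
          + (-lam) ^ N * (volterra a₀ a)^[N + 1] (fun _ => 1) t := by
      rw [h1, volterra_add (g := fun s => (-lam) ^ N * (volterra a₀ a)^[N] (fun _ => (1 : ℝ)) s)
        ha (continuousOn_resolventSum ha N lam)
        (continuousOn_const.mul (continuousOn_volterra_iterate ha continuousOn_const N)) ht,
        volterra_const_mul, Function.iterate_succ_apply']
    rw [h2, resolventSum, Finset.sum_range_succ]
    have := ih t ht
    rw [resolventSum] at this
    rw [this]
    ring

/-- Passage to the limit in the Picard iteration: the partial sums converge uniformly on [0, t], and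
the Volterra operator is bounded in the supremum norm there. -/
theorem resolvent_eq (ha : IntegrableOn a (Ioi 0)) (lam : ℝ) {t : ℝ} (ht : 0 ≤ t) :
    resolvent a₀ a lam t = 1 - lam * volterra a₀ a (resolvent a₀ a lam) t := by
  have hL := memBound_nonneg a₀ a
  have hlim : Tendsto (fun N => volterra a₀ a (resolventSum a₀ a N lam) t) atTop
      (𝓝 (volterra a₀ a (resolvent a₀ a lam) t)) := by
    rw [Metric.tendsto_atTop]
    intro ε hε
    have hu := Metric.tendstoUniformlyOn_iff.1 (tendstoUniformlyOn_resolventSum (a₀ := a₀) ha lam t)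
      (ε / (memBound a₀ a * t + 1)) (by positivity)
    obtain ⟨N₀, hN₀⟩ := eventually_atTop.1 hu
    refine ⟨N₀, fun N hN => ?_⟩
    have hsub : volterra a₀ a (resolventSum a₀ a N lam) t - volterra a₀ a (resolvent a₀ a lam) t
        = (volterra a₀ a)^[1]
          (fun s => resolventSum a₀ a N lam s + (-1) * resolvent a₀ a lam s) t := by
      rw [Function.iterate_one, volterra_add (g := fun s => (-1) * resolvent a₀ a lam s)
        ha (continuousOn_resolventSum ha N lam)
        (continuousOn_const.mul (continuousOn_resolvent ha lam)) ht, volterra_const_mul]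
      ring
    rw [Real.dist_eq, hsub, ← Real.norm_eq_abs]
    refine (norm_volterra_iterate_le ha (T := t) (C := ε / (memBound a₀ a * t + 1))
      (fun s hs => ?_) 1 t ⟨ht, le_rfl⟩).trans_lt ?_
    · have := (hN₀ N hN s hs).le
      rw [Real.dist_eq, abs_sub_comm] at this
      rw [Real.norm_eq_abs]
      rwa [neg_one_mul, ← sub_eq_add_neg]
    · have h0 : 0 ≤ memBound a₀ a * t := mul_nonneg hL ht
      rw [pow_one, Nat.factorial_one, Nat.cast_one, div_one, div_mul_eq_mul_div,
        div_lt_iff₀ (by positivity)]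
      nlinarith
  have h1 := (tendsto_resolventSum (a₀ := a₀) ha lam ht).comp (tendsto_add_atTop_nat 1)
  refine tendsto_nhds_unique h1 ?_
  refine (tendsto_const_nhds.sub (hlim.const_mul lam)).congr fun N => ?_
  exact (resolventSum_succ ha N lam t ht).symm

theorem resolvent_zero_right (ha : IntegrableOn a (Ioi 0)) (lam : ℝ) :
    resolvent a₀ a lam 0 = 1 := by
  rw [resolvent_eq ha lam le_rfl]
  simp [volterra]

theorem hasDerivAt_resolvent (ha : IntegrableOn a (Ioi 0)) (lam : ℝ) {t : ℝ} (ht : 0 < t) :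
    HasDerivAt (resolvent a₀ a lam) (-lam * memOp a₀ a (resolvent a₀ a lam) t) t := by
  have h := ((hasDerivAt_primitive_of_Ici (continuousOn_memOp (a₀ := a₀) ha
    (continuousOn_resolvent (a₀ := a₀) ha lam)) ht).const_mul lam).const_sub 1
  rw [neg_mul]
  refine h.congr_of_eventuallyEq ?_
  filter_upwards [Ioi_mem_nhds ht] with s hs
  exact resolvent_eq ha lam (le_of_lt hs)

theorem measurable_resolvent (ha : IntegrableOn a (Ioi 0)) {t : ℝ} (ht : 0 ≤ t) :
    Measurable fun lam => resolvent a₀ a lam t := by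
  refine measurable_of_tendsto_metrizable (f := fun N lam => resolventSum a₀ a N lam t)
    (fun N => ?_) (tendsto_pi_nhds.2 fun lam => tendsto_resolventSum ha lam ht)
  unfold resolventSum
  fun_prop

end Resolvent

/-! ### Fourier transform on L¹ ∩ L² and Parseval's identity -/

section FourierL2

variable {V : Type*} [NormedAddCommGroup V] [InnerProductSpace ℝ V] [FiniteDimensional ℝ V]
  [MeasurableSpace V] [BorelSpace V]

theorem integral_fourier_mul_flip {f g : V → ℂ} (hf : Integrable f) (hg : Integrable g) :
    ∫ ξ, 𝓕 f ξ * g ξ = ∫ x, f x * 𝓕 g x := by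
  have h := VectorFourier.integral_fourierIntegral_smul_eq_flip (μ := volume) (ν := volume)
    (L := innerₗ V) Real.continuous_fourierChar continuous_inner hf hg
  rw [flip_innerₗ] at h
  exact h

theorem ae_eq_of_forall_integral_schwartz_mul {f g : V → ℂ} (hf : LocallyIntegrable f)
    (hg : LocallyIntegrable g)
    (h : ∀ ψ : 𝓢(V, ℂ), HasCompactSupport ψ → ∫ x, ψ x * f x = ∫ x, ψ x * g x) :
    f =ᵐ[volume] g := by
  refine ae_eq_of_integral_contDiff_smul_eq hf hg fun φ hφ hc => ?_
  have hc' : HasCompactSupport fun x => (φ x : ℂ) := hc.comp_left (g := fun y : ℝ => (y : ℂ)) rfl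
  have := h (hc'.toSchwartzMap (Complex.ofRealCLM.contDiff.comp hφ)) hc'
  exact this

/-- The L² extension and the Fourier integral have the same pairing with every Schwartz function,
since both transfer the transform to the test function. -/
theorem fourier_toLp_two_ae_eq {f : V → ℂ} (h1 : Integrable f) (h2 : MemLp f 2) :
    (𝓕 (h2.toLp f) : Lp (α := V) ℂ 2) =ᵐ[volume] 𝓕 f := by
  refine ae_eq_of_forall_integral_schwartz_mul
    ((Lp.memLp _).locallyIntegrable one_le_two)
    (VectorFourier.fourierIntegral_continuous Real.continuous_fourierChar
      continuous_inner h1).locallyIntegrable fun ψ _ => ?_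
  have h3 := congrArg (fun T : 𝓢'(V, ℂ) => T ψ)
    (Lp.fourier_toTemperedDistribution_eq (h2.toLp f))
  simp only [TemperedDistribution.fourier_apply, Lp.toTemperedDistribution_apply,
    smul_eq_mul] at h3
  rw [← h3]
  have h4 : ∫ x, (𝓕 ψ) x * h2.toLp f x = ∫ x, (𝓕 (ψ : V → ℂ)) x * f x := by
    refine integral_congr_ae ?_
    filter_upwards [h2.coeFn_toLp] with x hx
    rw [hx]
    rfl
  rw [h4]
  exact integral_fourier_mul_flip ψ.integrable h1

theorem memLp_two_fourier {f : V → ℂ} (h1 : Integrable f) (h2 : MemLp f 2) : MemLp (𝓕 f) 2 :=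
  (memLp_congr_ae (fourier_toLp_two_ae_eq h1 h2)).1 (Lp.memLp _)

/-- Parseval's identity for functions in `L¹ ∩ L²`. -/
theorem integral_conj_mul_eq_fourier {f g : V → ℂ} (hf1 : Integrable f)
    (hf2 : MemLp f 2) (hg1 : Integrable g) (hg2 : MemLp g 2) :
    ∫ x, (starRingEnd ℂ) (f x) * g x = ∫ ξ, (starRingEnd ℂ) (𝓕 f ξ) * 𝓕 g ξ := by
  have h := Lp.inner_fourier_eq (hf2.toLp f) (hg2.toLp g)
  rw [L2.inner_def, L2.inner_def] at h
  have e1 : ∫ ξ, (starRingEnd ℂ) (𝓕 f ξ) * 𝓕 g ξ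
      = ∫ ξ : V, inner ℂ ((𝓕 (hf2.toLp f) : Lp ℂ 2 (volume : Measure V)) ξ)
        ((𝓕 (hg2.toLp g) : Lp ℂ 2 (volume : Measure V)) ξ) := by
    refine integral_congr_ae ?_
    filter_upwards [fourier_toLp_two_ae_eq hf1 hf2, fourier_toLp_two_ae_eq hg1 hg2] with x h1 h2
    rw [h1, h2, RCLike.inner_apply, mul_comm]
  have e2 : ∫ ξ, (starRingEnd ℂ) (f ξ) * g ξ
      = ∫ ξ : V, inner ℂ ((hf2.toLp f) ξ) ((hg2.toLp g) ξ) := by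
    refine integral_congr_ae ?_
    filter_upwards [hf2.coeFn_toLp, hg2.coeFn_toLp] with x h1 h2
    rw [h1, h2, RCLike.inner_apply, mul_comm]
  rw [e1, e2, h]

/-- An integrable function with vanishing Fourier transform vanishes. -/
theorem ae_eq_zero_of_fourier_eq_zero {f : V → ℂ} (hf : Integrable f) (h : ∀ ξ, 𝓕 f ξ = 0) :
    f =ᵐ[volume] 0 := by
  refine ae_eq_of_forall_integral_schwartz_mul hf.locallyIntegrable
    (integrable_zero _ _ _).locallyIntegrable fun ψ _ => ?_
  have h1 := integral_fourier_mul_flip (𝓕⁻ ψ : 𝓢(V, ℂ)).integrable hf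
  simp only [h, mul_zero, integral_zero] at h1
  simp only [Pi.zero_apply, mul_zero, integral_zero]
  rw [← h1]
  have : 𝓕 (⇑(𝓕⁻ ψ : 𝓢(V, ℂ))) = ψ := by
    rw [← SchwartzMap.fourier_coe, FourierTransform.fourier_fourierInv_eq]
  rw [this]

/-- A multiplier with non-negative real part has a non-negative quadratic form. -/
theorem re_integral_conj_mul_nonneg {f g : V → ℂ} {m : V → ℂ} (hf1 : Integrable f)
    (hf2 : MemLp f 2) (hg1 : Integrable g) (hg2 : MemLp g 2) (hm : ∀ ξ, 𝓕 g ξ = m ξ * 𝓕 f ξ)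
    (hpos : ∀ ξ, 0 ≤ (m ξ).re) : 0 ≤ (∫ x, (starRingEnd ℂ) (f x) * g x).re := by
  have hi : Integrable fun ξ => (starRingEnd ℂ) (𝓕 f ξ) * 𝓕 g ξ := by
    have h := (memLp_two_fourier hg1 hg2).integrable_mul (memLp_two_fourier hf1 hf2).star
    refine h.congr (ae_of_all _ fun x => ?_)
    simp [mul_comm]
  rw [integral_conj_mul_eq_fourier hf1 hf2 hg1 hg2, ← RCLike.re_eq_complex_re, ← integral_re hi]
  refine integral_nonneg fun ξ => ?_
  have : (starRingEnd ℂ) (𝓕 f ξ) * 𝓕 g ξ = ((‖𝓕 f ξ‖ ^ 2 : ℝ) : ℂ) * m ξ := by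
    rw [hm, mul_left_comm, Complex.conj_mul', mul_comm]
    push_cast
    rfl
  simp only [this, RCLike.re_eq_complex_re, Complex.re_ofReal_mul, Pi.zero_apply]
  exact mul_nonneg (by positivity) (hpos ξ)

end FourierL2

/-! ### Bounds for convolutions -/

section Convolution

/-- A bounded integrable function is square integrable. -/
theorem memLp_two_of_integrable_of_bound {f : ℝ → ℂ} (hf : Integrable f) {C : ℝ}
    (hC : ∀ x, ‖f x‖ ≤ C) : MemLp f 2 := by
  refine (memLp_two_iff_integrable_sq_norm hf.aestronglyMeasurable).2 ?_
  refine (hf.norm.const_mul C).mono' (hf.aestronglyMeasurable.norm.pow 2) (ae_of_all _ fun x => ?_)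
  rw [Real.norm_eq_abs, abs_of_nonneg (by positivity), pow_two]
  exact mul_le_mul_of_nonneg_right (hC x) (norm_nonneg _)

theorem norm_convolution_le {k f : ℝ → ℂ} (hk : Integrable k) {C : ℝ} (hC : ∀ x, ‖f x‖ ≤ C)
    (x : ℝ) : ‖(k ⋆[ContinuousLinearMap.mul ℂ ℂ] f) x‖ ≤ (∫ s, ‖k s‖) * C := by
  rw [convolution_def, ← integral_mul_const]
  refine norm_integral_le_of_norm_le (hk.norm.mul_const C) (ae_of_all _ fun s => ?_)
  rw [ContinuousLinearMap.mul_apply', norm_mul]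
  exact mul_le_mul_of_nonneg_left (hC _) (norm_nonneg _)

end Convolution


/-! ### The Cauchy kernel: sign, decay and Fourier transform -/

section Cauchy

/-- The Fourier transform of `t ↦ exp(-ζ |t|)`, in the angular frequency `η`. -/
def cauchyKernel (ζ : ℂ) (η : ℝ) : ℂ := 2 * ζ / (ζ ^ 2 + (η : ℂ) ^ 2)

theorem normSq_cauchyDenom (x y η : ℝ) :
    Complex.normSq (((x : ℂ) + y * Complex.I) ^ 2 + (η : ℂ) ^ 2)
      = (x ^ 2 - y ^ 2 + η ^ 2) ^ 2 + (2 * x * y) ^ 2 := by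
  have h : ((x : ℂ) + y * Complex.I) ^ 2 + (η : ℂ) ^ 2
      = ((x ^ 2 - y ^ 2 + η ^ 2 : ℝ) : ℂ) + ((2 * x * y : ℝ) : ℂ) * Complex.I := by
    push_cast
    linear_combination (y : ℂ) ^ 2 * Complex.I_sq
  rw [h, Complex.normSq_add_mul_I]

theorem normSq_cauchyDenom_pos {x : ℝ} (hx : 0 < x) (y η : ℝ) :
    0 < (x ^ 2 - y ^ 2 + η ^ 2) ^ 2 + (2 * x * y) ^ 2 := by
  rcases eq_or_ne y 0 with rfl | hy
  · have : 0 < x ^ 2 - 0 ^ 2 + η ^ 2 := by nlinarith [pow_pos hx 2, sq_nonneg η]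
    positivity
  · positivity

theorem cauchyKernel_re (x y η : ℝ) : (cauchyKernel (x + y * Complex.I) η).re
    = 2 * x * (x ^ 2 + y ^ 2 + η ^ 2) / ((x ^ 2 - y ^ 2 + η ^ 2) ^ 2 + (2 * x * y) ^ 2) := by
  rw [cauchyKernel, Complex.div_re, normSq_cauchyDenom, ← add_div]
  congr 1
  simp [pow_two]
  ring

theorem cauchyKernel_im (x y η : ℝ) : (cauchyKernel (x + y * Complex.I) η).im
    = 2 * y * (η ^ 2 - x ^ 2 - y ^ 2) / ((x ^ 2 - y ^ 2 + η ^ 2) ^ 2 + (2 * x * y) ^ 2) := by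
  rw [cauchyKernel, Complex.div_im, normSq_cauchyDenom, ← sub_div]
  congr 1
  simp [pow_two]
  ring

/-- The denominator of the real part equals (x²+y²+η²)² - 4y²η², hence is at most (x²+y²+η²)². -/
theorem le_cauchyKernel_re {x : ℝ} (hx : 0 < x) (y η : ℝ) :
    2 * x / (x ^ 2 + y ^ 2 + η ^ 2) ≤ (cauchyKernel (x + y * Complex.I) η).re := by
  have h0 : 0 < x ^ 2 + y ^ 2 + η ^ 2 := by positivity
  have h1 := normSq_cauchyDenom_pos hx y η
  rw [cauchyKernel_re, div_le_iff₀ h0, div_mul_eq_mul_div, le_div_iff₀ h1]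
  have h2 : (x ^ 2 - y ^ 2 + η ^ 2) ^ 2 + (2 * x * y) ^ 2
      ≤ (x ^ 2 + y ^ 2 + η ^ 2) * (x ^ 2 + y ^ 2 + η ^ 2) := by
    nlinarith [mul_nonneg (sq_nonneg η) (sq_nonneg y)]
  rw [mul_assoc (2 * x)]
  exact mul_le_mul_of_nonneg_left h2 (by positivity)

/-- Being pointwise in η, the inequality survives integration against non-negative boundary values,
and it then controls the imaginary part of the Laplace transform by its real part. -/
theorem neg_le_mul_cauchyKernel_im {x : ℝ} (hx : 0 < x) (y η : ℝ) :
    -(y ^ 2 / x * (cauchyKernel (x + y * Complex.I) η).re)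
      ≤ y * (cauchyKernel (x + y * Complex.I) η).im := by
  have hD := normSq_cauchyDenom_pos hx y η
  rw [cauchyKernel_im, cauchyKernel_re]
  have h1 : y ^ 2 / x * (2 * x * (x ^ 2 + y ^ 2 + η ^ 2)
      / ((x ^ 2 - y ^ 2 + η ^ 2) ^ 2 + (2 * x * y) ^ 2))
      = 2 * y ^ 2 * (x ^ 2 + y ^ 2 + η ^ 2)
        / ((x ^ 2 - y ^ 2 + η ^ 2) ^ 2 + (2 * x * y) ^ 2) := by
    field_simp
  rw [h1, ← neg_div, ← mul_div_assoc]
  refine div_le_div_of_nonneg_right ?_ hD.le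
  nlinarith [mul_nonneg (sq_nonneg η) (sq_nonneg y)]

theorem continuous_cauchyKernel {x : ℝ} (hx : 0 < x) (y : ℝ) :
    Continuous (cauchyKernel (x + y * Complex.I)) := by
  unfold cauchyKernel
  refine Continuous.div (by fun_prop) (by fun_prop) fun η h => ?_
  have := normSq_cauchyDenom_pos hx y η
  rw [← normSq_cauchyDenom, h, map_zero] at this
  exact lt_irrefl _ this

/-- The squared modulus of the denominator factors as (x²+(y-η)²)(x²+(y+η)²), and each factor
dominates a multiple of 1 + η². -/
theorem norm_cauchyKernel_le {x : ℝ} (hx : 0 < x) (y η : ℝ) :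
    ‖cauchyKernel (x + y * Complex.I) η‖
      ≤ ‖2 * ((x : ℂ) + y * Complex.I)‖ * (2 + (1 + 2 * y ^ 2) / x ^ 2) * (1 + η ^ 2)⁻¹ := by
  set K := 2 + (1 + 2 * y ^ 2) / x ^ 2 with hK
  have hK0 : 0 < K := by positivity
  -- Stated for σ with σ² = η², so that one computation covers both factors, σ = η and σ = -η.
  have hb : ∀ σ : ℝ, 1 + η ^ 2 ≤ K * (x ^ 2 + (y - σ) ^ 2) ∨ σ ^ 2 ≠ η ^ 2 := by
    intro σ
    by_cases h : σ ^ 2 = η ^ 2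
    · left
      have h2 : (1 + 2 * y ^ 2) / x ^ 2 * (x ^ 2 + (y - σ) ^ 2) ≥ 1 + 2 * y ^ 2 := by
        rw [div_mul_eq_mul_div, ge_iff_le, le_div_iff₀ (by positivity)]
        nlinarith [sq_nonneg (y - σ), mul_nonneg (sq_nonneg y) (sq_nonneg (y - σ))]
      rw [hK, add_mul, ← h]
      nlinarith [sq_nonneg (σ - 2 * y), sq_nonneg x]
    · exact Or.inr h
  have h1 : 1 + η ^ 2 ≤ K * (x ^ 2 + (y - η) ^ 2) := (hb η).resolve_right (by simp)
  have h2 : 1 + η ^ 2 ≤ K * (x ^ 2 + (y + η) ^ 2) := by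
    have := (hb (-η)).resolve_right (by simp)
    rwa [sub_neg_eq_add] at this
  have h3 : ((1 + η ^ 2) / K) ^ 2 ≤ ‖((x : ℂ) + y * Complex.I) ^ 2 + (η : ℂ) ^ 2‖ ^ 2 := by
    rw [← Complex.normSq_eq_norm_sq, normSq_cauchyDenom, div_pow, div_le_iff₀ (by positivity)]
    calc (1 + η ^ 2) ^ 2 ≤ (K * (x ^ 2 + (y - η) ^ 2)) * (K * (x ^ 2 + (y + η) ^ 2)) := by
          rw [pow_two]; exact mul_le_mul h1 h2 (by positivity) (by positivity)
      _ = _ := by ring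
  have h4 := le_of_sq_le_sq h3 (norm_nonneg _)
  rw [cauchyKernel, norm_div, mul_assoc, div_eq_mul_inv]
  refine mul_le_mul_of_nonneg_left ?_ (norm_nonneg _)
  rw [← div_eq_mul_inv, inv_eq_one_div, div_le_div_iff₀
    (lt_of_lt_of_le (by positivity) h4) (by positivity), one_mul]
  rwa [div_le_iff₀' hK0] at h4

theorem integrable_cauchyKernel {x : ℝ} (hx : 0 < x) (y : ℝ) :
    Integrable (cauchyKernel (x + y * Complex.I)) :=
  (integrable_inv_one_add_sq.const_mul _).mono'
    (continuous_cauchyKernel hx y).aestronglyMeasurable (ae_of_all _ (norm_cauchyKernel_le hx y))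

theorem integrable_exp_neg_mul_abs {ζ : ℂ} (hζ : 0 < ζ.re) :
    Integrable fun t : ℝ => Complex.exp (-ζ * |t|) := by
  rw [← integrableOn_univ, ← Iic_union_Ioi (a := (0 : ℝ))]
  refine IntegrableOn.union ?_ ?_
  · refine (integrableOn_exp_mul_complex_Iic hζ 0).congr_fun (fun t ht => ?_) measurableSet_Iic
    simp only [abs_of_nonpos (show t ≤ 0 from ht)]
    push_cast
    ring_nf
  · refine (integrableOn_exp_mul_complex_Ioi (a := -ζ) (by simpa using hζ) 0).congr_fun
      (fun t ht => ?_) measurableSet_Ioi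
    simp only [abs_of_pos (show 0 < t from ht)]

theorem fourier_exp_neg_mul_abs {ζ : ℂ} (hζ : 0 < ζ.re) (w : ℝ) :
    𝓕 (fun t : ℝ => Complex.exp (-ζ * |t|)) w = cauchyKernel ζ (2 * Real.pi * w) := by
  set θ : ℂ := 2 * Real.pi * w * Complex.I with hθ
  have hθre : θ.re = 0 := by simp [hθ]
  have hi := integrable_exp_neg_mul_abs hζ
  have h1 : ∀ t : ℝ, Complex.exp (↑(-2 * Real.pi * t * w) * Complex.I)
      • Complex.exp (-ζ * |t|) = Complex.exp (-θ * t + -ζ * |t|) := by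
    intro t
    rw [smul_eq_mul, ← Complex.exp_add, hθ]
    push_cast
    ring_nf
  rw [Real.fourier_real_eq_integral_exp_smul]
  simp_rw [h1]
  have e1 : EqOn (fun t : ℝ => Complex.exp (-θ * t + -ζ * |t|))
      (fun t : ℝ => Complex.exp ((ζ - θ) * t)) (Iic 0) := by
    intro t ht
    simp only [abs_of_nonpos (show t ≤ 0 from ht)]
    push_cast
    ring_nf
  have e2 : EqOn (fun t : ℝ => Complex.exp (-θ * t + -ζ * |t|))
      (fun t : ℝ => Complex.exp (-(ζ + θ) * t)) (Ioi 0) := by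
    intro t ht
    simp only [abs_of_pos (show 0 < t from ht)]
    ring_nf
  have r1 : 0 < (ζ - θ).re := by simpa [hθre] using hζ
  have r2 : (-(ζ + θ)).re < 0 := by simpa [hθre] using hζ
  have n1 : ζ - θ ≠ 0 := fun h => by simp [h] at r1
  have n2 : ζ + θ ≠ 0 := fun h => by simp [h] at r2
  have i1 := (integrableOn_exp_mul_complex_Iic r1 0).congr_fun e1.symm measurableSet_Iic
  have i2 := (integrableOn_exp_mul_complex_Ioi r2 0).congr_fun e2.symm measurableSet_Ioi
  rw [← intervalIntegral.integral_Iic_add_Ioi i1 i2, setIntegral_congr_fun measurableSet_Iic e1,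
    setIntegral_congr_fun measurableSet_Ioi e2, integral_exp_mul_complex_Iic r1,
    integral_exp_mul_complex_Ioi r2, cauchyKernel]
  have n3 : ζ ^ 2 + ((2 * Real.pi * w : ℝ) : ℂ) ^ 2 = (ζ - θ) * (ζ + θ) := by
    rw [hθ]
    push_cast
    linear_combination (2 * Real.pi * w : ℂ) ^ 2 * Complex.I_sq
  rw [n3]
  simp only [Complex.ofReal_zero, mul_zero, Complex.exp_zero]
  field_simp
  ring

/-- Fourier inversion for exp(-ζ|t|), evaluated at -t because the forward transform is wanted. -/
theorem fourier_cauchyKernel {x : ℝ} (hx : 0 < x) (y t : ℝ) :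
    𝓕 (fun w : ℝ => cauchyKernel (x + y * Complex.I) (2 * Real.pi * w)) t
      = Complex.exp (-(x + y * Complex.I) * |t|) := by
  set ζ : ℂ := x + y * Complex.I with hζdef
  have hζ : 0 < ζ.re := by simpa [hζdef] using hx
  have hF : 𝓕 (fun t : ℝ => Complex.exp (-ζ * |t|))
      = fun w : ℝ => cauchyKernel ζ (2 * Real.pi * w) := funext (fourier_exp_neg_mul_abs hζ)
  have hcont : Continuous fun t : ℝ => Complex.exp (-ζ * |t|) := by fun_prop
  have h := hcont.fourierInv_fourier_eq (integrable_exp_neg_mul_abs hζ)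
    (by rw [hF]; exact (integrable_cauchyKernel hx y).comp_mul_left' (by positivity))
  rw [hF] at h
  have h2 := congrFun h (-t)
  rw [Real.fourierInv_eq_fourier_neg, neg_neg, abs_neg] at h2
  exact h2

end Cauchy

/-! ### The Laplace transform as the Fourier transform of a weighted kernel -/

section Laplace

variable {a : ℝ → ℝ}

/-- The weighted kernel `e^{βt} a(t)`, extended by `0` to the negative axis. -/
def weighted (a : ℝ → ℝ) (β : ℝ) : ℝ → ℂ :=
  (Ioi (0 : ℝ)).indicator fun t => ((Real.exp (β * t) * a t : ℝ) : ℂ)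

theorem laplace_eq_fourier_weighted (a : ℝ → ℝ) (β w : ℝ) :
    laplace a (-β + (2 * Real.pi * w : ℝ) * Complex.I) = 𝓕 (weighted a β) w := by
  rw [Real.fourier_real_eq_integral_exp_smul, laplace, ← integral_indicator measurableSet_Ioi]
  refine integral_congr_ae (ae_of_all _ fun t => ?_)
  by_cases ht : t ∈ Ioi (0 : ℝ)
  · simp only [weighted, indicator_of_mem ht, smul_eq_mul]
    push_cast
    rw [← mul_assoc, ← Complex.exp_add]
    congr 2
    ring
  · simp only [weighted, indicator_of_notMem ht, smul_zero]

theorem laplace_eq_fourier_weighted' (a : ℝ → ℝ) (β y : ℝ) :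
    laplace a (-β + y * Complex.I) = 𝓕 (weighted a β) (y / (2 * Real.pi)) := by
  rw [← laplace_eq_fourier_weighted]
  congr 4
  field_simp

theorem integrableOn_exp_mul_of_le {α β : ℝ}
    (ha : IntegrableOn (fun t => Real.exp (α * t) * a t) (Ioi 0)) (hβ : β ≤ α) :
    IntegrableOn (fun t => Real.exp (β * t) * a t) (Ioi 0) := by
  have hm : AEStronglyMeasurable (fun t => Real.exp (β * t) * a t) (volume.restrict (Ioi 0)) := by
    have h2 : Continuous fun t : ℝ => Real.exp ((β - α) * t) := by fun_prop
    refine (h2.aestronglyMeasurable.mul ha.aestronglyMeasurable).congr (ae_of_all _ fun t => ?_)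
    simp only [Pi.mul_apply]
    rw [← mul_assoc, ← Real.exp_add]
    ring_nf
  refine Integrable.mono ha hm ((ae_restrict_iff' measurableSet_Ioi).2 (ae_of_all _ fun t ht => ?_))
  rw [norm_mul, norm_mul]
  refine mul_le_mul_of_nonneg_right ?_ (norm_nonneg _)
  rw [Real.norm_eq_abs, Real.norm_eq_abs, Real.abs_exp, Real.abs_exp]
  exact Real.exp_le_exp.2 (mul_le_mul_of_nonneg_right hβ (le_of_lt ht))

theorem integrableOn_of_exp_mul {α : ℝ} (hα : 0 ≤ α)
    (ha : IntegrableOn (fun t => Real.exp (α * t) * a t) (Ioi 0)) : IntegrableOn a (Ioi 0) := by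
  simpa using integrableOn_exp_mul_of_le ha hα

theorem integrable_weighted {α β : ℝ}
    (ha : IntegrableOn (fun t => Real.exp (α * t) * a t) (Ioi 0)) (hβ : β ≤ α) :
    Integrable (weighted a β) :=
  IntegrableOn.integrable_indicator
    (show IntegrableOn (fun t => ((Real.exp (β * t) * a t : ℝ) : ℂ)) (Ioi 0) volume from
      (integrableOn_exp_mul_of_le ha hβ).ofReal) measurableSet_Ioi

theorem fourier_weighted_neg (a : ℝ → ℝ) (β w : ℝ) :
    𝓕 (weighted a β) (-w) = (starRingEnd ℂ) (𝓕 (weighted a β) w) := by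
  rw [Real.fourier_real_eq_integral_exp_smul, Real.fourier_real_eq_integral_exp_smul,
    ← integral_conj]
  refine integral_congr_ae (ae_of_all _ fun t => ?_)
  have h1 : (starRingEnd ℂ) (weighted a β t) = weighted a β t := by
    by_cases ht : t ∈ Ioi (0 : ℝ)
    · simp only [weighted, indicator_of_mem ht, Complex.conj_ofReal]
    · simp only [weighted, indicator_of_notMem ht, map_zero]
  simp only [smul_eq_mul, map_mul, h1, ← Complex.exp_conj, Complex.conj_I, Complex.conj_ofReal]
  congr 2
  push_cast
  ring

theorem continuous_fourier_weighted {α β : ℝ}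
    (ha : IntegrableOn (fun t => Real.exp (α * t) * a t) (Ioi 0)) (hβ : β ≤ α) :
    Continuous (𝓕 (weighted a β)) :=
  VectorFourier.fourierIntegral_continuous Real.continuous_fourierChar
      continuous_inner (integrable_weighted ha hβ)

theorem norm_fourier_le {f : ℝ → ℂ} (w : ℝ) : ‖𝓕 f w‖ ≤ ∫ t, ‖f t‖ :=
  VectorFourier.norm_fourierIntegral_le_integral_norm _ _ _ _ _

/-- The Laplace transform inside the half plane is the Poisson-type integral of the boundary
values of its real part. -/
theorem laplace_eq_integral_cauchyKernel {α x : ℝ}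
    (ha : IntegrableOn (fun t => Real.exp (α * t) * a t) (Ioi 0)) (hx : 0 < x) (y : ℝ) :
    laplace a (-(α - x : ℝ) + y * Complex.I)
      = ∫ w : ℝ, ((𝓕 (weighted a α) w).re : ℂ)
        * cauchyKernel (x + y * Complex.I) (2 * Real.pi * w) := by
  set Ψ : ℝ → ℂ := fun w => cauchyKernel (x + y * Complex.I) (2 * Real.pi * w) with hΨ
  have hΨi : Integrable Ψ := (integrable_cauchyKernel hx y).comp_mul_left' (by positivity)
  have hw := integrable_weighted ha le_rfl
  have hc := continuous_fourier_weighted ha le_rfl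
  have hΨeven : ∀ w, Ψ (-w) = Ψ w := fun w => by simp [hΨ, cauchyKernel]
  have hprod : Integrable fun w => 𝓕 (weighted a α) w * Ψ w :=
    hΨi.bdd_mul hc.aestronglyMeasurable (ae_of_all _ fun w => norm_fourier_le w)
  have hprod' : Integrable fun w => (starRingEnd ℂ) (𝓕 (weighted a α) w) * Ψ w := by
    refine hΨi.bdd_mul (c := ∫ t, ‖weighted a α t‖)
      (Complex.continuous_conj.comp hc).aestronglyMeasurable (ae_of_all _ fun w => ?_)
    exact (RCLike.norm_conj _).trans_le (norm_fourier_le w)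
  -- The weighted kernel lives on t > 0, where |t| = t, so the transform of Ψ becomes the factor
  -- exp(-ζt) that moves the line of integration to the right.
  have e1 : ∫ w, 𝓕 (weighted a α) w * Ψ w = laplace a (-(α - x : ℝ) + y * Complex.I) := by
    rw [integral_fourier_mul_flip hw hΨi, laplace, ← integral_indicator measurableSet_Ioi]
    refine integral_congr_ae (ae_of_all _ fun t => ?_)
    change weighted a α t * 𝓕 Ψ t = _
    rw [hΨ, fourier_cauchyKernel hx]
    by_cases ht : t ∈ Ioi (0 : ℝ)
    · simp only [weighted, indicator_of_mem ht, abs_of_pos (show 0 < t from ht)]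
      push_cast
      rw [mul_right_comm, ← Complex.exp_add]
      congr 2
      ring
    · simp only [weighted, indicator_of_notMem ht, zero_mul]
  -- Since a is real, conjugation of its transform is reflection of the frequency, and Ψ is even.
  -- The conjugate boundary values thus give the same integral, and averaging leaves only the real
  -- part.
  have e2 : ∫ w, (starRingEnd ℂ) (𝓕 (weighted a α) w) * Ψ w
      = laplace a (-(α - x : ℝ) + y * Complex.I) := by
    rw [← e1, ← integral_neg_eq_self]
    refine integral_congr_ae (ae_of_all _ fun w => ?_)
    simp only [fourier_weighted_neg, hΨeven, Complex.conj_conj]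
  have e3 : (2 : ℂ) * ∫ w : ℝ, ((𝓕 (weighted a α) w).re : ℂ) * Ψ w
      = 2 * laplace a (-(α - x : ℝ) + y * Complex.I) := by
    rw [two_mul (laplace a _)]
    nth_rewrite 1 [← e1]
    rw [← e2, ← integral_add hprod hprod', ← integral_const_mul]
    refine integral_congr_ae (ae_of_all _ fun w => ?_)
    simp only
    rw [← add_mul, Complex.add_conj]
    push_cast
    ring
  exact (mul_left_cancel₀ two_ne_zero e3).symm

end Laplace


/-! ### Lower bounds for the symbol a₀ + ã in a strip -/

section Symbol

variable {a₀ α : ℝ} {a : ℝ → ℝ}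

/-- Lower bounds for the symbol `a₀ + ã` on the lines `Re z = -β`, `0 ≤ β ≤ b`. -/
def SymbolBound (a₀ : ℝ) (a : ℝ → ℝ) (b c M : ℝ) : Prop :=
  ∀ β ∈ Icc 0 b, ∀ y : ℝ,
    c / (1 + y ^ 2) ≤ a₀ + (laplace a (-β + y * Complex.I)).re ∧
    -(M * (1 + y ^ 2) * (a₀ + (laplace a (-β + y * Complex.I)).re))
      ≤ y * (laplace a (-β + y * Complex.I)).im

theorem norm_weighted_le (a : ℝ → ℝ) {β β' : ℝ} (h : β ≤ β') (t : ℝ) :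
    ‖weighted a β t‖ ≤ ‖weighted a β' t‖ := by
  by_cases ht : t ∈ Ioi (0 : ℝ)
  · simp only [weighted, indicator_of_mem ht, Complex.norm_real, norm_mul]
    refine mul_le_mul_of_nonneg_right ?_ (norm_nonneg _)
    rw [Real.norm_eq_abs, Real.norm_eq_abs, Real.abs_exp, Real.abs_exp]
    exact Real.exp_le_exp.2 (mul_le_mul_of_nonneg_right h (le_of_lt ht))
  · simp only [weighted, indicator_of_notMem ht, le_refl]

theorem norm_fourier_sub_le {f g : ℝ → ℂ} (hf : Integrable f) (hg : Integrable g) (w : ℝ) :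
    ‖𝓕 f w - 𝓕 g w‖ ≤ ∫ t, ‖f t - g t‖ := by
  have h := norm_fourier_le (f := fun t => f t - g t) w
  rw [Real.fourier_eq] at h ⊢
  rw [Real.fourier_eq, ← integral_sub ((Real.fourierIntegral_convergent_iff w).2 hf)
    ((Real.fourierIntegral_convergent_iff w).2 hg)]
  simpa only [smul_sub] using h

theorem tendsto_integral_weighted_sub
    (hα : 0 < α) (ha : IntegrableOn (fun t => Real.exp (α * t) * a t) (Ioi 0)) :
    Tendsto (fun β => ∫ t, ‖weighted a β t - weighted a 0 t‖) (𝓝 0) (𝓝 0) := by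
  have hz : ∫ t, ‖weighted a 0 t - weighted a 0 t‖ = 0 := by simp
  suffices key : Tendsto (fun β => ∫ t, ‖weighted a β t - weighted a 0 t‖) (𝓝 0)
      (𝓝 (∫ t, ‖weighted a 0 t - weighted a 0 t‖)) by rwa [hz] at key
  refine tendsto_integral_filter_of_dominated_convergence
    (fun t => 2 * ‖weighted a α t‖) ?_ ?_
    ((integrable_weighted ha le_rfl).norm.const_mul 2) (ae_of_all _ fun t => ?_)
  · filter_upwards [Iio_mem_nhds hα] with β hβ
    exact ((integrable_weighted ha (le_of_lt hβ)).sub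
      (integrable_weighted ha hα.le)).aestronglyMeasurable.norm
  · filter_upwards [Iio_mem_nhds hα] with β hβ
    refine ae_of_all _ fun t => ?_
    rw [norm_norm, two_mul]
    exact (norm_sub_le _ _).trans
      (add_le_add (norm_weighted_le a (le_of_lt hβ) t) (norm_weighted_le a hα.le t))
  · have : Continuous fun β => ‖weighted a β t - weighted a 0 t‖ := by
      by_cases ht : t ∈ Ioi (0 : ℝ)
      · simp only [weighted, indicator_of_mem ht]
        fun_prop
      · simp only [weighted, indicator_of_notMem ht]
        fun_prop
    exact this.tendsto 0

/-- Near infinity the positive limit gives the bound; on the remaining compact set the minimum is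
attained. -/
theorem exists_pos_le_of_tendsto_cocompact {g : ℝ → ℝ} (hg : Continuous g) (hpos : ∀ x, 0 < g x)
    {l : ℝ} (hl : 0 < l) (h : Tendsto g (cocompact ℝ) (𝓝 l)) : ∃ c > 0, ∀ x, c ≤ g x := by
  obtain ⟨K, hK, hsub⟩ := mem_cocompact.1 (h.eventually (lt_mem_nhds (half_lt_self hl)))
  rcases K.eq_empty_or_nonempty with rfl | hne
  · exact ⟨l / 2, half_pos hl, fun x => le_of_lt (hsub (by simp))⟩
  · obtain ⟨x₀, -, hx₀⟩ := hK.exists_isMinOn hne hg.continuousOn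
    refine ⟨min (l / 2) (g x₀), lt_min (half_pos hl) (hpos _), fun x => ?_⟩
    by_cases hx : x ∈ K
    · exact (min_le_right _ _).trans (hx₀ hx)
    · exact (min_le_left _ _).trans (le_of_lt (hsub hx))

/-- By Riemann–Lebesgue the real part tends to a₀ > 0 at infinity, so positivity on the axis is
uniform. The weighted kernels depend continuously on β in L¹, so a small shift of the line loses at
most half of the bound. The imaginary part is simply bounded. -/
theorem exists_symbolBound_of_pos_axis (hα : 0 < α)
    (ha : IntegrableOn (fun t => Real.exp (α * t) * a t) (Ioi 0)) (ha₀ : 0 < a₀)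
    (hpos : ∀ y : ℝ, 0 < a₀ + (laplace a (y * Complex.I)).re) :
    ∃ b > 0, ∃ c > 0, ∃ M ≥ 0, b ≤ α ∧ SymbolBound a₀ a b c M := by
  have hF0 : ∀ w, laplace a ((2 * Real.pi * w : ℝ) * Complex.I) = 𝓕 (weighted a 0) w := by
    intro w
    rw [← laplace_eq_fourier_weighted]
    simp
  have hcont : Continuous fun w => a₀ + (𝓕 (weighted a 0) w).re :=
    continuous_const.add (Complex.continuous_re.comp (continuous_fourier_weighted ha hα.le))
  have hlim : Tendsto (fun w => a₀ + (𝓕 (weighted a 0) w).re) (cocompact ℝ) (𝓝 a₀) := by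
    have h := (Complex.continuous_re.tendsto 0).comp (Real.zero_at_infty_fourier (weighted a 0))
    simpa using h.const_add a₀
  obtain ⟨c, hc, hcle⟩ := exists_pos_le_of_tendsto_cocompact hcont
    (fun w => by rw [← hF0]; exact hpos _) ha₀ hlim
  obtain ⟨ε, hε, hR⟩ := Metric.eventually_nhds_iff.1
    ((tendsto_integral_weighted_sub hα ha).eventually (gt_mem_nhds (half_pos hc)))
  set I := ∫ t, ‖weighted a α t‖ with hI
  have hI0 : 0 ≤ I := integral_nonneg fun _ => norm_nonneg _
  refine ⟨min (ε / 2) α, by positivity, c / 2, by positivity, I / (c / 2), by positivity,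
    min_le_right _ _, fun β hβ y => ?_⟩
  have hβα : β ≤ α := hβ.2.trans (min_le_right _ _)
  have hβε : β ≤ ε / 2 := hβ.2.trans (min_le_left _ _)
  rw [laplace_eq_fourier_weighted']
  set w := y / (2 * Real.pi)
  have h1 := hcle w
  have h2 : ‖𝓕 (weighted a β) w - 𝓕 (weighted a 0) w‖ < c / 2 :=
    (norm_fourier_sub_le (integrable_weighted ha hβα) (integrable_weighted ha hα.le) w).trans_lt
      (hR (by rw [Real.dist_eq, sub_zero, abs_of_nonneg hβ.1]; linarith))
  have h3 := (Complex.abs_re_le_norm _).trans_lt h2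
  rw [Complex.sub_re, abs_lt] at h3
  have h4 : c / 2 ≤ a₀ + (𝓕 (weighted a β) w).re := by linarith [h3.1]
  refine ⟨le_trans (div_le_self (half_pos hc).le (by nlinarith [sq_nonneg y])) h4, ?_⟩
  have h5 : |(𝓕 (weighted a β) w).im| ≤ I :=
    (Complex.abs_im_le_norm _).trans ((norm_fourier_le w).trans
      (integral_mono (integrable_weighted ha hβα).norm (integrable_weighted ha le_rfl).norm
        (norm_weighted_le a hβα)))
  have h6 : |y * (𝓕 (weighted a β) w).im| ≤ (1 + y ^ 2) * I := by
    rw [abs_mul]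
    refine mul_le_mul ?_ h5 (abs_nonneg _) (by positivity)
    nlinarith [sq_nonneg (|y| - 1), sq_abs y]
  have h7 : (1 + y ^ 2) * I
      ≤ I / (c / 2) * (1 + y ^ 2) * (a₀ + (𝓕 (weighted a β) w).re) := by
    calc (1 + y ^ 2) * I = I / (c / 2) * (1 + y ^ 2) * (c / 2) := by field_simp
      _ ≤ _ := mul_le_mul_of_nonneg_left h4 (by positivity)
  linarith [neg_abs_le (y * (𝓕 (weighted a β) w).im)]

theorem laplace_eq_zero_of_ae (h : ∀ᵐ t ∂volume.restrict (Ioi (0 : ℝ)), a t = 0) (z : ℂ) :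
    laplace a z = 0 := by
  rw [laplace]
  refine integral_eq_zero_of_ae ?_
  filter_upwards [h] with t ht
  simp [ht]

theorem ae_eq_zero_of_laplace_eq_zero
    (ha : IntegrableOn (fun t => Real.exp (α * t) * a t) (Ioi 0)) {β : ℝ} (hβ : β ≤ α)
    (h : ∀ y : ℝ, laplace a (-β + y * Complex.I) = 0) :
    ∀ᵐ t ∂volume.restrict (Ioi (0 : ℝ)), a t = 0 := by
  have h0 := ae_eq_zero_of_fourier_eq_zero (integrable_weighted ha hβ)
    fun w => by rw [← laplace_eq_fourier_weighted]; exact h _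
  rw [ae_restrict_iff' measurableSet_Ioi]
  filter_upwards [h0] with t ht hpos
  rw [weighted, indicator_of_mem hpos, Pi.zero_apply, Complex.ofReal_eq_zero] at ht
  exact (mul_eq_zero.1 ht).resolve_left (Real.exp_ne_zero _)

/-- Inside the half plane the transform is an integral of its non-negative boundary real part
against the Cauchy kernel, so the pointwise bounds for that kernel integrate to both inequalities.
At distance x ≥ α/2 from the boundary line the constants are uniform. -/
theorem exists_symbolBound_of_nonneg_line (hα : 0 < α)
    (ha : IntegrableOn (fun t => Real.exp (α * t) * a t) (Ioi 0)) (ha₀ : 0 ≤ a₀)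
    (hpos : ∀ y : ℝ, 0 ≤ (laplace a (-α + y * Complex.I)).re)
    (hne : ¬ ∀ᵐ t ∂volume.restrict (Ioi (0 : ℝ)), a t = 0) :
    ∃ b > 0, ∃ c > 0, ∃ M ≥ 0, b ≤ α ∧ SymbolBound a₀ a b c M := by
  set H : ℝ → ℝ := fun w => (𝓕 (weighted a α) w).re with hH
  have hH0 : ∀ w, 0 ≤ H w := fun w => by
    rw [hH]; simp only; rw [← laplace_eq_fourier_weighted]; exact hpos _
  have hHc : Continuous H := Complex.continuous_re.comp (continuous_fourier_weighted ha le_rfl)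
  have hHb : ∀ w, ‖H w‖ ≤ ∫ t, ‖weighted a α t‖ := fun w =>
    (Complex.abs_re_le_norm _).trans (norm_fourier_le w)
  have hΨi : ∀ {x : ℝ}, 0 < x → ∀ y : ℝ,
      Integrable fun w : ℝ => cauchyKernel (x + y * Complex.I) (2 * Real.pi * w) := fun hx y =>
    (integrable_cauchyKernel hx y).comp_mul_left' (by positivity)
  have hRe : ∀ {x : ℝ}, 0 < x → ∀ y : ℝ, Integrable fun w : ℝ =>
      H w * (cauchyKernel (x + y * Complex.I) (2 * Real.pi * w)).re := fun hx y =>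
    (hΨi hx y).re.bdd_mul hHc.aestronglyMeasurable (ae_of_all _ hHb)
  have hIm : ∀ {x : ℝ}, 0 < x → ∀ y : ℝ, Integrable fun w : ℝ =>
      H w * (cauchyKernel (x + y * Complex.I) (2 * Real.pi * w)).im := fun hx y =>
    (hΨi hx y).im.bdd_mul hHc.aestronglyMeasurable (ae_of_all _ hHb)
  have hprod : ∀ {x : ℝ}, 0 < x → ∀ y : ℝ, Integrable fun w : ℝ =>
      (H w : ℂ) * cauchyKernel (x + y * Complex.I) (2 * Real.pi * w) := fun hx y =>
    (hΨi hx y).bdd_mul (Complex.continuous_ofReal.comp hHc).aestronglyMeasurable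
      (c := ∫ t, ‖weighted a α t‖)
      (ae_of_all _ fun w => (Complex.norm_real _).trans_le (hHb w))
  have eRe : ∀ {x : ℝ}, 0 < x → ∀ y : ℝ, (laplace a (-(α - x : ℝ) + y * Complex.I)).re
      = ∫ w : ℝ, H w * (cauchyKernel (x + y * Complex.I) (2 * Real.pi * w)).re := by
    intro x hx y
    rw [laplace_eq_integral_cauchyKernel ha hx]
    refine (integral_re (𝕜 := ℂ) (hprod hx y)).symm.trans ?_
    simp only [RCLike.re_eq_complex_re, Complex.re_ofReal_mul]
  have eIm : ∀ {x : ℝ}, 0 < x → ∀ y : ℝ, (laplace a (-(α - x : ℝ) + y * Complex.I)).im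
      = ∫ w : ℝ, H w * (cauchyKernel (x + y * Complex.I) (2 * Real.pi * w)).im := by
    intro x hx y
    rw [laplace_eq_integral_cauchyKernel ha hx]
    refine (integral_im (𝕜 := ℂ) (hprod hx y)).symm.trans ?_
    simp only [RCLike.im_eq_complex_im, Complex.im_ofReal_mul]
  -- the Poisson mass of the boundary values
  set P : ℝ → ℝ := fun w => α / (1 + α ^ 2 + (2 * Real.pi * w) ^ 2) with hP
  have hPpos : ∀ w, 0 < P w := fun w => by simp only [hP]; positivity
  have hPle : ∀ {x : ℝ}, α / 2 ≤ x → x ≤ α → ∀ y w : ℝ,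
      P w / (1 + y ^ 2) ≤ (cauchyKernel (x + y * Complex.I) (2 * Real.pi * w)).re := by
    intro x hx hxα y w
    have hx0 : 0 < x := (half_pos hα).trans_le hx
    refine le_trans ?_ (le_cauchyKernel_re hx0 y (2 * Real.pi * w))
    simp only [hP]
    rw [div_div]
    refine div_le_div₀ (by linarith) (by linarith) (by positivity) ?_
    have : x ^ 2 ≤ α ^ 2 := pow_le_pow_left₀ hx0.le hxα 2
    nlinarith [mul_nonneg (sq_nonneg y) (sq_nonneg α),
      mul_nonneg (sq_nonneg y) (sq_nonneg (2 * Real.pi * w))]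
  have hPc : Continuous P := by
    simp only [hP]
    exact Continuous.div (by fun_prop) (by fun_prop) fun w => by positivity
  have hPi : Integrable fun w => H w * P w := by
    refine (hRe hα 0).mono' (hHc.mul hPc).aestronglyMeasurable (ae_of_all _ fun w => ?_)
    rw [Real.norm_eq_abs, abs_of_nonneg (mul_nonneg (hH0 w) (hPpos w).le)]
    refine mul_le_mul_of_nonneg_left ?_ (hH0 w)
    simpa using hPle (by linarith) le_rfl 0 w
  have hc : 0 < ∫ w, H w * P w := by
    refine lt_of_le_of_ne (integral_nonneg fun w => mul_nonneg (hH0 w) (hPpos w).le) fun h0 => ?_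
    have h1 := (integral_eq_zero_iff_of_nonneg
      (fun w => mul_nonneg (hH0 w) (hPpos w).le) hPi).1 h0.symm
    have h2 : (fun w => H w * P w) = 0 :=
      (hHc.mul hPc).ae_eq_iff_eq volume continuous_zero |>.1 h1
    have h3 : ∀ w, H w = 0 := fun w =>
      (mul_eq_zero.1 (congrFun h2 w)).resolve_right (hPpos w).ne'
    -- The boundary real part alone determines the whole transform, so its vanishing forces a = 0
    -- almost everywhere. The form α - α of the exponent matches the representation formula at x =
    -- α.
    refine hne (ae_eq_zero_of_laplace_eq_zero ha (β := α - α) (by linarith) fun y => ?_)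
    rw [laplace_eq_integral_cauchyKernel ha hα]
    simp only [hH] at h3
    simp [h3]
  -- With x = α - β at least α/2 one has y²/x ≤ (2/α)(1 + y²), which gives M = 2/α.
  refine ⟨α / 2, half_pos hα, ∫ w, H w * P w, hc, 2 / α, by positivity, by linarith,
    fun β hβ y => ?_⟩
  obtain ⟨x, rfl⟩ : ∃ x, β = α - x := ⟨α - β, by ring⟩
  have hx1 : α / 2 ≤ x := by linarith [hβ.2]
  have hx2 : x ≤ α := by linarith [hβ.1]
  have hx : 0 < x := (half_pos hα).trans_le hx1
  have hre : (∫ w, H w * P w) / (1 + y ^ 2)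
      ≤ (laplace a (-(α - x : ℝ) + y * Complex.I)).re := by
    rw [eRe hx, ← integral_div]
    refine integral_mono (hPi.div_const _) (hRe hx y) fun w => ?_
    simp only
    rw [mul_div_assoc]
    exact mul_le_mul_of_nonneg_left (hPle hx1 hx2 y w) (hH0 w)
  have hre0 : 0 ≤ (laplace a (-(α - x : ℝ) + y * Complex.I)).re :=
    le_trans (by positivity) hre
  have him : -(y ^ 2 / x * (laplace a (-(α - x : ℝ) + y * Complex.I)).re)
      ≤ y * (laplace a (-(α - x : ℝ) + y * Complex.I)).im := by
    rw [eIm hx, eRe hx, ← integral_const_mul, ← integral_const_mul, ← integral_neg]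
    refine integral_mono ((hRe hx y).const_mul _).neg ((hIm hx y).const_mul _) fun w => ?_
    have := mul_le_mul_of_nonneg_left
      (neg_le_mul_cauchyKernel_im hx y (2 * Real.pi * w)) (hH0 w)
    simp only
    linarith
  refine ⟨by linarith, le_trans (neg_le_neg ?_) him⟩
  have h1 : y ^ 2 / x ≤ 2 / α * (1 + y ^ 2) := by
    rw [div_mul_eq_mul_div, div_le_div_iff₀ hx hα]
    nlinarith [sq_nonneg y, mul_le_mul_of_nonneg_left hx1 (sq_nonneg y)]
  refine mul_le_mul h1 (by linarith) hre0 (by positivity)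

/-- If a vanishes almost everywhere then a₀ > 0 and the symbol is the constant a₀, so the first case
applies whichever alternative was assumed. -/
theorem exists_symbolBound (ha₀ : 0 ≤ a₀) (hα : 0 < α)
    (ha : IntegrableOn (fun t => Real.exp (α * t) * a t) (Ioi 0))
    (hpos : (0 < a₀ ∧ ∀ y : ℝ, 0 < a₀ + (laplace a (y * Complex.I)).re) ∨
      ∀ y : ℝ, 0 ≤ (laplace a (-α + y * Complex.I)).re)
    (hne : a₀ ≠ 0 ∨ ¬ (∀ᵐ t ∂volume.restrict (Ioi (0 : ℝ)), a t = 0)) :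
    ∃ b > 0, ∃ c > 0, ∃ M ≥ 0, b ≤ α ∧ SymbolBound a₀ a b c M := by
  by_cases h0 : ∀ᵐ t ∂volume.restrict (Ioi (0 : ℝ)), a t = 0
  · have hpos₀ : 0 < a₀ := lt_of_le_of_ne ha₀ (hne.resolve_right (not_not.2 h0)).symm
    refine exists_symbolBound_of_pos_axis hα ha hpos₀ fun y => ?_
    rw [laplace_eq_zero_of_ae h0]
    simpa using hpos₀
  · rcases hpos with ⟨h1, h2⟩ | h
    · exact exists_symbolBound_of_pos_axis hα ha h1 h2
    · exact exists_symbolBound_of_nonneg_line hα ha ha₀ h h0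

theorem laplace_zero_eq (a : ℝ → ℝ) : laplace a 0 = ((∫ t in Ioi (0 : ℝ), a t : ℝ) : ℂ) := by
  rw [laplace, ← integral_complex_ofReal]
  simp

/-- The diffusivity is the value of the symbol at z = 0. -/
theorem diffusivity_pos {b c M : ℝ} (hb : 0 ≤ b) (hc : 0 < c) (h : SymbolBound a₀ a b c M) :
    0 < diffusivity a₀ a := by
  have h1 := (h 0 ⟨le_rfl, hb⟩ 0).1
  have h2 : (-((0 : ℝ) : ℂ) + ((0 : ℝ) : ℂ) * Complex.I) = 0 := by simp
  rw [h2, laplace_zero_eq, Complex.ofReal_re] at h1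
  have h3 : 0 < c / (1 + (0 : ℝ) ^ 2) := by positivity
  exact h3.trans_le h1

end Symbol

/-! ### Positivity of the memory form by Parseval -/

section Positivity

variable {a : ℝ → ℝ} {β : ℝ}

theorem fourier_fun_add {f g : ℝ → ℂ} (hf : Integrable f) (hg : Integrable g) (w : ℝ) :
    𝓕 (fun t => f t + g t) w = 𝓕 f w + 𝓕 g w := by
  rw [Real.fourier_eq, Real.fourier_eq, Real.fourier_eq,
    ← integral_add ((Real.fourierIntegral_convergent_iff w).2 hf)
    ((Real.fourierIntegral_convergent_iff w).2 hg)]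
  simp only [smul_add]

theorem fourier_fun_const_mul (c : ℂ) (f : ℝ → ℂ) (w : ℝ) :
    𝓕 (fun t => c * f t) w = c * 𝓕 f w := by
  rw [Real.fourier_eq, Real.fourier_eq, ← integral_const_mul]
  simp only [mul_smul_comm]

theorem weighted_convolution_eq_zero {g : ℝ → ℂ} (hg : ∀ t < 0, g t = 0) {t : ℝ} (ht : t < 0) :
    (weighted a β ⋆[ContinuousLinearMap.mul ℂ ℂ] g) t = 0 := by
  rw [convolution_def]
  refine integral_eq_zero_of_ae (ae_of_all _ fun s => ?_)
  simp only [ContinuousLinearMap.mul_apply', Pi.zero_apply]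
  by_cases hs : s ∈ Ioi (0 : ℝ)
  · rw [hg _ (by linarith [show 0 < s from hs]), mul_zero]
  · rw [weighted, indicator_of_notMem hs, zero_mul]

theorem weighted_convolution_eq {g : ℝ → ℂ} {G : ℝ → ℝ} {T : ℝ} (hg : ∀ t < 0, g t = 0)
    (hG : ∀ t ∈ Icc 0 T, g t = G t) {t : ℝ} (ht : t ∈ Icc 0 T) :
    (weighted a β ⋆[ContinuousLinearMap.mul ℂ ℂ] g) t
      = ((causalConv (fun s => Real.exp (β * s) * a s) G t : ℝ) : ℂ) := by
  rw [convolution_def, causalConv, intervalIntegral.integral_of_le ht.1,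
    ← integral_complex_ofReal, ← integral_indicator measurableSet_Ioc]
  refine integral_congr_ae (ae_of_all _ fun s => ?_)
  simp only [ContinuousLinearMap.mul_apply']
  by_cases hs : s ∈ Ioc 0 t
  · rw [indicator_of_mem hs, weighted, indicator_of_mem (show s ∈ Ioi (0 : ℝ) from hs.1),
      hG _ ⟨by linarith [hs.2], by linarith [hs.1, ht.2]⟩]
    push_cast [smul_eq_mul]
    rfl
  · rw [indicator_of_notMem hs]
    by_cases hs0 : s ∈ Ioi (0 : ℝ)
    · have : t < s := not_le.1 fun h => hs ⟨hs0, h⟩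
      rw [hg _ (by linarith), mul_zero]
    · rw [weighted, indicator_of_notMem hs0, zero_mul]

/-- The convolution with `e^{-t}`. -/
def expConv (f : ℝ → ℝ) : ℝ → ℝ := causalConv (fun s => Real.exp (-1 * s) * 1) f

theorem integrableOn_exp_neg_one : IntegrableOn (fun t : ℝ => Real.exp (-1 * t) * 1) (Ioi 0) := by
  simpa using integrableOn_exp_mul_Ioi (a := -1) (by norm_num) 0

theorem fourier_weighted_one (w : ℝ) :
    𝓕 (weighted (fun _ => 1) (-1)) w = 1 / (1 + (2 * Real.pi * w : ℝ) * Complex.I) := by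
  rw [← laplace_eq_fourier_weighted, laplace]
  have h : (-(1 + (2 * Real.pi * w : ℝ) * Complex.I)).re < 0 := by simp
  have h2 := integral_exp_mul_complex_Ioi h 0
  simp only [Complex.ofReal_zero, mul_zero, Complex.exp_zero] at h2
  simp only [Complex.ofReal_neg, Complex.ofReal_one, neg_neg, mul_one]
  rw [h2, neg_div_neg_eq]

/-- The positivity of the quadratic form of the memory operator, tested on `[0, T]`. -/
theorem integral_memOp_nonneg {α a₀ κ c T : ℝ} (hT : 0 ≤ T) {z : ℝ → ℝ}
    (hz : ContinuousOn z (Ici 0))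
    (ha : IntegrableOn (fun t => Real.exp (α * t) * a t) (Ioi 0)) (hβ : β ≤ α)
    (hm : ∀ w : ℝ, 0 ≤ ((a₀ + 𝓕 (weighted a β) w)
      + κ * ((a₀ + 𝓕 (weighted a β) w) / (1 + (2 * Real.pi * w : ℝ) * Complex.I))
      - c / (1 + (2 * Real.pi * w : ℝ) * Complex.I)).re) :
    0 ≤ ∫ t in (0 : ℝ)..T, z t * (memOp a₀ (fun s => Real.exp (β * s) * a s) z t
      + κ * expConv (memOp a₀ (fun s => Real.exp (β * s) * a s) z) t - c * expConv z t) := by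
  set k : ℝ → ℝ := fun s => Real.exp (β * s) * a s with hk
  set N := memOp a₀ k z with hN
  -- Truncating z to [0, T] makes Parseval available. All kernels are causal, so the convolutions
  -- with f agree on [0, T] with those of z; what they do after T is irrelevant because they are
  -- multiplied by f.
  set f : ℝ → ℂ := (Icc 0 T).indicator fun t => (z t : ℂ) with hf
  set K := weighted a β with hK
  set E := weighted (fun _ => 1) (-1) with hE
  have hKi : Integrable K := integrable_weighted ha hβ
  have hEi : Integrable E := integrable_weighted integrableOn_exp_neg_one le_rfl
  have hzc : ContinuousOn z (Icc 0 T) := hz.mono Icc_subset_Ici_self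
  obtain ⟨C, hC⟩ := isCompact_Icc.exists_bound_of_continuousOn hzc
  have hfi : Integrable f := by
    refine IntegrableOn.integrable_indicator ?_ measurableSet_Icc
    exact (Complex.continuous_ofReal.comp_continuousOn hzc).integrableOn_Icc
  have hfb : ∀ t, ‖f t‖ ≤ max C 0 := fun t => by
    by_cases ht : t ∈ Icc 0 T
    · rw [hf, indicator_of_mem ht, Complex.norm_real]
      exact (hC t ht).trans (le_max_left _ _)
    · rw [hf, indicator_of_notMem ht, norm_zero]
      exact le_max_right _ _
  have hf0 : ∀ t < 0, f t = 0 := fun t ht =>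
    indicator_of_notMem (fun h => absurd h.1 (not_le.2 ht)) _
  have hfz : ∀ t ∈ Icc 0 T, f t = z t := fun t ht => indicator_of_mem ht _
  set F : ℝ → ℂ := fun t => a₀ * f t + (K ⋆[ContinuousLinearMap.mul ℂ ℂ] f) t with hF
  have hKfi : Integrable (K ⋆[ContinuousLinearMap.mul ℂ ℂ] f) := hKi.integrable_convolution _ hfi
  have hFi : Integrable F := (hfi.const_mul _).add hKfi
  have hFb : ∀ t, ‖F t‖ ≤ |a₀| * max C 0 + (∫ s, ‖K s‖) * max C 0 := fun t => by
    refine (norm_add_le _ _).trans (add_le_add ?_ (norm_convolution_le hKi hfb t))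
    rw [norm_mul, Complex.norm_real, Real.norm_eq_abs]
    exact mul_le_mul_of_nonneg_left (hfb t) (abs_nonneg _)
  have hF0 : ∀ t < 0, F t = 0 := fun t ht => by
    simp only [hF]
    rw [hf0 t ht, weighted_convolution_eq_zero hf0 ht, mul_zero, add_zero]
  have hFN : ∀ t ∈ Icc 0 T, F t = N t := fun t ht => by
    simp only [hF]
    rw [hfz t ht, weighted_convolution_eq hf0 hfz ht, hN, memOp]
    push_cast [smul_eq_mul]
    rfl
  have hEFi : Integrable (E ⋆[ContinuousLinearMap.mul ℂ ℂ] F) := hEi.integrable_convolution _ hFi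
  have hEfi : Integrable (E ⋆[ContinuousLinearMap.mul ℂ ℂ] f) := hEi.integrable_convolution _ hfi
  set R : ℝ → ℂ := fun t => (F t + κ * (E ⋆[ContinuousLinearMap.mul ℂ ℂ] F) t)
    + (-c : ℂ) * (E ⋆[ContinuousLinearMap.mul ℂ ℂ] f) t with hR
  have hRi : Integrable R := (hFi.add (hEFi.const_mul _)).add (hEfi.const_mul _)
  have hRb : ∃ B, ∀ t, ‖R t‖ ≤ B := by
    refine ⟨|a₀| * max C 0 + (∫ s, ‖K s‖) * max C 0
      + ‖(κ : ℂ)‖ * ((∫ s, ‖E s‖) * (|a₀| * max C 0 + (∫ s, ‖K s‖) * max C 0))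
      + ‖(-c : ℂ)‖ * ((∫ s, ‖E s‖) * max C 0),
      fun t => (norm_add_le _ _).trans (add_le_add ((norm_add_le _ _).trans
      (add_le_add (hFb t) ?_)) ?_)⟩
    · rw [norm_mul]
      exact mul_le_mul_of_nonneg_left (norm_convolution_le hEi hFb t) (norm_nonneg _)
    · rw [norm_mul]
      exact mul_le_mul_of_nonneg_left (norm_convolution_le hEi hfb t) (norm_nonneg _)
  obtain ⟨B, hB⟩ := hRb
  have hFhat : ∀ w, 𝓕 F w = (a₀ + 𝓕 K w) * 𝓕 f w := fun w => by
    simp only [hF]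
    rw [fourier_fun_add (hfi.const_mul _) hKfi, fourier_fun_const_mul,
      Real.fourier_mul_convolution_eq hKi hfi]
    ring
  have hRhat : ∀ w, 𝓕 R w = ((a₀ + 𝓕 K w)
      + κ * ((a₀ + 𝓕 K w) / (1 + (2 * Real.pi * w : ℝ) * Complex.I))
      - c / (1 + (2 * Real.pi * w : ℝ) * Complex.I)) * 𝓕 f w := fun w => by
    simp only [hR]
    rw [fourier_fun_add
        (f := fun t => F t + κ * (E ⋆[ContinuousLinearMap.mul ℂ ℂ] F) t)
        (hFi.add (hEFi.const_mul _)) (hEfi.const_mul _),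
      fourier_fun_add hFi (hEFi.const_mul _), fourier_fun_const_mul, fourier_fun_const_mul,
      Real.fourier_mul_convolution_eq hEi hFi, Real.fourier_mul_convolution_eq hEi hfi, hFhat,
      hE, fourier_weighted_one]
    ring
  have key := re_integral_conj_mul_nonneg hfi (memLp_two_of_integrable_of_bound hfi hfb) hRi
    (memLp_two_of_integrable_of_bound hRi hB) hRhat hm
  have e1 : ∫ t, (starRingEnd ℂ) (f t) * R t
      = ((∫ t in (0 : ℝ)..T, z t * (N t + κ * expConv N t - c * expConv z t) : ℝ) : ℂ) := by
    rw [intervalIntegral.integral_of_le hT, ← integral_Icc_eq_integral_Ioc,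
      ← integral_complex_ofReal, ← integral_indicator measurableSet_Icc]
    refine integral_congr_ae (ae_of_all _ fun t => ?_)
    by_cases ht : t ∈ Icc 0 T
    · simp only [hR]
      rw [indicator_of_mem ht, hfz t ht, hFN t ht, weighted_convolution_eq hF0 hFN ht,
        weighted_convolution_eq hf0 hfz ht, Complex.conj_ofReal]
      simp only [expConv]
      push_cast
      ring
    · have h0 : f t = 0 := indicator_of_notMem ht _
      simp only [h0, map_zero, zero_mul, indicator_of_notMem ht]
  rwa [e1, Complex.ofReal_re] at key

end Positivity

/-! ### The weighted energy estimate for the resolvent -/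

section Energy

theorem expConv_eq (f : ℝ → ℝ) (t : ℝ) :
    expConv f t = Real.exp (-t) * ∫ s in (0 : ℝ)..t, Real.exp s * f s := by
  have h := intervalIntegral.integral_comp_sub_left (a := 0) (b := t)
    (fun s => Real.exp (-t) * (Real.exp s * f s)) t
  rw [sub_self, sub_zero] at h
  rw [expConv, causalConv, ← intervalIntegral.integral_const_mul, ← h]
  simp only [smul_eq_mul]
  refine intervalIntegral.integral_congr fun s _ => ?_
  rw [← mul_assoc (Real.exp (-t)), ← Real.exp_add]
  ring_nf

theorem continuousOn_expConv {f : ℝ → ℝ} (hf : ContinuousOn f (Ici 0)) :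
    ContinuousOn (expConv f) (Ici 0) :=
  continuousOn_causalConv integrableOn_exp_neg_one hf

theorem hasDerivAt_expConv {f : ℝ → ℝ} (hf : ContinuousOn f (Ici 0)) {t : ℝ} (ht : 0 < t) :
    HasDerivAt (expConv f) (f t - expConv f t) t := by
  have h1 : ContinuousOn (fun s => Real.exp s * f s) (Ici 0) := by fun_prop
  have h2 : HasDerivAt (fun t : ℝ => Real.exp (-t)) (-Real.exp (-t)) t := by
    simpa using (hasDerivAt_neg t).exp
  have h3 := h2.mul (hasDerivAt_primitive_of_Ici h1 ht)
  refine (h3.congr_of_eventuallyEq (Eventually.of_forall fun s => expConv_eq f s)).congr_deriv ?_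
  have h4 : Real.exp (-t) * (Real.exp t * f t) = f t := by
    rw [← mul_assoc, ← Real.exp_add]; simp
  rw [h4, expConv_eq]
  ring

/-- The function v = e^{-t}∗f satisfies v' + v = f and v(0) = 0, so the integral equals v(T)²/2 plus
the integral of v². -/
theorem integral_mul_expConv_nonneg {f : ℝ → ℝ} (hf : ContinuousOn f (Ici 0)) {T : ℝ}
    (hT : 0 ≤ T) : 0 ≤ ∫ t in (0 : ℝ)..T, f t * expConv f t := by
  have hv := continuousOn_expConv hf
  have hd : ∀ t ∈ Ioo 0 T, HasDerivAt (fun t => expConv f t ^ 2 / 2)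
      ((f t - expConv f t) * expConv f t) t := fun t ht => by
    have := ((hasDerivAt_expConv hf ht.1).pow 2).div_const 2
    refine this.congr_deriv ?_
    push_cast
    ring
  have hi : ContinuousOn (fun t => (f t - expConv f t) * expConv f t) (Ici 0) := by fun_prop
  have hi2 : ContinuousOn (fun t => expConv f t ^ 2) (Ici 0) := by fun_prop
  have h1 := intervalIntegral.integral_eq_sub_of_hasDerivAt_of_le hT
    ((by fun_prop : ContinuousOn (fun t => expConv f t ^ 2 / 2) (Ici 0)).mono Icc_subset_Ici_self)
    hd (hi.intervalIntegrable_of_Ici le_rfl hT)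
  have h2 : expConv f 0 = 0 := by simp [expConv, causalConv]
  have h3 : ∫ t in (0 : ℝ)..T, f t * expConv f t
      = (∫ t in (0 : ℝ)..T, (f t - expConv f t) * expConv f t)
        + ∫ t in (0 : ℝ)..T, expConv f t ^ 2 := by
    rw [← intervalIntegral.integral_add (hi.intervalIntegrable_of_Ici le_rfl hT)
      (hi2.intervalIntegrable_of_Ici le_rfl hT)]
    refine intervalIntegral.integral_congr fun s _ => ?_
    ring
  rw [h3, h1, h2]
  have := intervalIntegral.integral_nonneg hT (μ := volume)
    (f := fun t => expConv f t ^ 2) fun _ _ => sq_nonneg _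
  nlinarith [sq_nonneg (expConv f T)]

variable {a₀ α : ℝ} {a : ℝ → ℝ}

theorem exp_mul_causalConv (a f : ℝ → ℝ) (β t : ℝ) :
    Real.exp (β * t) * causalConv a f t
      = causalConv (fun s => Real.exp (β * s) * a s) (fun s => Real.exp (β * s) * f s) t := by
  rw [causalConv, causalConv, ← intervalIntegral.integral_const_mul]
  refine intervalIntegral.integral_congr fun s _ => ?_
  simp only [smul_eq_mul]
  have : Real.exp (β * t) = Real.exp (β * s) * Real.exp (β * (t - s)) := by
    rw [← Real.exp_add]; ring_nf
  rw [this]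
  ring

theorem exp_mul_memOp (a f : ℝ → ℝ) (β t : ℝ) :
    Real.exp (β * t) * memOp a₀ a f t
      = memOp a₀ (fun s => Real.exp (β * s) * a s) (fun s => Real.exp (β * s) * f s) t := by
  rw [memOp, memOp, mul_add, exp_mul_causalConv]
  simp only [smul_eq_mul]
  ring

/-- After multiplication by 1 + y², with P = Re(a₀ + ã), the real part is P(1+y²) + κ(P + y Im ã) -
c/2. The lower bound on y Im ã costs at most half of P(1+y²), and the other half is at least c/2. -/
theorem multiplier_re_nonneg {b c M κ β : ℝ} (h : SymbolBound a₀ a b c M) (hc : 0 ≤ c)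
    (hβ : β ∈ Icc 0 b) (hκ : 0 ≤ κ) (hκM : κ * M ≤ 1 / 2) (w : ℝ) :
    0 ≤ ((a₀ + 𝓕 (weighted a β) w)
      + κ * ((a₀ + 𝓕 (weighted a β) w) / (1 + (2 * Real.pi * w : ℝ) * Complex.I))
      - ((c / 2 : ℝ) : ℂ) / (1 + (2 * Real.pi * w : ℝ) * Complex.I)).re := by
  obtain ⟨h1, h2⟩ := h β hβ (2 * Real.pi * w)
  rw [laplace_eq_fourier_weighted] at h1 h2
  set y : ℝ := 2 * Real.pi * w
  set K := 𝓕 (weighted a β) w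
  have hn : Complex.normSq (1 + (y : ℂ) * Complex.I) = 1 + y ^ 2 := by
    have := Complex.normSq_add_mul_I 1 y
    simpa using this
  have hy : 0 < 1 + y ^ 2 := by positivity
  have e : ((a₀ + K) + κ * ((a₀ + K) / (1 + (y : ℂ) * Complex.I))
      - ((c / 2 : ℝ) : ℂ) / (1 + (y : ℂ) * Complex.I)).re
      = (a₀ + K.re) + κ * ((a₀ + K.re) + y * K.im) / (1 + y ^ 2) - (c / 2) / (1 + y ^ 2) := by
    simp only [Complex.sub_re, Complex.add_re, Complex.div_re, hn,
      Complex.ofReal_re, Complex.ofReal_im, Complex.add_im, Complex.one_re, Complex.one_im,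
      Complex.mul_re, Complex.mul_im, Complex.I_re, Complex.I_im]
    ring
  rw [e]
  set P := a₀ + K.re
  have hP : 0 ≤ P := le_trans (by positivity) h1
  rw [div_le_iff₀ hy] at h1
  rw [add_sub_assoc, ← sub_div]
  have h3 : 0 ≤ P * (1 + y ^ 2) + (κ * (P + y * K.im) - c / 2) := by
    have h4 := mul_le_mul_of_nonneg_left h2 hκ
    have h5 : κ * M * ((1 + y ^ 2) * P) ≤ 1 / 2 * ((1 + y ^ 2) * P) :=
      mul_le_mul_of_nonneg_right hκM (by positivity)
    have h6 : 0 ≤ κ * P := mul_nonneg hκ hP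
    nlinarith
  have h7 : P + (κ * (P + y * K.im) - c / 2) / (1 + y ^ 2)
      = (P * (1 + y ^ 2) + (κ * (P + y * K.im) - c / 2)) / (1 + y ^ 2) := by
    field_simp
  rw [h7]
  positivity

/-- The weighted energy estimate. -/
theorem sq_exp_mul_resolvent_le {b c M κ lam T : ℝ} (hbα : b ≤ α)
    (ha : IntegrableOn (fun t => Real.exp (α * t) * a t) (Ioi 0)) (hα : 0 ≤ α)
    (h : SymbolBound a₀ a b c M) (hc : 0 ≤ c) (hκ : 0 ≤ κ) (hκb : κ / 2 ≤ b)
    (hκM : κ * M ≤ 1 / 2) (hlam : 0 ≤ lam) (hκlam : κ * (1 + κ / 2) ≤ lam * (c / 2))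
    (hT : 0 ≤ T) :
    (Real.exp (κ / 2 * T) * resolvent a₀ a lam T) ^ 2 ≤ 1 + κ / 2 := by
  set β := κ / 2 with hβ
  have hβ0 : 0 ≤ β := by positivity
  have hβα : β ≤ α := hκb.trans hbα
  have hai := integrableOn_of_exp_mul hα ha
  have hy := continuousOn_resolvent (a₀ := a₀) hai lam
  set y := resolvent a₀ a lam with hydef
  set z : ℝ → ℝ := fun t => Real.exp (β * t) * y t with hz
  set k : ℝ → ℝ := fun s => Real.exp (β * s) * a s with hk
  have hki : IntegrableOn k (Ioi 0) := integrableOn_exp_mul_of_le ha hβα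
  have hzc : ContinuousOn z (Ici 0) := by fun_prop
  set N := memOp a₀ k z with hN
  have hNc : ContinuousOn N (Ici 0) := continuousOn_memOp hki hzc
  have hz0 : z 0 = 1 := by simp [hz, hydef, resolvent_zero_right hai]
  have hzd : ∀ t, 0 < t → HasDerivAt z (β * z t - lam * N t) t := fun t ht => by
    have h1 : HasDerivAt (fun t : ℝ => Real.exp (β * t)) (Real.exp (β * t) * β) t := by
      simpa using ((hasDerivAt_id t).const_mul β).exp
    refine (h1.mul (hasDerivAt_resolvent hai lam ht)).congr_deriv ?_
    rw [hN, ← exp_mul_memOp]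
    simp only [hz, hydef]
    ring
  have hvc := continuousOn_expConv hzc
  have hqc := continuousOn_expConv hNc
  -- the convolved equation
  have hq : ∀ t, 0 ≤ t →
      lam * expConv N t = (1 + β) * expConv z t + Real.exp (-t) - z t := by
    intro t ht
    have hd : ∀ s ∈ Ioo 0 t, HasDerivAt (fun s => Real.exp s * z s)
        ((1 + β) * (Real.exp s * z s) - lam * (Real.exp s * N s)) s := fun s hs => by
      refine ((Real.hasDerivAt_exp s).mul (hzd s hs.1)).congr_deriv ?_
      ring
    have c1 : ContinuousOn (fun s => Real.exp s * z s) (Ici 0) := by fun_prop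
    have c2 : ContinuousOn (fun s => Real.exp s * N s) (Ici 0) := by fun_prop
    have i1 := c1.intervalIntegrable_of_Ici le_rfl ht
    have i2 := c2.intervalIntegrable_of_Ici le_rfl ht
    have h1 := intervalIntegral.integral_eq_sub_of_hasDerivAt_of_le ht
      (c1.mono Icc_subset_Ici_self) hd ((i1.const_mul _).sub (i2.const_mul _))
    rw [intervalIntegral.integral_sub (i1.const_mul _) (i2.const_mul _),
      intervalIntegral.integral_const_mul, intervalIntegral.integral_const_mul, hz0,
      Real.exp_zero] at h1
    rw [expConv_eq, expConv_eq]
    have h2 : Real.exp (-t) * (Real.exp t * z t) = z t := by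
      rw [← mul_assoc, ← Real.exp_add]; simp
    linear_combination -Real.exp (-t) * h1 - h2
  -- the energy identity
  have cz2 : ContinuousOn (fun t => z t ^ 2) (Ici 0) := by fun_prop
  have czN : ContinuousOn (fun t => z t * N t) (Ici 0) := by fun_prop
  have czv : ContinuousOn (fun t => z t * expConv z t) (Ici 0) := by fun_prop
  have cze : ContinuousOn (fun t => Real.exp (-t) * z t) (Ici 0) := by fun_prop
  have iz2 := cz2.intervalIntegrable_of_Ici le_rfl hT
  have izN := czN.intervalIntegrable_of_Ici le_rfl hT
  have izv := czv.intervalIntegrable_of_Ici le_rfl hT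
  have ize := cze.intervalIntegrable_of_Ici le_rfl hT
  have hen : z T ^ 2 / 2 - 1 / 2
      = β * (∫ t in (0 : ℝ)..T, z t ^ 2) - lam * ∫ t in (0 : ℝ)..T, z t * N t := by
    have hd : ∀ t ∈ Ioo 0 T, HasDerivAt (fun t => z t ^ 2 / 2)
        (β * z t ^ 2 - lam * (z t * N t)) t := fun t ht => by
      refine (((hzd t ht.1).pow 2).div_const 2).congr_deriv ?_
      push_cast
      ring
    have h1 := intervalIntegral.integral_eq_sub_of_hasDerivAt_of_le hT
      ((by fun_prop : ContinuousOn (fun t => z t ^ 2 / 2) (Ici 0)).mono Icc_subset_Ici_self)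
      hd ((iz2.const_mul _).sub (izN.const_mul _))
    rw [intervalIntegral.integral_sub (iz2.const_mul _) (izN.const_mul _),
      intervalIntegral.integral_const_mul, intervalIntegral.integral_const_mul, hz0] at h1
    rw [h1]
    norm_num
  -- The term κ e^{-t}∗N is added because the convolved equation turns it into a gain of κ∫z². The
  -- subtracted term is a surplus that absorbs κ(1+β)∫z(e^{-t}∗z).
  have hpos := integral_memOp_nonneg (a := a) (β := β) (a₀ := a₀) (κ := κ) (c := c / 2) hT hzc ha
    hβα (multiplier_re_nonneg h hc ⟨hβ0, hκb⟩ hκ hκM)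
  have hpos2 : 0 ≤ lam * (∫ t in (0 : ℝ)..T, z t * N t)
      + κ * ((1 + β) * (∫ t in (0 : ℝ)..T, z t * expConv z t)
        + (∫ t in (0 : ℝ)..T, Real.exp (-t) * z t) - ∫ t in (0 : ℝ)..T, z t ^ 2)
      - lam * (c / 2) * ∫ t in (0 : ℝ)..T, z t * expConv z t := by
    have h1 := mul_nonneg hlam hpos
    rw [← intervalIntegral.integral_const_mul] at h1
    have h2 : ∫ t in (0 : ℝ)..T, lam * (z t * (N t + κ * expConv N t - c / 2 * expConv z t))
        = ∫ t in (0 : ℝ)..T, (lam * (z t * N t)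
          + κ * ((1 + β) * (z t * expConv z t) + Real.exp (-t) * z t - z t ^ 2)
          - lam * (c / 2) * (z t * expConv z t)) := by
      refine intervalIntegral.integral_congr fun t ht => ?_
      rw [uIcc_of_le hT] at ht
      have h3 := hq t ht.1
      linear_combination κ * z t * h3
    rw [h2, intervalIntegral.integral_sub ((izN.const_mul _).add
        ((((izv.const_mul _).add ize).sub iz2).const_mul _)) (izv.const_mul _),
      intervalIntegral.integral_add (izN.const_mul _)
        ((((izv.const_mul _).add ize).sub iz2).const_mul _),
      intervalIntegral.integral_const_mul, intervalIntegral.integral_const_mul,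
      intervalIntegral.integral_const_mul,
      intervalIntegral.integral_sub ((izv.const_mul _).add ize) iz2,
      intervalIntegral.integral_add (izv.const_mul _) ize,
      intervalIntegral.integral_const_mul] at h1
    exact h1
  have hzv := integral_mul_expConv_nonneg hzc hT
  -- Young's inequality, with 1/4 bounding half the integral of e^{-2t}.
  have hez : ∫ t in (0 : ℝ)..T, Real.exp (-t) * z t
      ≤ (∫ t in (0 : ℝ)..T, z t ^ 2) / 2 + 1 / 4 := by
    have ce : Continuous fun t : ℝ => Real.exp (-2 * t) := by fun_prop
    have ie := ce.intervalIntegrable (μ := volume) 0 T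
    have h1 : ∫ t in (0 : ℝ)..T, Real.exp (-t) * z t
        ≤ ∫ t in (0 : ℝ)..T, ((z t ^ 2) / 2 + Real.exp (-2 * t) / 2) := by
      refine intervalIntegral.integral_mono_on hT ize
        ((iz2.div_const _).add (ie.div_const _)) fun t _ => ?_
      have : Real.exp (-2 * t) = Real.exp (-t) ^ 2 := by
        rw [← Real.exp_nat_mul]; push_cast; ring_nf
      rw [this]
      nlinarith [sq_nonneg (Real.exp (-t) - z t)]
    rw [intervalIntegral.integral_add (iz2.div_const _) (ie.div_const _),
      intervalIntegral.integral_div, intervalIntegral.integral_div] at h1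
    have h2 : ∫ t in (0 : ℝ)..T, Real.exp (-2 * t) = (1 - Real.exp (-2 * T)) / 2 := by
      rw [intervalIntegral.integral_comp_mul_left (fun t => Real.exp t)
          (by norm_num : (-2 : ℝ) ≠ 0),
        integral_exp]
      simp
      ring
    have h3 := Real.exp_pos (-2 * T)
    linarith
  have hzz : 0 ≤ ∫ t in (0 : ℝ)..T, z t ^ 2 :=
    intervalIntegral.integral_nonneg hT fun _ _ => sq_nonneg _
  have h1 := mul_le_mul_of_nonneg_left hez hκ
  have h2 := mul_le_mul_of_nonneg_right hκlam hzv
  -- The coefficient of ∫z² cancels exactly: β = κ/2 from the exponential weight and κ/2 from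
  -- Young's inequality against the gain κ. What remains is z(T)²/2 ≤ 1/2 + κ/4.
  change z T ^ 2 ≤ _
  rw [hβ] at *
  nlinarith

end Energy

/-! ### Uniform decay and parabolic limit of the resolvent -/

section Decay

variable {a₀ α : ℝ} {a : ℝ → ℝ}

/-- The energy estimate is used with κ proportional to min(1, λ). The factor λ is forced for small λ
by the condition κ(1+κ/2) ≤ λc/2; for large λ the rate is limited by the width of the strip and by
M. -/
theorem exists_resolvent_decay {b c M : ℝ} (hb : 0 < b) (hc : 0 < c) (hM : 0 ≤ M) (hbα : b ≤ α)
    (ha : IntegrableOn (fun t => Real.exp (α * t) * a t) (Ioi 0)) (h : SymbolBound a₀ a b c M) :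
    ∃ B > 0, ∀ lam ≥ 0, ∀ t ≥ 0,
      |resolvent a₀ a lam t| ≤ 2 * Real.exp (-(B * min 1 lam * t)) := by
  -- The entries secure, in turn, κ ≤ 1, κ/2 ≤ b, κM ≤ 1/2 and, with the factor min(1, λ), κ(1+κ/2)
  -- ≤ λc/2.
  set κ₀ := min (min 1 (2 * b)) (min (1 / (2 * M + 1)) (c / 4)) with hκ₀
  have h0 : 0 < κ₀ := by positivity
  have k1 : κ₀ ≤ 1 := (min_le_left _ _).trans (min_le_left _ _)
  have k2 : κ₀ ≤ 2 * b := (min_le_left _ _).trans (min_le_right _ _)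
  have k3 : κ₀ ≤ 1 / (2 * M + 1) := (min_le_right _ _).trans (min_le_left _ _)
  have k4 : κ₀ ≤ c / 4 := (min_le_right _ _).trans (min_le_right _ _)
  refine ⟨κ₀ / 2, half_pos h0, fun lam hlam t ht => ?_⟩
  set κ := κ₀ * min 1 lam with hκ
  have m0 : 0 ≤ min 1 lam := le_min zero_le_one hlam
  have hκ0 : 0 ≤ κ := mul_nonneg h0.le m0
  have hκ1 : κ ≤ κ₀ := mul_le_of_le_one_right h0.le (min_le_left _ _)
  have hκM : κ * M ≤ 1 / 2 := by
    rw [le_div_iff₀ (by positivity)] at k3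
    nlinarith [mul_le_mul_of_nonneg_right hκ1 hM]
  have hκlam : κ * (1 + κ / 2) ≤ lam * (c / 2) := by
    have h1 : κ ≤ c / 4 * lam :=
      mul_le_mul k4 (min_le_right _ _) m0 (by positivity)
    nlinarith [mul_le_mul_of_nonneg_left (hκ1.trans k1) hκ0]
  have key := sq_exp_mul_resolvent_le hbα ha (hb.le.trans hbα) h hc.le hκ0 (by linarith) hκM hlam
    hκlam ht
  have h2 : |Real.exp (κ / 2 * t) * resolvent a₀ a lam t| ≤ 2 :=
    abs_le_of_sq_le_sq (by linarith) (by norm_num)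
  rw [abs_mul, Real.abs_exp] at h2
  have h3 : |resolvent a₀ a lam t|
      = Real.exp (-(κ / 2 * t)) * (Real.exp (κ / 2 * t) * |resolvent a₀ a lam t|) := by
    rw [← mul_assoc, ← Real.exp_add]; simp
  rw [h3, mul_comm 2]
  have h4 : κ₀ / 2 * min 1 lam * t = κ / 2 * t := by rw [hκ]; ring
  rw [h4]
  exact mul_le_mul_of_nonneg_left h2 (Real.exp_pos _).le

theorem setIntegral_Ioi_abs_le (hα : 0 < α)
    (ha : IntegrableOn (fun t => Real.exp (α * t) * a t) (Ioi 0)) {t : ℝ} (ht : 0 ≤ t) :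
    ∫ s in Ioi t, |a s|
      ≤ Real.exp (-(α * t)) * ∫ s in Ioi (0 : ℝ), |Real.exp (α * s) * a s| := by
  have hai := integrableOn_of_exp_mul hα.le ha
  have hsub : Ioi t ⊆ Ioi (0 : ℝ) := Ioi_subset_Ioi ht
  rw [← integral_const_mul]
  have hi : IntegrableOn (fun s => Real.exp (-(α * t)) * |Real.exp (α * s) * a s|) (Ioi 0) :=
    ha.abs.const_mul _
  calc ∫ s in Ioi t, |a s|
      ≤ ∫ s in Ioi t, Real.exp (-(α * t)) * |Real.exp (α * s) * a s| := by
        refine setIntegral_mono_on (IntegrableOn.mono_set hai.abs hsub) (hi.mono_set hsub)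
          measurableSet_Ioi
          fun s hs => ?_
        rw [abs_mul, Real.abs_exp, ← mul_assoc, ← Real.exp_add]
        refine le_mul_of_one_le_left (abs_nonneg _) (Real.one_le_exp ?_)
        nlinarith [mul_le_mul_of_nonneg_left (le_of_lt (show t < s from hs)) hα.le]
    _ ≤ _ := setIntegral_mono_set hi (ae_of_all _ fun s => by positivity) hsub.eventuallyLE

/-- The difference is ∫₀ᵗ a(s)(y(t) - y(t-s)) ds plus y(t) times the tail of a beyond t. The first
is controlled by the Lipschitz constant and the first moment of a, through s ≤ e^{αs}/α; the second
by the exponential smallness of the tail. -/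
theorem abs_memOp_sub_le (hα : 0 < α)
    (ha : IntegrableOn (fun t => Real.exp (α * t) * a t) (Ioi 0)) {y : ℝ → ℝ}
    (hy : ContinuousOn y (Ici 0)) {Y L t : ℝ} (hY : ∀ s ≥ 0, |y s| ≤ Y)
    (hL : ∀ s ≥ 0, ∀ r ≥ 0, |y s - y r| ≤ L * |s - r|) (ht : 0 ≤ t) :
    |diffusivity a₀ a * y t - memOp a₀ a y t|
      ≤ (∫ s in Ioi (0 : ℝ), |Real.exp (α * s) * a s|) * (L / α + Y * Real.exp (-(α * t))) := by
  have hai := integrableOn_of_exp_mul hα.le ha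
  set J := ∫ s in Ioi (0 : ℝ), |Real.exp (α * s) * a s| with hJ
  have hL0 : 0 ≤ L := by
    have := (abs_nonneg _).trans (hL 1 (by norm_num) 0 le_rfl)
    simpa using this
  have hY0 : 0 ≤ Y := (abs_nonneg _).trans (hY 0 le_rfl)
  have hsplit : ∫ s in Ioi (0 : ℝ), a s = (∫ s in Ioc 0 t, a s) + ∫ s in Ioi t, a s := by
    rw [← setIntegral_union (by simp [Set.disjoint_left]) measurableSet_Ioi
      (hai.mono_set Ioc_subset_Ioi_self) (hai.mono_set (Ioi_subset_Ioi ht)),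
      Ioc_union_Ioi_eq_Ioi ht]
  have hint : IntegrableOn (fun s => a s * y (t - s)) (Ioc 0 t) := by
    have h1 := causalConv_intervalIntegrable hai hy ht
    exact (intervalIntegrable_iff_integrableOn_Ioc_of_le ht).1 h1
  have hint2 : IntegrableOn (fun s => a s * y t) (Ioc 0 t) :=
    (hai.mono_set Ioc_subset_Ioi_self).mul_const _
  have e : diffusivity a₀ a * y t - memOp a₀ a y t
      = (∫ s in Ioc 0 t, (a s * y t - a s * y (t - s))) + (∫ s in Ioi t, a s) * y t := by
    rw [integral_sub hint2 hint, diffusivity, memOp, hsplit, causalConv,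
      intervalIntegral.integral_of_le ht, integral_mul_const]
    simp only [smul_eq_mul]
    ring
  have b1 : |∫ s in Ioc 0 t, (a s * y t - a s * y (t - s))| ≤ J * (L / α) := by
    have hi : IntegrableOn (fun s => |Real.exp (α * s) * a s| * (L / α)) (Ioi 0) :=
      ha.abs.mul_const _
    rw [hJ, ← integral_mul_const]
    calc |∫ s in Ioc 0 t, (a s * y t - a s * y (t - s))|
        ≤ ∫ s in Ioc 0 t, |Real.exp (α * s) * a s| * (L / α) := by
          rw [← Real.norm_eq_abs]
          refine norm_integral_le_of_norm_le (hi.mono_set Ioc_subset_Ioi_self)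
            ((ae_restrict_iff' measurableSet_Ioc).2 (ae_of_all _ fun s hs => ?_))
          have h1 := hL t ht (t - s) (by linarith [hs.2])
          rw [sub_sub_cancel, abs_of_pos hs.1] at h1
          have h2 : s ≤ Real.exp (α * s) / α := by
            rw [le_div_iff₀ hα]
            linarith [Real.add_one_le_exp (α * s)]
          rw [← mul_sub, norm_mul, Real.norm_eq_abs, Real.norm_eq_abs, abs_mul, Real.abs_exp]
          calc |a s| * |y t - y (t - s)| ≤ |a s| * (L * (Real.exp (α * s) / α)) :=
                mul_le_mul_of_nonneg_left
                  (h1.trans (mul_le_mul_of_nonneg_left h2 hL0)) (abs_nonneg _)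
            _ = _ := by ring
      _ ≤ _ := setIntegral_mono_set hi (ae_of_all _ fun s => by positivity)
          Ioc_subset_Ioi_self.eventuallyLE
  have b2 : |(∫ s in Ioi t, a s) * y t| ≤ J * (Y * Real.exp (-(α * t))) := by
    rw [abs_mul]
    have h1 : |∫ s in Ioi t, a s| ≤ Real.exp (-(α * t)) * J :=
      (abs_integral_le_integral_abs).trans (setIntegral_Ioi_abs_le hα ha ht)
    calc _ ≤ Real.exp (-(α * t)) * J * Y :=
          mul_le_mul h1 (hY t ht) (abs_nonneg _) ((abs_nonneg _).trans h1)
      _ = _ := by ring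
  rw [e, mul_add]
  exact (abs_add_le _ _).trans (add_le_add b1 b2)

/-- The resolvent equation is y' = -A_∞ λ y plus λ times the defect of the previous lemma. The
Lipschitz constant of y is itself of order λ, so variation of constants gives λ²t from the slow
variation and λ from the integrable tail. -/
theorem abs_resolvent_sub_exp_le (hα : 0 < α)
    (ha : IntegrableOn (fun t => Real.exp (α * t) * a t) (Ioi 0)) (hA : 0 ≤ diffusivity a₀ a)
    {Y : ℝ} (hY : ∀ lam ≥ 0, ∀ t ≥ 0, |resolvent a₀ a lam t| ≤ Y) :
    ∃ C, ∀ lam ≥ 0, ∀ t ≥ 0,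
      |resolvent a₀ a lam t - Real.exp (-(diffusivity a₀ a * lam * t))|
        ≤ C * (lam ^ 2 * t + lam) := by
  have hai := integrableOn_of_exp_mul hα.le ha
  set J := ∫ s in Ioi (0 : ℝ), |Real.exp (α * s) * a s| with hJ
  set A := diffusivity a₀ a with hAdef
  have hJ0 : 0 ≤ J := integral_nonneg fun _ => abs_nonneg _
  have hY0 : 0 ≤ Y := (abs_nonneg _).trans (hY 0 le_rfl 0 le_rfl)
  have hB0 := memBound_nonneg a₀ a
  refine ⟨J * (memBound a₀ a * Y / α + Y / α), fun lam hlam t ht => ?_⟩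
  have hyc := continuousOn_resolvent (a₀ := a₀) hai lam
  set y := resolvent a₀ a lam with hy
  have hNc := continuousOn_memOp (a₀ := a₀) hai hyc
  have hLip : ∀ s ≥ 0, ∀ r ≥ 0, |y s - y r| ≤ lam * (memBound a₀ a * Y) * |s - r| := by
    intro s hs r hr
    have e : y s - y r = lam * ∫ τ in s..r, memOp a₀ a y τ := by
      rw [hy, resolvent_eq hai lam hs, resolvent_eq hai lam hr, volterra, volterra,
        ← intervalIntegral.integral_interval_sub_left
          (hNc.intervalIntegrable_of_Ici le_rfl hr) (hNc.intervalIntegrable_of_Ici le_rfl hs)]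
      ring
    rw [e, abs_mul, abs_of_nonneg hlam, mul_assoc, abs_sub_comm]
    refine mul_le_mul_of_nonneg_left ?_ hlam
    rw [← Real.norm_eq_abs]
    refine intervalIntegral.norm_integral_le_of_norm_le_const fun τ hτ => ?_
    have hτ0 : 0 ≤ τ := (le_min hs hr).trans (le_of_lt hτ.1)
    exact norm_memOp_le hai hτ0 fun σ hσ => hY lam hlam σ hσ.1
  have hρ := fun s (hs : 0 ≤ s) => abs_memOp_sub_le (a₀ := a₀) hα ha hyc (hY lam hlam) hLip hs
  -- variation of constants
  have hd : ∀ s ∈ Ioo 0 t, HasDerivAt (fun s => Real.exp (A * lam * s) * y s)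
      (Real.exp (A * lam * s) * (lam * (A * y s - memOp a₀ a y s))) s := fun s hs => by
    have h1 : HasDerivAt (fun s : ℝ => Real.exp (A * lam * s))
        (Real.exp (A * lam * s) * (A * lam)) s := by
      simpa using ((hasDerivAt_id s).const_mul (A * lam)).exp
    refine (h1.mul (hasDerivAt_resolvent hai lam hs.1)).congr_deriv ?_
    rw [← hy]
    ring
  have hc1 : ContinuousOn (fun s => Real.exp (A * lam * s) * y s) (Ici 0) := by fun_prop
  have hc2 : ContinuousOn
      (fun s => Real.exp (A * lam * s) * (lam * (A * y s - memOp a₀ a y s))) (Ici 0) := by fun_prop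
  have h1 := intervalIntegral.integral_eq_sub_of_hasDerivAt_of_le ht (hc1.mono Icc_subset_Ici_self)
    hd (hc2.intervalIntegrable_of_Ici le_rfl ht)
  have hy0 : y 0 = 1 := resolvent_zero_right hai lam
  rw [hy0, mul_zero, Real.exp_zero, one_mul] at h1
  have h2 : y t - Real.exp (-(A * lam * t)) = Real.exp (-(A * lam * t))
      * ∫ s in (0 : ℝ)..t, Real.exp (A * lam * s) * (lam * (A * y s - memOp a₀ a y s)) := by
    rw [h1, mul_sub, ← mul_assoc, ← Real.exp_add]
    simp
  rw [h2, ← intervalIntegral.integral_const_mul]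
  have hcb : Continuous fun s : ℝ =>
      lam * (J * (lam * (memBound a₀ a * Y) / α + Y * Real.exp (-(α * s)))) := by fun_prop
  have h3 : |∫ s in (0 : ℝ)..t, Real.exp (-(A * lam * t))
      * (Real.exp (A * lam * s) * (lam * (A * y s - memOp a₀ a y s)))|
      ≤ ∫ s in (0 : ℝ)..t,
        lam * (J * (lam * (memBound a₀ a * Y) / α + Y * Real.exp (-(α * s)))) := by
    rw [← Real.norm_eq_abs]
    refine intervalIntegral.norm_integral_le_of_norm_le ht ?_ (hcb.intervalIntegrable _ _)
    refine ae_of_all _ fun s hs => ?_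
    rw [← mul_assoc, ← Real.exp_add, norm_mul, norm_mul, Real.norm_eq_abs, Real.norm_eq_abs,
      Real.norm_eq_abs, Real.abs_exp, abs_of_nonneg hlam]
    have h4 : Real.exp (-(A * lam * t) + A * lam * s) ≤ 1 := by
      rw [Real.exp_le_one_iff]
      nlinarith [mul_le_mul_of_nonneg_left hs.2 (mul_nonneg hA hlam)]
    calc _ ≤ 1 * (lam * |A * y s - memOp a₀ a y s|) :=
          mul_le_mul_of_nonneg_right h4 (by positivity)
      _ = lam * |A * y s - memOp a₀ a y s| := one_mul _
      _ ≤ _ := mul_le_mul_of_nonneg_left (hρ s hs.1.le) hlam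
  refine h3.trans ?_
  have h5 : ∫ s in (0 : ℝ)..t, Real.exp (-(α * s)) ≤ 1 / α := by
    have e1 : ∀ s : ℝ, -(α * s) = -α * s := fun s => by ring
    simp_rw [e1]
    rw [intervalIntegral.integral_comp_mul_left (fun t => Real.exp t) (neg_ne_zero.2 hα.ne'),
      integral_exp, mul_zero, Real.exp_zero, smul_eq_mul, inv_neg, neg_mul, ← mul_neg, neg_sub,
      one_div]
    exact mul_le_of_le_one_right (by positivity) (by linarith [Real.exp_pos (-α * t)])
  have hce : Continuous fun s : ℝ => Real.exp (-(α * s)) := by fun_prop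
  rw [intervalIntegral.integral_const_mul, intervalIntegral.integral_const_mul,
    intervalIntegral.integral_add intervalIntegrable_const
      ((hce.intervalIntegrable _ _).const_mul _),
    intervalIntegral.integral_const, intervalIntegral.integral_const_mul, sub_zero, smul_eq_mul]
  have h6 : t * (lam * (memBound a₀ a * Y) / α)
      + Y * ∫ s in (0 : ℝ)..t, Real.exp (-(α * s))
      ≤ t * (lam * (memBound a₀ a * Y) / α) + Y * (1 / α) :=
    add_le_add le_rfl (mul_le_mul_of_nonneg_left h5 hY0)
  calc _ ≤ lam * (J * (t * (lam * (memBound a₀ a * Y) / α) + Y * (1 / α))) :=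
        mul_le_mul_of_nonneg_left (mul_le_mul_of_nonneg_left h6 hJ0) hlam
    _ = J * (memBound a₀ a * Y / α) * (lam ^ 2 * t) + J * (Y / α) * lam := by ring
    _ ≤ J * (memBound a₀ a * Y / α + Y / α) * (lam ^ 2 * t)
        + J * (memBound a₀ a * Y / α + Y / α) * lam := by
        gcongr <;> [exact le_add_of_nonneg_right (by positivity);
          exact le_add_of_nonneg_left (by positivity)]
    _ = _ := by ring

/-- With λ/t in place of λ, both terms of the error bound are of order 1/t. -/
theorem tendsto_resolvent_div (hα : 0 < α)
    (ha : IntegrableOn (fun t => Real.exp (α * t) * a t) (Ioi 0)) (hA : 0 ≤ diffusivity a₀ a)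
    {Y : ℝ} (hY : ∀ lam ≥ 0, ∀ t ≥ 0, |resolvent a₀ a lam t| ≤ Y) {lam : ℝ} (hlam : 0 ≤ lam) :
    Tendsto (fun t => resolvent a₀ a (lam / t) t) atTop
      (𝓝 (Real.exp (-(diffusivity a₀ a * lam)))) := by
  obtain ⟨C, hC⟩ := abs_resolvent_sub_exp_le hα ha hA hY
  have h0 : Tendsto (fun t : ℝ => C * (lam ^ 2 + lam) * t⁻¹) atTop (𝓝 0) := by
    simpa using tendsto_inv_atTop_zero.const_mul (C * (lam ^ 2 + lam))
  rw [tendsto_iff_norm_sub_tendsto_zero]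
  refine squeeze_zero' (Eventually.of_forall fun _ => norm_nonneg _) ?_ h0
  filter_upwards [eventually_gt_atTop 0] with t ht
  have h1 := hC (lam / t) (by positivity) t ht.le
  have e1 : diffusivity a₀ a * (lam / t) * t = diffusivity a₀ a * lam := by field_simp
  have e2 : C * ((lam / t) ^ 2 * t + lam / t) = C * (lam ^ 2 + lam) * t⁻¹ := by field_simp
  rw [e1, e2] at h1
  exact h1

end Decay


/-! ### Norms and Cauchy–Schwarz in L² -/

section SquareIntegrable

variable {X : Type*} [MeasurableSpace X] {μ : Measure X}

theorem norm_Lp_two_sq (f : Lp ℂ 2 μ) : ‖f‖ ^ 2 = ∫ x, ‖f x‖ ^ 2 ∂μ := by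
  have h := norm_sq_eq_re_inner (𝕜 := ℂ) f
  rw [h, L2.inner_def, ← integral_re (L2.integrable_inner f f)]
  exact integral_congr_ae (ae_of_all _ fun x => (norm_sq_eq_re_inner (𝕜 := ℂ) (f x)).symm)

theorem norm_toLp_two_sq {f : X → ℂ} (hf : MemLp f 2 μ) :
    ‖hf.toLp f‖ ^ 2 = ∫ x, ‖f x‖ ^ 2 ∂μ := by
  rw [norm_Lp_two_sq]
  refine integral_congr_ae ?_
  filter_upwards [hf.coeFn_toLp] with x hx
  rw [hx]

theorem norm_integral_mul_le {f g : X → ℂ} (hf : MemLp f 2 μ) (hg : MemLp g 2 μ) :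
    ‖∫ x, f x * g x ∂μ‖ ≤ ‖hf.toLp f‖ * ‖hg.toLp g‖ := by
  have h := norm_inner_le_norm (𝕜 := ℂ) (hf.star.toLp (star f)) (hg.toLp g)
  rw [L2.inner_def] at h
  have e1 : ∫ x, inner ℂ ((hf.star.toLp (star f)) x) ((hg.toLp g) x) ∂μ = ∫ x, f x * g x ∂μ := by
    refine integral_congr_ae ?_
    filter_upwards [hf.star.coeFn_toLp, hg.coeFn_toLp] with x h1 h2
    rw [h1, h2, RCLike.inner_apply, mul_comm]
    simp
  have e2 : ‖hf.star.toLp (star f)‖ = ‖hf.toLp f‖ := by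
    rw [← sq_eq_sq₀ (norm_nonneg _) (norm_nonneg _), norm_toLp_two_sq, norm_toLp_two_sq]
    simp
  rwa [e1, e2] at h

end SquareIntegrable

/-! ### Sobolev distributions described by their Fourier symbols -/

section Symbol

variable {n : ℕ}

/-- The weight `(1 + ‖ξ‖²)^{s/2}`. -/
def sobolevWeight (s : ℝ) (ξ : Space n) : ℝ := (1 + ‖ξ‖ ^ 2) ^ (s / 2)

theorem sobolevWeight_pos (s : ℝ) (ξ : Space n) : 0 < sobolevWeight s ξ := by
  unfold sobolevWeight; positivity

theorem continuous_sobolevWeight (s : ℝ) : Continuous (sobolevWeight (n := n) s) := by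
  unfold sobolevWeight
  exact Continuous.rpow_const (by fun_prop) fun ξ => Or.inl (by positivity)

theorem sobolevWeight_neg_mul (s : ℝ) (ξ : Space n) :
    sobolevWeight (-s) ξ * sobolevWeight s ξ = 1 := by
  unfold sobolevWeight
  rw [← Real.rpow_add (by positivity)]
  ring_nf
  simp

theorem sobolevWeight_sq (s : ℝ) (ξ : Space n) :
    sobolevWeight s ξ ^ 2 = (1 + ‖ξ‖ ^ 2) ^ s := by
  unfold sobolevWeight
  rw [← Real.rpow_natCast, ← Real.rpow_mul (by positivity)]
  ring_nf

theorem hasTemperateGrowth_sobolevWeight (s : ℝ) :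
    (fun ξ : Space n => (sobolevWeight s ξ : ℂ)).HasTemperateGrowth := by
  unfold sobolevWeight
  fun_prop

/-- Multiplication of a Schwartz function by the Sobolev weight. -/
def weightMul (s : ℝ) : 𝓢(Space n, ℂ) →L[ℂ] 𝓢(Space n, ℂ) :=
  SchwartzMap.smulLeftCLM ℂ fun ξ : Space n => (sobolevWeight s ξ : ℂ)

theorem weightMul_apply (s : ℝ) (ψ : 𝓢(Space n, ℂ)) (ξ : Space n) :
    weightMul s ψ ξ = sobolevWeight s ξ * ψ ξ :=
  SchwartzMap.smulLeftCLM_apply_apply (hasTemperateGrowth_sobolevWeight s) ψ ξ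

/-- The Fourier transform of the distribution `f ∈ H^s` is the function `g`. -/
structure HasSymbol (s : ℝ) (f : 𝓢'(Space n, ℂ)) (g : Space n → ℂ) : Prop where
  memLp : MemLp (fun ξ => (sobolevWeight s ξ : ℂ) * g ξ) 2
  apply_eq : ∀ ψ : 𝓢(Space n, ℂ), 𝓕 f ψ = ∫ ξ, ψ ξ * g ξ

variable {s : ℝ} {f : 𝓢'(Space n, ℂ)} {g : Space n → ℂ}

theorem mul_eq_weight_mul (s : ℝ) (ψ : 𝓢(Space n, ℂ)) (g : Space n → ℂ) (ξ : Space n) :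
    ψ ξ * g ξ = weightMul (-s) ψ ξ * ((sobolevWeight s ξ : ℂ) * g ξ) := by
  have h : (sobolevWeight (-s) ξ : ℂ) * (sobolevWeight s ξ : ℂ) = 1 := by
    rw [← Complex.ofReal_mul, sobolevWeight_neg_mul, Complex.ofReal_one]
  rw [weightMul_apply]
  linear_combination (-(ψ ξ * g ξ)) * h

/-- The weighted Fourier transform is an L² function; dividing by the weight is harmless since its
inverse also has temperate growth. -/
theorem exists_hasSymbol (h : MemSobolev s 2 f) : ∃ g, HasSymbol s f g := by
  obtain ⟨G, hG⟩ := memSobolev_iff_exists_smulLeftCLM_fourier.1 h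
  have e : ∀ ξ, (sobolevWeight s ξ : ℂ) * ((sobolevWeight (-s) ξ : ℂ) * G ξ) = G ξ := fun ξ => by
    rw [← mul_assoc, mul_comm (sobolevWeight s ξ : ℂ), ← Complex.ofReal_mul,
      sobolevWeight_neg_mul, Complex.ofReal_one, one_mul]
  refine ⟨fun ξ => (sobolevWeight (-s) ξ : ℂ) * G ξ, ?_, fun ψ => ?_⟩
  · simp_rw [e]
    exact Lp.memLp G
  · have h1 := congrArg (fun T : 𝓢'(Space n, ℂ) => T (weightMul (-s) ψ)) hG
    simp only [smulLeftCLM_apply_apply, Lp.toTemperedDistribution_apply, smul_eq_mul] at h1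
    have h2 : SchwartzMap.smulLeftCLM ℂ (fun x : Space n => (((1 + ‖x‖ ^ 2) ^ (s / 2) : ℝ) : ℂ))
        (weightMul (-s) ψ) = ψ := by
      ext ξ
      change weightMul s (weightMul (-s) ψ) ξ = ψ ξ
      rw [weightMul_apply, weightMul_apply, ← mul_assoc, mul_comm (sobolevWeight s ξ : ℂ),
        ← Complex.ofReal_mul, sobolevWeight_neg_mul, Complex.ofReal_one, one_mul]
    rw [h2] at h1
    rw [h1]
    refine integral_congr_ae (ae_of_all _ fun ξ => ?_)
    simp only [weightMul_apply]
    ring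

namespace HasSymbol

theorem smulLeftCLM_fourier (h : HasSymbol s f g) :
    smulLeftCLM ℂ (fun x : Space n => (((1 + ‖x‖ ^ 2) ^ (s / 2) : ℝ) : ℂ)) (𝓕 f)
      = (h.memLp.toLp _ : Lp ℂ 2 (volume : Measure (Space n))) := by
  ext ψ
  rw [smulLeftCLM_apply_apply, h.apply_eq, Lp.toTemperedDistribution_apply]
  refine integral_congr_ae ?_
  filter_upwards [h.memLp.coeFn_toLp] with ξ hξ
  rw [hξ]
  change weightMul s ψ ξ * g ξ = ψ ξ • ((sobolevWeight s ξ : ℂ) * g ξ)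
  rw [weightMul_apply, smul_eq_mul]
  ring

theorem memSobolev (h : HasSymbol s f g) : MemSobolev s 2 f :=
  memSobolev_iff_exists_smulLeftCLM_fourier.2 ⟨_, h.smulLeftCLM_fourier⟩

theorem sobolevNorm_eq_norm (h : HasSymbol s f g) : sobolevNorm s f = ‖h.memLp.toLp _‖ := by
  set G : Lp ℂ 2 (volume : Measure (Space n)) := h.memLp.toLp _ with hG
  have h1 : besselPotential (Space n) ℂ s f
      = (𝓕⁻ G : Lp ℂ 2 (volume : Measure (Space n))) := by
    rw [besselPotential, TemperedDistribution.fourierMultiplierCLM_apply,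
      ← Lp.fourierInv_toTemperedDistribution_eq]
    congr 1
    exact h.smulLeftCLM_fourier
  have h2 : (𝓕 (𝓕⁻ G : Lp ℂ 2 (volume : Measure (Space n))) : Lp ℂ 2 (volume : Measure (Space n)))
      = G := FourierTransform.fourier_fourierInv_eq G
  rw [sobolevNorm_eq h1, ← Lp.norm_fourier_eq, h2]

theorem sobolevNorm_sq (h : HasSymbol s f g) :
    sobolevNorm s f ^ 2 = ∫ ξ, (1 + ‖ξ‖ ^ 2) ^ s * ‖g ξ‖ ^ 2 := by
  rw [h.sobolevNorm_eq_norm, norm_toLp_two_sq]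
  refine integral_congr_ae (ae_of_all _ fun ξ => ?_)
  simp only
  rw [norm_mul, mul_pow, Complex.norm_real, Real.norm_eq_abs, sq_abs, sobolevWeight_sq]

theorem integrable_mul (h : HasSymbol s f g) (ψ : 𝓢(Space n, ℂ)) :
    Integrable fun ξ => ψ ξ * g ξ := by
  simp_rw [mul_eq_weight_mul s ψ g]
  exact ((weightMul (-s) ψ).memLp 2).integrable_mul h.memLp

theorem locallyIntegrable (h : HasSymbol s f g) : LocallyIntegrable g := by
  have h1 := h.memLp.locallyIntegrable one_le_two
  refine (h1.continuous_smul (g := fun ξ => (sobolevWeight (-s) ξ : ℂ))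
    (Complex.continuous_ofReal.comp (continuous_sobolevWeight _))).congr ?_
  refine ae_of_all _ fun ξ => ?_
  simp only [smul_eq_mul]
  rw [← mul_assoc, ← Complex.ofReal_mul, sobolevWeight_neg_mul, Complex.ofReal_one, one_mul]

theorem congr_ae {g' : Space n → ℂ} (h : HasSymbol s f g) (hg : g =ᵐ[volume] g') :
    HasSymbol s f g' where
  memLp := (memLp_congr_ae (by filter_upwards [hg] with ξ hξ; rw [hξ])).1 h.memLp
  apply_eq ψ := by
    rw [h.apply_eq]
    exact integral_congr_ae (by filter_upwards [hg] with ξ hξ; rw [hξ])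

theorem sub {f' : 𝓢'(Space n, ℂ)} {g' : Space n → ℂ} (h : HasSymbol s f g)
    (h' : HasSymbol s f' g') : HasSymbol s (f - f') (fun ξ => g ξ - g' ξ) where
  memLp := by
    simp_rw [mul_sub]
    exact h.memLp.sub h'.memLp
  apply_eq ψ := by
    have h1 : 𝓕 (f - f') ψ = 𝓕 f ψ - 𝓕 f' ψ := rfl
    rw [h1, h.apply_eq, h'.apply_eq, ← integral_sub (h.integrable_mul ψ) (h'.integrable_mul ψ)]
    simp only [mul_sub]

end HasSymbol

/-- The norm dual to the norm of `H^s`, on the Fourier side. -/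
def dualNorm (s : ℝ) (ψ : 𝓢(Space n, ℂ)) : ℝ := ‖(weightMul (-s) ψ).toLp 2‖

theorem continuous_dualNorm (s : ℝ) : Continuous (dualNorm (n := n) s) :=
  (SchwartzMap.continuous_toLp.comp (weightMul (-s)).continuous).norm

theorem dualNorm_sq (s : ℝ) (ψ : 𝓢(Space n, ℂ)) :
    dualNorm s ψ ^ 2 = ∫ ξ, ‖weightMul (-s) ψ ξ‖ ^ 2 := by
  rw [dualNorm, norm_Lp_two_sq]
  refine integral_congr_ae ?_
  filter_upwards [SchwartzMap.coeFn_toLp (weightMul (-s) ψ) 2 volume] with ξ hξ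
  rw [hξ]

theorem norm_fourier_apply_le (h : MemSobolev s 2 f) (ψ : 𝓢(Space n, ℂ)) :
    ‖𝓕 f ψ‖ ≤ sobolevNorm s f * dualNorm s ψ := by
  obtain ⟨g, hg⟩ := exists_hasSymbol h
  rw [hg.apply_eq, hg.sobolevNorm_eq_norm, mul_comm]
  simp_rw [mul_eq_weight_mul s ψ g]
  exact norm_integral_mul_le ((weightMul (-s) ψ).memLp 2) hg.memLp

theorem dualNorm_le_of_norm_le {ψ φ : 𝓢(Space n, ℂ)} {K : ℝ} (hK : 0 ≤ K)
    (h : ∀ ξ, ‖φ ξ‖ ≤ K * ‖ψ ξ‖) : dualNorm s φ ≤ K * dualNorm s ψ := by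
  refine le_of_sq_le_sq ?_ (mul_nonneg hK (norm_nonneg _))
  rw [mul_pow, dualNorm_sq, dualNorm_sq, ← integral_const_mul]
  have hi : ∀ χ : 𝓢(Space n, ℂ), Integrable fun ξ => ‖χ ξ‖ ^ 2 := fun χ =>
    (memLp_two_iff_integrable_sq_norm (χ.memLp 2).1).1 (χ.memLp 2)
  refine integral_mono (hi _) ((hi _).const_mul _) fun ξ => ?_
  simp only
  rw [← mul_pow]
  refine pow_le_pow_left₀ (norm_nonneg _) ?_ 2
  rw [weightMul_apply, weightMul_apply, norm_mul, norm_mul, mul_left_comm]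
  exact mul_le_mul_of_nonneg_left (h ξ) (norm_nonneg _)

theorem apply_eq_fourier_apply (f : 𝓢'(Space n, ℂ)) (φ : 𝓢(Space n, ℂ)) :
    f φ = 𝓕 f (𝓕⁻ φ) := by
  rw [TemperedDistribution.fourier_apply, FourierTransform.fourier_fourierInv_eq]

/-- The symbol `4π²‖ξ‖²` of `-Δ`. -/
def lapSymbol (ξ : Space n) : ℝ := (2 * Real.pi) ^ 2 * ‖ξ‖ ^ 2

theorem lapSymbol_nonneg (ξ : Space n) : 0 ≤ lapSymbol ξ := by unfold lapSymbol; positivity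

theorem continuous_lapSymbol : Continuous (lapSymbol (n := n)) := by
  unfold lapSymbol; fun_prop

/-- Multiplication of a Schwartz function by `4π²‖ξ‖²`. -/
def lapMul : 𝓢(Space n, ℂ) →L[ℂ] 𝓢(Space n, ℂ) :=
  SchwartzMap.smulLeftCLM ℂ fun ξ : Space n => (lapSymbol ξ : ℂ)

theorem hasTemperateGrowth_lapSymbol :
    (fun ξ : Space n => (lapSymbol ξ : ℂ)).HasTemperateGrowth := by
  unfold lapSymbol
  fun_prop

theorem lapMul_apply (ψ : 𝓢(Space n, ℂ)) (ξ : Space n) : lapMul ψ ξ = lapSymbol ξ * ψ ξ :=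
  SchwartzMap.smulLeftCLM_apply_apply hasTemperateGrowth_lapSymbol ψ ξ

theorem lapMul_iterate_apply (k : ℕ) (ψ : 𝓢(Space n, ℂ)) (ξ : Space n) :
    (lapMul^[k] ψ) ξ = (lapSymbol ξ : ℂ) ^ k * ψ ξ := by
  induction k generalizing ψ with
  | zero => simp
  | succ k ih =>
    rw [Function.iterate_succ_apply, ih, lapMul_apply]
    ring

theorem fourier_laplacian_apply (f : 𝓢'(Space n, ℂ)) (ψ : 𝓢(Space n, ℂ)) :
    f (Δ (𝓕 ψ)) = -𝓕 f (lapMul ψ) := by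
  have h1 : f (Δ (𝓕 ψ)) = (Δ f) (𝓕 ψ) := (TemperedDistribution.laplacian_apply_apply f _).symm
  have h2 : lapMul ψ = (((2 * Real.pi) ^ 2 : ℝ) : ℂ) •
      SchwartzMap.smulLeftCLM ℂ (fun x : Space n => Complex.ofReal (‖x‖ ^ 2)) ψ := by
    ext ξ
    rw [lapMul_apply, smul_apply,
      SchwartzMap.smulLeftCLM_apply_apply (by fun_prop), lapSymbol]
    push_cast [smul_eq_mul]
    ring
  rw [h1, TemperedDistribution.laplacian_eq_fourierMultiplierCLM, h2, map_smul]
  simp only [TemperedDistribution.fourier_apply]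
  have h3 : (-(2 * Real.pi) ^ 2 • TemperedDistribution.fourierMultiplierCLM ℂ
      (fun x : Space n => Complex.ofReal (‖x‖ ^ 2)) f) (𝓕 ψ)
      = -(2 * Real.pi) ^ 2 • (TemperedDistribution.fourierMultiplierCLM ℂ
      (fun x : Space n => Complex.ofReal (‖x‖ ^ 2)) f) (𝓕 ψ) := rfl
  rw [h3, TemperedDistribution.fourierMultiplierCLM_apply_apply,
    FourierTransform.fourierInv_fourier_eq]
  simp

theorem fourier_injective {f f' : 𝓢'(Space n, ℂ)} (h : ∀ ψ, 𝓕 f ψ = 𝓕 f' ψ) : f = f' := by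
  ext φ
  rw [apply_eq_fourier_apply, apply_eq_fourier_apply f', h]

end Symbol


/-! ### Density of compactly supported functions in the Schwartz space -/

section Density

variable {n : ℕ}

/-- Near any point with ε‖x‖ < 1 the function vanishes, and elsewhere the factor ε‖x‖ is at least 1.
The smallness ε is thus traded for one more power of ‖x‖, which a Schwartz function can afford. -/
theorem exists_norm_iteratedFDeriv_one_sub_bump_le (ρ : ContDiffBump (0 : Space n))
    (h1 : 1 ≤ ρ.rIn) (i : ℕ) :
    ∃ C : ℝ, 0 ≤ C ∧ ∀ ε : ℝ, 0 ≤ ε → ε ≤ 1 → ∀ x : Space n,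
      ‖iteratedFDeriv ℝ i (fun x => 1 - ρ (ε • x)) x‖ ≤ C * (ε * ‖x‖) := by
  have hs : ContDiff ℝ ∞ fun x => 1 - ρ x := contDiff_const.sub ρ.contDiff
  have hb : ∃ C, ∀ x, ‖iteratedFDeriv ℝ i (fun x => 1 - ρ x) x‖ ≤ C := by
    rcases Nat.eq_zero_or_pos i with rfl | hi
    · refine ⟨1, fun x => ?_⟩
      rw [norm_iteratedFDeriv_zero, Real.norm_eq_abs,
        abs_of_nonneg (by linarith [ρ.le_one (x := x)])]
      linarith [ρ.nonneg (x := x)]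
    · have hcs : HasCompactSupport (iteratedFDeriv ℝ i (ρ : Space n → ℝ)) :=
        ρ.hasCompactSupport.iteratedFDeriv (𝕜 := ℝ) i
      obtain ⟨C, hC⟩ := hcs.exists_bound_of_continuous
        ((ρ.contDiff (n := ⊤)).continuous_iteratedFDeriv (by exact_mod_cast le_top))
      refine ⟨C, fun x => ?_⟩
      have : iteratedFDeriv ℝ i (fun x => 1 - ρ x) x = - iteratedFDeriv ℝ i ρ x := by
        have e := iteratedFDeriv_sub_apply (𝕜 := ℝ) (i := i) (x := x)
          (f := fun _ : Space n => (1 : ℝ)) (g := ρ) contDiff_const.contDiffAt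
          (ρ.contDiff (n := (i : ℕ∞))).contDiffAt
        have e' : (fun x => 1 - ρ x) = (fun _ : Space n => (1 : ℝ)) - ρ := rfl
        rw [e', e, iteratedFDeriv_const_of_ne (by omega)]
        simp
      rw [this, norm_neg]
      exact hC x
  obtain ⟨C, hC⟩ := hb
  have hC0 : 0 ≤ C := (norm_nonneg _).trans (hC 0)
  refine ⟨C, hC0, fun ε hε hε1 x => ?_⟩
  have e := congrFun (iteratedFDeriv_comp_const_smul (𝕜 := ℝ) (i := i) ε
    (hs.of_le (by exact_mod_cast le_top))) x
  rw [e, norm_smul, norm_pow, Real.norm_eq_abs, abs_of_nonneg hε]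
  have hp : ε ^ i ≤ 1 := pow_le_one₀ hε hε1
  by_cases hx : ε * ‖x‖ < 1
  · have hz : (fun x => 1 - ρ x) =ᶠ[𝓝 (ε • x)] fun _ => (0 : ℝ) := by
      have : Metric.ball (0 : Space n) 1 ∈ 𝓝 (ε • x) := by
        refine Metric.isOpen_ball.mem_nhds ?_
        rw [mem_ball_zero_iff, norm_smul, Real.norm_eq_abs, abs_of_nonneg hε]
        exact hx
      filter_upwards [this] with y hy
      rw [ρ.one_of_mem_closedBall, sub_self]
      rw [mem_ball_zero_iff] at hy
      rw [mem_closedBall_zero_iff]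
      linarith
    rw [(Filter.EventuallyEq.iteratedFDeriv ℝ hz i).eq_of_nhds]
    have : iteratedFDeriv ℝ i (fun _ : Space n => (0 : ℝ)) (ε • x) = 0 := by
      simp
    rw [this, norm_zero, mul_zero]
    positivity
  · push Not at hx
    calc ε ^ i * _ ≤ 1 * C := mul_le_mul hp (hC _) (norm_nonneg _) zero_le_one
      _ = C * 1 := by ring
      _ ≤ _ := mul_le_mul_of_nonneg_left hx hC0

/-- Truncation at radius of order m. By Leibniz, each seminorm of the error is 1/(m+1) times
seminorms with one more power of ‖x‖. -/
theorem dense_hasCompactSupport :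
    Dense {φ : 𝓢(Space n, ℂ) | HasCompactSupport φ} := by
  intro φ
  let ρ : ContDiffBump (0 : Space n) := ⟨1, 2, one_pos, one_lt_two⟩
  let c : ℕ → ℝ := fun m => 1 / ((m : ℝ) + 1)
  have hc0 : ∀ m, 0 < c m := fun m => by positivity
  have hc1 : ∀ m, c m ≤ 1 := fun m => by
    rw [div_le_one (by positivity)]
    linarith [(Nat.cast_nonneg m : (0 : ℝ) ≤ m)]
  have hcs : ∀ m, HasCompactSupport fun x : Space n => ρ (c m • x) := fun m =>
    ρ.hasCompactSupport.comp_homeomorph (Homeomorph.smulOfNeZero (c m) (hc0 m).ne')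
  have hsm : ∀ m, ContDiff ℝ ∞ fun x : Space n => ρ (c m • x) := fun m =>
    ρ.contDiff.comp (contDiff_const_smul _)
  have htg : ∀ m, (fun x : Space n => ρ (c m • x)).HasTemperateGrowth := fun m =>
    (hcs m).hasTemperateGrowth (hsm m)
  let Ψ : ℕ → 𝓢(Space n, ℂ) := fun m =>
    SchwartzMap.smulLeftCLM ℂ (fun x : Space n => ρ (c m • x)) φ
  have hΨ : ∀ m x, Ψ m x = ρ (c m • x) • φ x := fun m x =>
    SchwartzMap.smulLeftCLM_apply_apply (htg m) φ x
  refine mem_closure_of_tendsto (f := Ψ) (b := atTop) ?_ (Eventually.of_forall fun m => ?_)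
  · refine ((schwartz_withSeminorms ℝ (Space n) ℂ).tendsto_nhds Ψ φ).2 fun p δ hδ => ?_
    obtain ⟨k, j⟩ := p
    choose C hC0 hC using fun i => exists_norm_iteratedFDeriv_one_sub_bump_le ρ le_rfl i
    set K : ℝ := ∑ i ∈ Finset.range (j + 1),
      (j.choose i : ℝ) * C i * SchwartzMap.seminorm ℝ (k + 1) (j - i) φ with hK
    have hK0 : 0 ≤ K := Finset.sum_nonneg fun i _ =>
      mul_nonneg (mul_nonneg (Nat.cast_nonneg _) (hC0 i)) (apply_nonneg _ _)
    have key : ∀ m, SchwartzMap.seminorm ℝ k j (φ - Ψ m) ≤ c m * K := by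
      intro m
      refine SchwartzMap.seminorm_le_bound ℝ k j _ (mul_nonneg (hc0 m).le hK0) fun x => ?_
      have e : ((φ - Ψ m : 𝓢(Space n, ℂ)) : Space n → ℂ)
          = fun x => (1 - ρ (c m • x)) • φ x := by
        funext y
        rw [sub_apply, hΨ, sub_smul, one_smul]
      rw [e]
      have h := norm_iteratedFDeriv_smul_le (𝕜 := ℝ) (N := ∞) (n := j)
        (f := fun x : Space n => 1 - ρ (c m • x)) (g := φ) (contDiff_const.sub (hsm m))
        (φ.smooth ⊤) x (by exact_mod_cast le_top)
      calc ‖x‖ ^ k * ‖iteratedFDeriv ℝ j (fun x => (1 - ρ (c m • x)) • φ x) x‖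
          ≤ ‖x‖ ^ k * ∑ i ∈ Finset.range (j + 1), (j.choose i : ℝ) *
              ‖iteratedFDeriv ℝ i (fun x => 1 - ρ (c m • x)) x‖ *
              ‖iteratedFDeriv ℝ (j - i) φ x‖ := mul_le_mul_of_nonneg_left h (by positivity)
        _ ≤ c m * K := by
            rw [hK, Finset.mul_sum, Finset.mul_sum]
            refine Finset.sum_le_sum fun i _ => ?_
            have h1 := hC i (c m) (hc0 m).le (hc1 m) x
            have h2 := SchwartzMap.le_seminorm ℝ (k + 1) (j - i) φ x
            have h3 : 0 ≤ ‖iteratedFDeriv ℝ (j - i) φ x‖ := norm_nonneg _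
            calc ‖x‖ ^ k * ((j.choose i : ℝ) *
                  ‖iteratedFDeriv ℝ i (fun x => 1 - ρ (c m • x)) x‖ *
                  ‖iteratedFDeriv ℝ (j - i) φ x‖)
                ≤ ‖x‖ ^ k * ((j.choose i : ℝ) * (C i * (c m * ‖x‖)) *
                  ‖iteratedFDeriv ℝ (j - i) φ x‖) := by gcongr
              _ = c m * ((j.choose i : ℝ) * C i *
                  (‖x‖ ^ (k + 1) * ‖iteratedFDeriv ℝ (j - i) φ x‖)) := by ring
              _ ≤ _ := by
                  have := hC0 i
                  have := (hc0 m).le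
                  gcongr
    have ht : Tendsto (fun m => c m * K) atTop (𝓝 0) := by
      have := (tendsto_one_div_add_atTop_nhds_zero_nat (𝕜 := ℝ)).mul_const K
      rwa [zero_mul] at this
    filter_upwards [ht.eventually (gt_mem_nhds hδ)] with m hm
    rw [map_sub_rev]
    exact (key m).trans_lt hm
  · have : (Ψ m : Space n → ℂ) = fun x => ρ (c m • x) • φ x := funext (hΨ m)
    rw [Set.mem_ofPred_eq, this]
    exact (hcs m).smul_right

end Density

/-! ### Elementary properties of the Sobolev norm and continuity of solutions -/

section SobolevSpace

variable {n : ℕ} {s : ℝ} {f g : 𝓢'(Space n, ℂ)}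

theorem sobolevNorm_nonneg (s : ℝ) (f : 𝓢'(Space n, ℂ)) : 0 ≤ sobolevNorm s f := by
  unfold sobolevNorm
  split_ifs
  · exact norm_nonneg _
  · exact le_rfl

theorem abs_sobolevNorm_sub_le (hf : MemSobolev s 2 f) (hg : MemSobolev s 2 g) :
    |sobolevNorm s f - sobolevNorm s g| ≤ sobolevNorm s (f - g) := by
  obtain ⟨F, hF⟩ := hf
  obtain ⟨G, hG⟩ := hg
  have h : besselPotential (Space n) ℂ s (f - g)
      = ((F - G : Lp ℂ 2 (volume : Measure (Space n))) : 𝓢'(Space n, ℂ)) := by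
    rw [map_sub, hF, hG]
    exact (map_sub (Lp.toTemperedDistributionCLM ℂ (volume : Measure (Space n)) 2) F G).symm
  rw [sobolevNorm_eq hF, sobolevNorm_eq hG, sobolevNorm_eq h]
  exact abs_norm_sub_norm_le F G

theorem memSobolev_sub (hf : MemSobolev s 2 f) (hg : MemSobolev s 2 g) :
    MemSobolev s 2 (f - g) := by
  obtain ⟨F, hF⟩ := exists_hasSymbol hf
  obtain ⟨G, hG⟩ := exists_hasSymbol hg
  exact (hF.sub hG).memSobolev

theorem norm_apply_le (hf : MemSobolev s 2 f) (φ : 𝓢(Space n, ℂ)) :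
    ‖f φ‖ ≤ sobolevNorm s f * dualNorm s (𝓕⁻ φ) := by
  rw [apply_eq_fourier_apply]
  exact norm_fourier_apply_le hf _

end SobolevSpace

namespace IsSolution

variable {n : ℕ} {s a₀ : ℝ} {a : ℝ → ℝ} {u₀ : 𝓢'(Space n, ℂ)} {u : ℝ → 𝓢'(Space n, ℂ)}

theorem continuousOn_sobolevNorm (hu : IsSolution s a₀ a u₀ u) :
    ContinuousOn (fun t => sobolevNorm s (u t)) (Ici 0) := by
  intro t₀ ht₀
  refine tendsto_iff_dist_tendsto_zero.2 ?_
  refine squeeze_zero' (Eventually.of_forall fun t => dist_nonneg) ?_ (hu.continuous t₀ ht₀)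
  filter_upwards [self_mem_nhdsWithin] with t ht
  exact abs_sobolevNorm_sub_le (hu.memSobolev t ht) (hu.memSobolev t₀ ht₀)

theorem exists_sobolevNorm_le (hu : IsSolution s a₀ a u₀ u) (T : ℝ) :
    ∃ C, 0 ≤ C ∧ ∀ t ∈ Icc 0 T, sobolevNorm s (u t) ≤ C := by
  obtain ⟨C, hC⟩ := isCompact_Icc.exists_bound_of_continuousOn
    (hu.continuousOn_sobolevNorm.mono (Icc_subset_Ici_self : Icc 0 T ⊆ Ici 0))
  exact ⟨|C|, abs_nonneg C, fun t ht => (le_abs_self _).trans ((hC t ht).trans (le_abs_self C))⟩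

theorem continuousOn_apply (hu : IsSolution s a₀ a u₀ u) (φ : 𝓢(Space n, ℂ)) :
    ContinuousOn (fun t => u t φ) (Ici 0) := by
  intro t₀ ht₀
  refine tendsto_iff_norm_sub_tendsto_zero.2 ?_
  have h := (hu.continuous t₀ ht₀).mul_const (dualNorm s (𝓕⁻ φ))
  rw [zero_mul] at h
  refine squeeze_zero' (Eventually.of_forall fun t => norm_nonneg _) ?_ h
  filter_upwards [self_mem_nhdsWithin] with t ht
  exact norm_apply_le (memSobolev_sub (hu.memSobolev t ht) (hu.memSobolev t₀ ht₀)) φ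

end IsSolution

/-! ### From the weak formulation to an integrated Volterra equation -/

section Testing

variable {a₀ : ℝ} {a : ℝ → ℝ} {m l N : ℝ → ℂ} {θ : ℝ → ℝ}

theorem exists_eq_zero_of_hasCompactSupport (hc : HasCompactSupport θ) :
    ∃ T, 0 < T ∧ ∀ t, T ≤ |t| → θ t = 0 := by
  obtain ⟨R, hR⟩ := hc.isCompact.isBounded.subset_closedBall 0
  refine ⟨max R 0 + 1, by positivity, fun t ht => ?_⟩
  by_contra h
  have := hR (subset_tsupport θ h)
  rw [mem_closedBall_zero_iff, Real.norm_eq_abs] at this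
  linarith [le_max_left R 0]

theorem integrableOn_smul_of_hasCompactSupport (hθ : Continuous θ) (hc : HasCompactSupport θ)
    (hm : ContinuousOn m (Ici 0)) : IntegrableOn (fun t => θ t • m t) (Ioi 0) := by
  have h : Continuous fun t => θ t • m (max 0 t) :=
    hθ.smul (continuousOn_Ici_iff_continuous_max.1 hm)
  refine (h.integrable_of_hasCompactSupport hc.smul_right).integrableOn.congr_fun
    (fun t ht => ?_) measurableSet_Ioi
  simp only [max_eq_right (le_of_lt (mem_Ioi.1 ht))]

/-- Cutting l off at T, beyond which θ vanishes, changes nothing in the double integral and makes it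
absolutely convergent, as Fubini requires. -/
theorem integrable_memory_integrand (ha : IntegrableOn a (Ioi 0)) (hl : ContinuousOn l (Ici 0))
    (hθ : Continuous θ) (hc : HasCompactSupport θ) (T : ℝ) :
    Integrable (fun p : ℝ × ℝ => θ p.1 •
      ((Ioi (0 : ℝ)).indicator a (p.1 - p.2) • (Ioc 0 T).indicator l p.2))
      (volume.prod volume) := by
  have h1 : Integrable ((Ioc 0 T).indicator l) :=
    ((hl.mono Icc_subset_Ici_self).integrableOn_Icc.mono_set
      Ioc_subset_Icc_self).integrable_indicator measurableSet_Ioc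
  have h2 : Integrable ((Ioi (0 : ℝ)).indicator a) := ha.integrable_indicator measurableSet_Ioi
  have h3 := h1.convolution_integrand (ContinuousLinearMap.lsmul ℝ ℝ).flip h2
    (μ := (volume : Measure ℝ))
  obtain ⟨C, hC⟩ := hc.exists_bound_of_continuous hθ
  exact h3.bdd_smul C (hθ.comp continuous_fst).aestronglyMeasurable
    (ae_of_all _ fun p => hC p.1)

theorem integral_Ioi_memory (hT : ∀ t, T ≤ |t| → θ t = 0) {τ : ℝ} (hτ : 0 < τ) :
    ∫ t in Ioi τ, a (t - τ) • θ t • l τ = ∫ t, θ t •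
      ((Ioi (0 : ℝ)).indicator a (t - τ) • (Ioc 0 T).indicator l τ) := by
  rw [← integral_indicator measurableSet_Ioi]
  refine integral_congr_ae (ae_of_all _ fun t => ?_)
  beta_reduce
  by_cases ht : τ < t
  · rw [indicator_of_mem (mem_Ioi.2 ht), indicator_of_mem (mem_Ioi.2 (sub_pos.2 ht))]
    by_cases hτT : τ ≤ T
    · rw [indicator_of_mem (show τ ∈ Ioc 0 T from ⟨hτ, hτT⟩), smul_comm]
    · rw [hT t ((not_le.1 hτT).le.trans (ht.le.trans (le_abs_self t)))]
      simp
  · rw [indicator_of_notMem (by simpa using ht),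
      indicator_of_notMem (s := Ioi (0 : ℝ)) (by simpa using ht)]
    simp

theorem smul_causalConv_eq_integral (hT : ∀ t, T ≤ |t| → θ t = 0) {t : ℝ} (ht : 0 < t) :
    θ t • causalConv a l t = ∫ τ, θ t •
      ((Ioi (0 : ℝ)).indicator a (t - τ) • (Ioc 0 T).indicator l τ) := by
  rw [integral_smul]
  by_cases htT : T ≤ t
  · rw [hT t (htT.trans (le_abs_self t)), zero_smul, zero_smul]
  · congr 1
    have h := intervalIntegral.integral_comp_sub_left (fun s => a s • l (t - s)) t (a := 0) (b := t)
    simp only [sub_sub_cancel, sub_self, sub_zero] at h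
    rw [causalConv, ← h, intervalIntegral.integral_of_le ht.le, ← integral_indicator
      measurableSet_Ioc]
    refine integral_congr_ae ?_
    have hne : ∀ᵐ τ : ℝ, τ ≠ t := by simp [ae_iff, measure_singleton]
    filter_upwards [hne] with τ hτ
    by_cases h0 : 0 < τ
    · by_cases h1 : τ < t
      · rw [indicator_of_mem (show τ ∈ Ioc 0 t from ⟨h0, h1.le⟩),
          indicator_of_mem (mem_Ioi.2 (sub_pos.2 h1)),
          indicator_of_mem (show τ ∈ Ioc 0 T from ⟨h0, h1.le.trans (not_le.1 htT).le⟩)]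
      · have h2 : t < τ := lt_of_le_of_ne (not_lt.1 h1) hτ.symm
        rw [indicator_of_notMem (fun h => h1 (lt_of_le_of_ne h.2 hτ)),
          indicator_of_notMem (s := Ioi (0 : ℝ)) (by simpa using h2.le), zero_smul]
    · rw [indicator_of_notMem (fun h => h0 h.1), indicator_of_notMem (s := Ioc 0 T)
        (fun h => h0 h.1), smul_zero]

theorem integrableOn_memory (ha : IntegrableOn a (Ioi 0)) (hl : ContinuousOn l (Ici 0))
    (hθ : Continuous θ) (hc : HasCompactSupport θ) :
    IntegrableOn (fun τ => ∫ t in Ioi τ, a (t - τ) • θ t • l τ) (Ioi 0) := by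
  obtain ⟨T, -, hT⟩ := exists_eq_zero_of_hasCompactSupport hc
  exact (integrable_memory_integrand ha hl hθ hc T).integral_prod_right.integrableOn.congr_fun
    (fun τ hτ => (integral_Ioi_memory hT hτ).symm) measurableSet_Ioi

/-- Fubini moves the memory from the test function, where it looks into the future, to the solution,
where it looks into the past. -/
theorem integral_memory (ha : IntegrableOn a (Ioi 0)) (hl : ContinuousOn l (Ici 0))
    (hθ : Continuous θ) (hc : HasCompactSupport θ) :
    ∫ τ in Ioi 0, ∫ t in Ioi τ, a (t - τ) • θ t • l τ
      = ∫ t in Ioi 0, θ t • causalConv a l t := by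
  obtain ⟨T, -, hT⟩ := exists_eq_zero_of_hasCompactSupport hc
  have hi := integrable_memory_integrand ha hl hθ hc T
  have h1 : ∫ τ in Ioi 0, ∫ t in Ioi τ, a (t - τ) • θ t • l τ = ∫ τ, ∫ t, θ t •
      ((Ioi (0 : ℝ)).indicator a (t - τ) • (Ioc 0 T).indicator l τ) := by
    rw [setIntegral_congr_fun measurableSet_Ioi fun τ hτ => integral_Ioi_memory hT hτ]
    refine setIntegral_eq_integral_of_forall_compl_eq_zero fun τ hτ => ?_
    rw [indicator_of_notMem (s := Ioc 0 T) (fun h => hτ h.1)]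
    simp
  have h2 : ∫ t in Ioi 0, θ t • causalConv a l t = ∫ t, ∫ τ, θ t •
      ((Ioi (0 : ℝ)).indicator a (t - τ) • (Ioc 0 T).indicator l τ) := by
    rw [setIntegral_congr_fun measurableSet_Ioi fun t ht => smul_causalConv_eq_integral hT ht]
    refine setIntegral_eq_integral_of_forall_compl_eq_zero fun t ht => ?_
    refine integral_eq_zero_of_ae (ae_of_all _ fun τ => ?_)
    beta_reduce
    by_cases h0 : 0 < τ
    · have : t - τ ∉ Ioi (0 : ℝ) := by
        simp only [mem_Ioi, not_lt] at ht ⊢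
        linarith
      rw [indicator_of_notMem this]
      simp
    · rw [indicator_of_notMem (s := Ioc 0 T) (fun h => h0 h.1)]
      simp
  rw [h1, h2]
  exact (integral_integral_swap hi).symm

theorem integral_deriv_smul_primitive (hN : ContinuousOn N (Ici 0)) (hθ : ContDiff ℝ ∞ θ)
    (hc : HasCompactSupport θ) (c : ℂ) :
    ∫ t in Ioi 0, (deriv θ t • (c + ∫ s in (0 : ℝ)..t, N s) + θ t • N t) = -(θ 0 • c) := by
  have hP := continuousOn_primitive_of_Ici hN
  obtain ⟨T, hT0, hT⟩ := exists_eq_zero_of_hasCompactSupport hc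
  have hd : Continuous (deriv θ) := hθ.continuous_deriv (by simp)
  have h := integral_Ioi_of_hasDerivAt_of_tendsto
    (f := fun t => θ t • (c + ∫ s in (0 : ℝ)..t, N s))
    (f' := fun t => deriv θ t • (c + ∫ s in (0 : ℝ)..t, N s) + θ t • N t) (a := 0) (m := 0)
    ((hθ.continuous.continuousOn.smul (continuousOn_const.add hP)) 0 self_mem_Ici)
    (fun t ht => by
      have h1 := (hθ.differentiable (by simp) t).hasDerivAt
      have h2 := (hasDerivAt_primitive_of_Ici hN ht).const_add c
      have := h1.smul h2
      rwa [add_comm] at this)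
    ((integrableOn_smul_of_hasCompactSupport hd hc.deriv (continuousOn_const.add hP)).add
      (integrableOn_smul_of_hasCompactSupport hθ.continuous hc hN))
    (tendsto_const_nhds.congr' (by
      filter_upwards [eventually_ge_atTop T] with t ht
      rw [hT t (ht.trans (le_abs_self t)), zero_smul]))
  rw [h]
  simp

/-- The primitive that vanishes to the right of the support is cut off far out. The cutoff matters
only on the negative axis, where the primitive may be a non-zero constant and where the derivative
is not prescribed. -/
theorem exists_deriv_eq {ψ : ℝ → ℝ} (hψ : ContDiff ℝ ∞ ψ) (hc : HasCompactSupport ψ) :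
    ∃ θ : ℝ → ℝ, ContDiff ℝ ∞ θ ∧ HasCompactSupport θ ∧ ∀ t, 0 ≤ t → deriv θ t = ψ t := by
  obtain ⟨R, hR0, hR⟩ := exists_eq_zero_of_hasCompactSupport hc
  let χ : ContDiffBump (0 : ℝ) := ⟨R + 1, R + 2, by linarith, by linarith⟩
  have hder : ∀ t, HasDerivAt (fun t => ∫ s in R..t, ψ s) (ψ t) t := fun t =>
    intervalIntegral.integral_hasDerivAt_right (hψ.continuous.intervalIntegrable _ _)
      (hψ.continuous.stronglyMeasurableAtFilter _ _) hψ.continuous.continuousAt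
  have hF : ContDiff ℝ ∞ fun t => ∫ s in R..t, ψ s := by
    rw [contDiff_infty_iff_deriv]
    refine ⟨fun t => (hder t).differentiableAt, ?_⟩
    rwa [show deriv (fun t => ∫ s in R..t, ψ s) = ψ from funext fun t => (hder t).deriv]
  refine ⟨fun t => χ t * ∫ s in R..t, ψ s, χ.contDiff.mul hF, χ.hasCompactSupport.mul_right,
    fun t ht => ?_⟩
  by_cases htR : t < R + 1
  · have : (fun t => χ t * ∫ s in R..t, ψ s) =ᶠ[𝓝 t] fun t => ∫ s in R..t, ψ s := by
      have hmem : Metric.ball (0 : ℝ) (R + 1) ∈ 𝓝 t := Metric.isOpen_ball.mem_nhds (by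
        rwa [mem_ball_zero_iff, Real.norm_eq_abs, abs_of_nonneg ht])
      filter_upwards [hmem] with y hy
      rw [χ.one_of_mem_closedBall (Metric.ball_subset_closedBall hy), one_mul]
    rw [this.deriv_eq, (hder t).deriv]
  · have hz : ∀ y, R < y → ∫ s in R..y, ψ s = 0 := fun y hy => by
      refine intervalIntegral.integral_zero_ae (ae_of_all _ fun s hs => ?_)
      rw [uIoc_of_le hy.le] at hs
      exact hR s (hs.1.le.trans (le_abs_self s))
    have : (fun t => χ t * ∫ s in R..t, ψ s) =ᶠ[𝓝 t] fun _ => 0 := by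
      filter_upwards [Ioi_mem_nhds (show R < t by linarith)] with y hy
      rw [hz y hy, mul_zero]
    rw [this.deriv_eq, hR t ((by linarith : R ≤ t).trans (le_abs_self t))]
    simp

theorem eqOn_zero_of_integral_deriv_smul {h : ℝ → ℂ} (hh : ContinuousOn h (Ici 0))
    (H : ∀ θ : ℝ → ℝ, ContDiff ℝ ∞ θ → HasCompactSupport θ →
      ∫ t in Ioi 0, deriv θ t • h t = 0) : ∀ t, 0 < t → h t = 0 := by
  have h1 : ∀ᵐ t : ℝ, t ∈ Ioi (0 : ℝ) → h t = 0 := by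
    refine isOpen_Ioi.ae_eq_zero_of_integral_contDiff_smul_eq_zero
      ((hh.mono Ioi_subset_Ici_self).locallyIntegrableOn measurableSet_Ioi) fun ψ hψ hc hs => ?_
    obtain ⟨θ, hθ, hθc, hd⟩ := exists_deriv_eq hψ hc
    rw [← H θ hθ hθc, setIntegral_congr_fun (g := fun t => ψ t • h t) measurableSet_Ioi
      fun t ht => by simp only [hd t (le_of_lt ht)]]
    refine (setIntegral_eq_integral_of_forall_compl_eq_zero fun t ht => ?_).symm
    rw [image_eq_zero_of_notMem_tsupport (fun h' => ht (hs h')), zero_smul]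
  have h2 : h =ᵐ[volume.restrict (Ioi 0)] fun _ => 0 :=
    (ae_restrict_iff' measurableSet_Ioi).2 h1
  exact Measure.eqOn_open_of_ae_eq h2 isOpen_Ioi (hh.mono Ioi_subset_Ici_self) continuousOn_const

/-- Integration by parts shows that the integrated right-hand side satisfies the same identity, so
the difference is orthogonal to every θ' on the half line. By `exists_deriv_eq` these exhaust the
test functions there. -/
theorem eq_add_volterra_of_weak (ha : IntegrableOn a (Ioi 0)) (hm : ContinuousOn m (Ici 0))
    (hl : ContinuousOn l (Ici 0))
    (H : ∀ θ : ℝ → ℝ, ContDiff ℝ ∞ θ → HasCompactSupport θ →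
      (∫ τ in Ioi 0, (deriv θ τ • m τ + a₀ • θ τ • l τ + ∫ t in Ioi τ, a (t - τ) • θ t • l τ))
        + θ 0 • m 0 = 0) {t : ℝ} (ht : 0 ≤ t) : m t = m 0 + volterra a₀ a l t := by
  rcases ht.eq_or_lt with rfl | ht
  · simp [volterra]
  have hN := continuousOn_memOp (a₀ := a₀) ha hl
  have hV := continuousOn_volterra (a₀ := a₀) ha hl
  refine sub_eq_zero.1 (eqOn_zero_of_integral_deriv_smul
    (h := fun t => m t - (m 0 + volterra a₀ a l t)) (hm.sub (continuousOn_const.add hV))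
    (fun θ hθ hc => ?_) t ht)
  have hd : Continuous (deriv θ) := hθ.continuous_deriv (by simp)
  have i1 := integrableOn_smul_of_hasCompactSupport hd hc.deriv hm
  have i2 : IntegrableOn (fun t => a₀ • θ t • l t) (Ioi 0) :=
    (integrableOn_smul_of_hasCompactSupport hθ.continuous hc hl).smul a₀
  have i3 := integrableOn_memory ha hl hθ.continuous hc
  have i4 := integrableOn_smul_of_hasCompactSupport hθ.continuous hc hN
  have i5 : IntegrableOn (fun t => deriv θ t • (m 0 + volterra a₀ a l t)) (Ioi 0) :=
    integrableOn_smul_of_hasCompactSupport hd hc.deriv (continuousOn_const.add hV)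
  have i6 := integrableOn_smul_of_hasCompactSupport hθ.continuous hc
    (continuousOn_causalConv ha hl)
  have h1 := H θ hθ hc
  have h2 := integral_deriv_smul_primitive hN hθ hc (m 0)
  have i12 : IntegrableOn (fun t => deriv θ t • m t + a₀ • θ t • l t) (Ioi 0) := i1.add i2
  rw [integral_add i12 i3, integral_add i1 i2, integral_memory ha hl hθ.continuous hc,
    add_assoc (∫ t in Ioi 0, deriv θ t • m t), ← integral_add i2 i6] at h1
  have e : ∀ t, a₀ • θ t • l t + θ t • causalConv a l t = θ t • memOp a₀ a l t := fun t => by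
    rw [memOp, smul_add, smul_comm]
  have h3 : (∫ t in Ioi 0, (a₀ • θ t • l t + θ t • causalConv a l t))
      = ∫ t in Ioi 0, θ t • memOp a₀ a l t := by simp only [e]
  have h4 : (∫ t in Ioi 0, deriv θ t • (m 0 + volterra a₀ a l t))
      + ∫ t in Ioi 0, θ t • memOp a₀ a l t = -(θ 0 • m 0) := by
    rw [← integral_add i5 i4]
    exact h2
  simp only [smul_sub]
  rw [integral_sub i1 i5]
  rw [h3] at h1
  linear_combination h1 - h4

end Testing


/-! ### Iterating a chain of Volterra equations -/

section Iteration

variable {a₀ : ℝ} {a : ℝ → ℝ}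

theorem volterra_smul_const (f : ℝ → ℝ) (c : ℂ) (t : ℝ) :
    volterra a₀ a (fun s => f s • c) t = volterra a₀ a f t • c := by
  have h : ∀ s, memOp a₀ a (fun s => f s • c) s = memOp a₀ a f s • c := fun s => by
    simp only [memOp, causalConv, ← smul_assoc]
    rw [intervalIntegral.integral_smul_const, ← add_smul]
  simp only [volterra, h, intervalIntegral.integral_smul_const]

theorem volterra_iterate_const_sub (ha : IntegrableOn a (Ioi 0)) {f g : ℝ → ℂ}
    (hg : ContinuousOn g (Ici 0)) {c : ℂ} (h : ∀ t, 0 ≤ t → f t = c - g t) (k : ℕ) :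
    ∀ t, 0 ≤ t → (volterra a₀ a)^[k] f t
      = (volterra a₀ a)^[k] (fun _ => (1 : ℝ)) t • c - (volterra a₀ a)^[k] g t := by
  induction k with
  | zero =>
    intro t ht
    simpa using h t ht
  | succ k ih =>
    intro t ht
    simp only [Function.iterate_succ_apply']
    have h1 := continuousOn_volterra_iterate (a₀ := a₀) ha
      (continuousOn_const (c := (1 : ℝ)) (s := Ici 0)) k
    have h2 := continuousOn_volterra_iterate (a₀ := a₀) ha hg k
    rw [volterra_congr (g := fun s => (volterra a₀ a)^[k] (fun _ => (1 : ℝ)) s • c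
      + (-1) * (volterra a₀ a)^[k] g s) ht (fun s hs => by rw [ih s hs.1]; ring),
      volterra_add (f := fun s => (volterra a₀ a)^[k] (fun _ => (1 : ℝ)) s • c)
        (g := fun s => (-1) * (volterra a₀ a)^[k] g s) ha (h1.smul continuousOn_const)
        (continuousOn_const.mul h2) ht,
      volterra_smul_const, volterra_const_mul]
    ring

/-- Each equation is substituted into the previous one. In the application f j is the pairing of û
with the j-th power of the Laplace symbol times a test function, so the sum is a partial sum of the
resolvent series. -/
theorem eq_sum_add_volterra_iterate (ha : IntegrableOn a (Ioi 0)) {f : ℕ → ℝ → ℂ}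
    (hf : ∀ j, ContinuousOn (f j) (Ici 0))
    (h : ∀ j t, 0 ≤ t → f j t = f j 0 - volterra a₀ a (f (j + 1)) t) (N : ℕ) {t : ℝ}
    (ht : 0 ≤ t) :
    f 0 t = (∑ k ∈ Finset.range N,
      ((-1) ^ k * (volterra a₀ a)^[k] (fun _ => (1 : ℝ)) t) • f k 0)
      + (-1) ^ N * (volterra a₀ a)^[N] (f N) t := by
  induction N with
  | zero => simp
  | succ N ih =>
    rw [ih, Finset.sum_range_succ, volterra_iterate_const_sub ha
      (continuousOn_volterra ha (hf (N + 1))) (h N) N t ht, ← Function.iterate_succ_apply]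
    simp only [Complex.real_smul]
    push_cast
    ring

theorem continuous_resolvent_left (ha : IntegrableOn a (Ioi 0)) {t : ℝ} (ht : 0 ≤ t) :
    Continuous fun lam => resolvent a₀ a lam t := by
  refine continuous_iff_continuousAt.2 fun lam₀ => ?_
  have h : ContinuousOn (fun lam => resolvent a₀ a lam t) (Icc (-(|lam₀| + 1)) (|lam₀| + 1)) :=
    continuousOn_tsum (fun k => by fun_prop) (summable_resolvent_bound _)
      fun k lam hlam => norm_resolvent_term_le ha (abs_le.2 hlam) ⟨ht, le_rfl⟩ k
  exact h.continuousAt (Icc_mem_nhds (by linarith [neg_abs_le lam₀])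
    (by linarith [le_abs_self lam₀]))

end Iteration

/-! ### Test functions that are products in space and time -/

section Separation

variable {n : ℕ}

theorem laplacian_smul (c : ℂ) (φ : 𝓢(Space n, ℂ)) : Δ (c • φ) = c • Δ φ := by
  have h := map_smul (LineDeriv.laplacianCLM ℂ (Space n) 𝓢(Space n, ℂ)) c φ
  rwa [SchwartzMap.laplacianCLM_eq, SchwartzMap.laplacianCLM_eq] at h

theorem laplacian_sub (φ ψ : 𝓢(Space n, ℂ)) : Δ (φ - ψ) = Δ φ - Δ ψ := by
  have h := map_sub (LineDeriv.laplacianCLM ℂ (Space n) 𝓢(Space n, ℂ)) φ ψ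
  rwa [SchwartzMap.laplacianCLM_eq, SchwartzMap.laplacianCLM_eq, SchwartzMap.laplacianCLM_eq] at h

theorem continuous_laplacian : Continuous fun φ : 𝓢(Space n, ℂ) => Δ φ :=
  (LineDeriv.laplacianCLM ℂ (Space n) 𝓢(Space n, ℂ)).continuous.congr
    fun φ => SchwartzMap.laplacianCLM_eq ℂ φ

variable {θ : ℝ → ℝ} (φ : 𝓢(Space n, ℂ))

theorem contDiff_separated (hθ : ContDiff ℝ ∞ θ) :
    ContDiff ℝ ∞ fun p : Space n × ℝ => (θ p.2 : ℂ) * φ p.1 :=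
  (Complex.ofRealCLM.contDiff.comp (hθ.comp contDiff_snd)).mul ((φ.smooth ⊤).comp contDiff_fst)

theorem hasCompactSupport_separated (hc : HasCompactSupport θ) (hφ : HasCompactSupport φ) :
    HasCompactSupport fun p : Space n × ℝ => (θ p.2 : ℂ) * φ p.1 := by
  refine HasCompactSupport.intro (hφ.isCompact.prod hc.isCompact) fun p hp => ?_
  by_cases h1 : p.1 ∈ tsupport φ
  · have h2 : p.2 ∉ tsupport θ := fun h2 => hp ⟨h1, h2⟩
    simp [image_eq_zero_of_notMem_tsupport h2]
  · simp [image_eq_zero_of_notMem_tsupport h1]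

theorem slice_separated (hθ : ContDiff ℝ ∞ θ) (hc : HasCompactSupport θ)
    (hφ : HasCompactSupport φ) (t : ℝ) :
    slice _ (contDiff_separated φ hθ) (hasCompactSupport_separated φ hc hφ) t = (θ t : ℂ) • φ := by
  ext x
  simp

theorem timeDeriv_eq_deriv {Φ : Space n × ℝ → ℂ} (hΦ : ContDiff ℝ ∞ Φ) (x : Space n) (t : ℝ) :
    HasDerivAt (fun t => Φ (x, t)) (timeDeriv Φ (x, t)) t :=
  ((hΦ.differentiable (by simp)) (x, t)).hasFDerivAt.comp_hasDerivAt t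
    ((hasDerivAt_const t x).prodMk (hasDerivAt_id t))

theorem slice_timeDeriv_separated (hθ : ContDiff ℝ ∞ θ) (hc : HasCompactSupport θ)
    (hφ : HasCompactSupport φ) (t : ℝ) :
    slice _ (contDiff_timeDeriv (contDiff_separated φ hθ))
      (hasCompactSupport_timeDeriv (hasCompactSupport_separated φ hc hφ)) t
      = ((deriv θ t : ℝ) : ℂ) • φ := by
  ext x
  have h1 := timeDeriv_eq_deriv (contDiff_separated φ hθ) x t
  have h2 : HasDerivAt (fun t => (θ t : ℂ) * φ x) (((deriv θ t : ℝ) : ℂ) * φ x) t :=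
    ((hθ.differentiable (by simp) t).hasDerivAt.ofReal_comp).mul_const _
  simpa using h1.unique h2

end Separation

/-! ### The Fourier transform of a solution -/

namespace IsSolution

variable {n : ℕ} {s a₀ : ℝ} {a : ℝ → ℝ} {u₀ : 𝓢'(Space n, ℂ)} {u : ℝ → 𝓢'(Space n, ℂ)}

theorem apply_eq_of_hasCompactSupport (hu : IsSolution s a₀ a u₀ u)
    (ha : IntegrableOn a (Ioi 0)) {φ : 𝓢(Space n, ℂ)} (hφ : HasCompactSupport φ) {t : ℝ}
    (ht : 0 ≤ t) : u t φ = u 0 φ + volterra a₀ a (fun τ => u τ (Δ φ)) t := by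
  refine eq_add_volterra_of_weak (m := fun τ => u τ φ) ha (hu.continuousOn_apply φ)
    (hu.continuousOn_apply (Δ φ)) (fun θ hθ hc => ?_) ht
  have h := hu.weak _ (contDiff_separated φ hθ) (hasCompactSupport_separated φ hc hφ)
  simp only [slice_separated φ hθ hc hφ, slice_timeDeriv_separated φ hθ hc hφ, laplacian_smul,
    map_smul, smul_eq_mul] at h
  simpa only [Complex.real_smul, hu.initial] using h

/-- General Schwartz functions are needed because the functions used later have compactly supported
Fourier transforms, hence usually no compact support themselves. -/
theorem apply_eq (hu : IsSolution s a₀ a u₀ u) (ha : IntegrableOn a (Ioi 0))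
    (φ : 𝓢(Space n, ℂ)) {t : ℝ} (ht : 0 ≤ t) :
    u t φ = u 0 φ + volterra a₀ a (fun τ => u τ (Δ φ)) t := by
  obtain ⟨C, hC0, hC⟩ := hu.exists_sobolevNorm_le t
  set D : 𝓢(Space n, ℂ) → ℂ := fun φ => u t φ - u 0 φ - volterra a₀ a (fun τ => u τ (Δ φ)) t
    with hD
  set p : 𝓢(Space n, ℂ) → ℝ := fun φ => C * dualNorm s (𝓕⁻ φ) + C * dualNorm s (𝓕⁻ φ)
    + C * dualNorm s (𝓕⁻ (Δ φ)) * (memBound a₀ a * t) with hp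
  have hDp : ∀ φ, ‖D φ‖ ≤ p φ := by
    intro φ
    have hb : ∀ τ ∈ Icc 0 t, ∀ χ : 𝓢(Space n, ℂ), ‖u τ χ‖ ≤ C * dualNorm s (𝓕⁻ χ) :=
      fun τ hτ χ => (norm_apply_le (hu.memSobolev τ hτ.1) χ).trans
        (mul_le_mul_of_nonneg_right (hC τ hτ) (norm_nonneg _))
    have h3 := norm_volterra_iterate_le (a₀ := a₀) ha (fun τ hτ => hb τ hτ (Δ φ)) 1 t ⟨ht, le_rfl⟩
    simp only [Function.iterate_one, pow_one, Nat.factorial_one, Nat.cast_one, div_one] at h3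
    exact (norm_sub_le _ _).trans (add_le_add ((norm_sub_le _ _).trans
      (add_le_add (hb t ⟨ht, le_rfl⟩ φ) (hb 0 ⟨le_rfl, ht⟩ φ))) h3)
  have hDsub : ∀ φ ψ, D (φ - ψ) = D φ - D ψ := by
    intro φ ψ
    have h1 : volterra a₀ a (fun τ => u τ (Δ (φ - ψ))) t
        = volterra a₀ a (fun τ => u τ (Δ φ)) t - volterra a₀ a (fun τ => u τ (Δ ψ)) t := by
      rw [volterra_congr (g := fun τ => u τ (Δ φ) + (-1) * u τ (Δ ψ)) ht
        (fun τ _ => by rw [laplacian_sub, map_sub]; ring),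
        volterra_add (f := fun τ => u τ (Δ φ)) (g := fun τ => (-1) * u τ (Δ ψ)) ha
          (hu.continuousOn_apply _)
          (continuousOn_const.mul (hu.continuousOn_apply _)) ht, volterra_const_mul]
      ring
    simp only [hD, h1, map_sub]
    ring
  have hF : Continuous fun χ : 𝓢(Space n, ℂ) => dualNorm s (𝓕⁻ χ) :=
    (continuous_dualNorm s).comp
      (FourierTransform.fourierCLE ℂ 𝓢(Space n, ℂ)).symm.continuous
  have hpc : Continuous p :=
    ((continuous_const.mul hF).add (continuous_const.mul hF)).add
      ((continuous_const.mul (hF.comp continuous_laplacian)).mul continuous_const)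
  -- The defect D vanishes on compactly supported ψ, so ‖D φ‖ ≤ p(φ - ψ) for these. The condition is
  -- closed in ψ, so by density ψ = φ is allowed, where the right-hand side is 0.
  have hcl : IsClosed {ψ | ‖D φ‖ ≤ p (φ - ψ)} :=
    isClosed_le continuous_const (hpc.comp (continuous_const.sub continuous_id))
  have hsub : {ψ : 𝓢(Space n, ℂ) | HasCompactSupport ψ} ⊆ {ψ | ‖D φ‖ ≤ p (φ - ψ)} := by
    intro ψ hψ
    have h0 : D ψ = 0 := by
      simp only [hD]
      rw [hu.apply_eq_of_hasCompactSupport ha hψ ht]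
      ring
    have := hDp (φ - ψ)
    rwa [hDsub, h0, sub_zero] at this
  have hmem : ‖D φ‖ ≤ p (φ - φ) := (closure_minimal hsub hcl) (dense_hasCompactSupport φ)
  have hp0 : p (φ - φ) = 0 := by
    have e1 : dualNorm s (0 : 𝓢(Space n, ℂ)) = 0 := by
      have := dualNorm_le_of_norm_le (s := s) (ψ := (0 : 𝓢(Space n, ℂ))) (φ := 0) (K := 0) le_rfl
        (by simp)
      rw [zero_mul] at this
      exact le_antisymm this (norm_nonneg _)
    have e2 : Δ (0 : 𝓢(Space n, ℂ)) = 0 := by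
      have := laplacian_sub φ φ
      rwa [sub_self, sub_self] at this
    have e3 : 𝓕⁻ (0 : 𝓢(Space n, ℂ)) = 0 :=
      map_zero (FourierTransform.fourierCLE ℂ 𝓢(Space n, ℂ)).symm
    simp only [hp, sub_self, e2, e3, e1]
    ring
  rw [hp0] at hmem
  have : D φ = 0 := norm_le_zero_iff.1 hmem
  linear_combination this

theorem fourier_apply_eq (hu : IsSolution s a₀ a u₀ u) (ha : IntegrableOn a (Ioi 0))
    (ψ : 𝓢(Space n, ℂ)) {t : ℝ} (ht : 0 ≤ t) :
    𝓕 (u t) ψ = 𝓕 (u 0) ψ - volterra a₀ a (fun τ => 𝓕 (u τ) (lapMul ψ)) t := by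
  have h := hu.apply_eq ha (𝓕 ψ) ht
  simp only [fourier_laplacian_apply] at h
  have e : volterra a₀ a (fun τ => -𝓕 (u τ) (lapMul ψ)) t
      = -volterra a₀ a (fun τ => 𝓕 (u τ) (lapMul ψ)) t := by
    have := volterra_const_mul (a₀ := a₀) (a := a) (-1 : ℂ) (fun τ => 𝓕 (u τ) (lapMul ψ)) t
    simpa only [neg_one_mul] using this
  rw [e, ← sub_eq_add_neg] at h
  exact h

/-- On the support of ψ the Laplace symbol is at most K, so N-fold multiplication by it costs K^N,
which the N! of the iterated Volterra operator beats. No pointwise equation for û is needed. -/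
theorem tendsto_sum_fourier (hu : IsSolution s a₀ a u₀ u) (ha : IntegrableOn a (Ioi 0))
    {ψ : 𝓢(Space n, ℂ)} {K : ℝ} (hK0 : 0 ≤ K) (hK : ∀ ξ, ψ ξ ≠ 0 → lapSymbol ξ ≤ K) {t : ℝ}
    (ht : 0 ≤ t) :
    Tendsto (fun N => ∑ k ∈ Finset.range N,
      ((-1) ^ k * (volterra a₀ a)^[k] (fun _ => (1 : ℝ)) t) • 𝓕 (u 0) (lapMul^[k] ψ)) atTop
      (𝓝 (𝓕 (u t) ψ)) := by
  obtain ⟨C, hC0, hC⟩ := hu.exists_sobolevNorm_le t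
  have hd : ∀ k, dualNorm s (lapMul^[k] ψ) ≤ K ^ k * dualNorm s ψ := fun k => by
    refine dualNorm_le_of_norm_le (pow_nonneg hK0 k) fun ξ => ?_
    rw [lapMul_iterate_apply, norm_mul, norm_pow, Complex.norm_real, Real.norm_eq_abs,
      abs_of_nonneg (lapSymbol_nonneg ξ)]
    by_cases h : ψ ξ = 0
    · simp [h]
    · exact mul_le_mul_of_nonneg_right (pow_le_pow_left₀ (lapSymbol_nonneg ξ) (hK ξ h) k)
        (norm_nonneg _)
  have key : ∀ N, ‖𝓕 (u t) ψ - ∑ k ∈ Finset.range N,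
      ((-1) ^ k * (volterra a₀ a)^[k] (fun _ => (1 : ℝ)) t) • 𝓕 (u 0) (lapMul^[k] ψ)‖
      ≤ C * dualNorm s ψ * ((K * (memBound a₀ a * t)) ^ N / N.factorial) := by
    intro N
    have h1 := eq_sum_add_volterra_iterate (a₀ := a₀) ha
      (f := fun k τ => 𝓕 (u τ) (lapMul^[k] ψ))
      (fun j => hu.continuousOn_apply _) (fun j τ hτ => by
        simp only [Function.iterate_succ_apply']
        exact hu.fourier_apply_eq ha _ hτ) N ht
    simp only [Function.iterate_zero, id_eq] at h1
    rw [h1, add_sub_cancel_left, norm_mul, norm_pow, norm_neg, norm_one, one_pow, one_mul]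
    have h2 := norm_volterra_iterate_le (a₀ := a₀) (T := t) ha
      (f := fun τ => 𝓕 (u τ) (lapMul^[N] ψ)) (C := C * (K ^ N * dualNorm s ψ))
      (fun τ hτ => (norm_fourier_apply_le (hu.memSobolev τ hτ.1) _).trans
        (mul_le_mul (hC τ hτ) (hd N) (norm_nonneg _) hC0)) N t ⟨ht, le_rfl⟩
    refine h2.trans (le_of_eq ?_)
    rw [mul_pow]
    ring
  refine tendsto_iff_norm_sub_tendsto_zero.2 ?_
  have h0 := (FloorSemiring.tendsto_pow_div_factorial_atTop
    (K * (memBound a₀ a * t))).const_mul (C * dualNorm s ψ)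
  rw [mul_zero] at h0
  refine squeeze_zero (fun N => norm_nonneg _) (fun N => ?_) h0
  rw [norm_sub_rev]
  exact key N

theorem fourier_apply_eq_integral (hu : IsSolution s a₀ a u₀ u) (ha : IntegrableOn a (Ioi 0))
    {g₀ : Space n → ℂ} (hg : HasSymbol s u₀ g₀) {ψ : 𝓢(Space n, ℂ)} (hψ : HasCompactSupport ψ)
    {t : ℝ} (ht : 0 ≤ t) :
    𝓕 (u t) ψ = ∫ ξ, ψ ξ * (resolvent a₀ a (lapSymbol ξ) t * g₀ ξ) := by
  obtain ⟨K, hK⟩ := hψ.isCompact.exists_bound_of_continuousOn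
    (continuous_lapSymbol (n := n)).continuousOn
  have hK' : ∀ ξ, ψ ξ ≠ 0 → lapSymbol ξ ≤ |K| := fun ξ h =>
    ((le_abs_self _).trans (hK ξ (subset_tsupport _ h))).trans (le_abs_self K)
  refine tendsto_nhds_unique (hu.tendsto_sum_fourier ha (abs_nonneg K) hK' ht) ?_
  have e : ∀ N, ∑ k ∈ Finset.range N, ((-1) ^ k * (volterra a₀ a)^[k] (fun _ => (1 : ℝ)) t) •
      𝓕 (u 0) (lapMul^[k] ψ)
      = ∫ ξ, (resolventSum a₀ a N (lapSymbol ξ) t : ℂ) * (ψ ξ * g₀ ξ) := by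
    intro N
    have e1 : ∀ k, ((-1) ^ k * (volterra a₀ a)^[k] (fun _ => (1 : ℝ)) t) •
        𝓕 (u 0) (lapMul^[k] ψ) = ∫ ξ, (((-lapSymbol ξ) ^ k *
          (volterra a₀ a)^[k] (fun _ => (1 : ℝ)) t : ℝ) : ℂ) * (ψ ξ * g₀ ξ) := by
      intro k
      rw [hu.initial, hg.apply_eq, ← integral_smul]
      refine integral_congr_ae (ae_of_all _ fun ξ => ?_)
      simp only [lapMul_iterate_apply, Complex.real_smul]
      push_cast
      rw [neg_pow (lapSymbol ξ : ℂ)]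
      ring
    simp only [e1]
    rw [← integral_finsetSum]
    · simp only [resolventSum, Complex.ofReal_sum, Finset.sum_mul]
    · intro k _
      have := (hg.integrable_mul (lapMul^[k] ψ)).const_mul
        (((-1) ^ k * (volterra a₀ a)^[k] (fun _ => (1 : ℝ)) t : ℝ) : ℂ)
      refine this.congr (ae_of_all _ fun ξ => ?_)
      simp only [lapMul_iterate_apply]
      push_cast
      rw [neg_pow (lapSymbol ξ : ℂ)]
      ring
  simp only [e]
  have e2 : ∀ ξ, ψ ξ * (resolvent a₀ a (lapSymbol ξ) t * g₀ ξ)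
      = (resolvent a₀ a (lapSymbol ξ) t : ℂ) * (ψ ξ * g₀ ξ) := fun ξ => by ring
  simp only [e2]
  -- On the bounded support of ψ the partial sums of the resolvent are bounded by one exponential,
  -- independently of N.
  refine tendsto_integral_of_dominated_convergence
    (fun ξ => Real.exp (|K| * (memBound a₀ a * t)) * ‖ψ ξ * g₀ ξ‖) (fun N => ?_)
    ((hg.integrable_mul ψ).norm.const_mul _) (fun N => ae_of_all _ fun ξ => ?_)
    (ae_of_all _ fun ξ => ?_)
  · refine (Continuous.aestronglyMeasurable ?_).mul (hg.integrable_mul ψ).1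
    unfold resolventSum
    have := continuous_lapSymbol (n := n)
    fun_prop
  · rw [norm_mul]
    by_cases h : ψ ξ = 0
    · simp [h]
    · refine mul_le_mul_of_nonneg_right ?_ (norm_nonneg _)
      rw [Complex.norm_real, Real.norm_eq_abs]
      exact abs_resolventSum_le ha
        ((abs_of_nonneg (lapSymbol_nonneg ξ)).le.trans (hK' ξ h)) ht N
  · exact ((Complex.continuous_ofReal.tendsto _).comp
      (tendsto_resolventSum ha _ ht)).mul_const _

/-- The Fourier transform of a solution. -/
theorem hasSymbol (hu : IsSolution s a₀ a u₀ u) (ha : IntegrableOn a (Ioi 0))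
    {g₀ : Space n → ℂ} (hg : HasSymbol s u₀ g₀) {t : ℝ} (ht : 0 ≤ t) :
    HasSymbol s (u t) fun ξ => resolvent a₀ a (lapSymbol ξ) t * g₀ ξ := by
  obtain ⟨g, h⟩ := exists_hasSymbol (hu.memSobolev t ht)
  refine h.congr_ae (ae_eq_of_forall_integral_schwartz_mul h.locallyIntegrable ?_
    fun ψ hψ => ?_)
  · exact hg.locallyIntegrable.continuous_smul (g := fun ξ =>
      (resolvent a₀ a (lapSymbol ξ) t : ℂ)) (Complex.continuous_ofReal.comp
      ((continuous_resolvent_left ha ht).comp continuous_lapSymbol))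
  · rw [← h.apply_eq, hu.fourier_apply_eq_integral ha hg hψ ht]

end IsSolution


/-! ### The Gaussian and its Fourier transform -/

section HeatSymbol

variable {n : ℕ} {U₀ : ℂ} {A t : ℝ}

/-- The Fourier transform of the Gaussian. -/
def heatSymbol (U₀ : ℂ) (A t : ℝ) (ξ : Space n) : ℂ :=
  U₀ * (Real.exp (-(A * lapSymbol ξ * t)) : ℝ)

theorem continuous_heatSymbol : Continuous (heatSymbol (n := n) U₀ A t) := by
  have := continuous_lapSymbol (n := n)
  unfold heatSymbol
  fun_prop

theorem norm_heatSymbol_le (hA : 0 ≤ A) (ht : 0 ≤ t) (ξ : Space n) :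
    ‖heatSymbol U₀ A t ξ‖ ≤ ‖U₀‖ := by
  rw [heatSymbol, norm_mul, Complex.norm_real, Real.norm_eq_abs, Real.abs_exp]
  refine mul_le_of_le_one_right (norm_nonneg _) (Real.exp_le_one_iff.2 ?_)
  have := lapSymbol_nonneg ξ
  exact neg_nonpos.2 (by positivity)

theorem fourier_heatFlow_apply (hA : 0 < A) (ht : 0 ≤ t) (ψ : 𝓢(Space n, ℂ)) :
    𝓕 (heatFlow (n := n) U₀ A t) ψ = ∫ ξ, ψ ξ * heatSymbol U₀ A t ξ := by
  rw [TemperedDistribution.fourier_apply, heatFlow]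
  split_ifs with h
  · rw [ofIntegrable_apply (integrable_gaussian U₀ hA h)]
    set b : ℝ := 1 / (4 * A * t) with hb
    have hb0 : 0 < b := by positivity
    have hbre : 0 < (b : ℂ).re := by rwa [Complex.ofReal_re]
    set E : Space n → ℂ := fun x => Complex.exp (-(b : ℂ) * ‖x‖ ^ 2) with hE
    have hEi : Integrable E := by
      simpa [hE] using GaussianFourier.integrable_cexp_neg_mul_sq_norm_add (V := Space n) hbre 0 0
    have e1 : ∀ x : Space n, gaussian U₀ A t x
        = (U₀ * ((4 * A * Real.pi * t) ^ (-(n : ℝ) / 2) : ℝ)) * E x := fun x => by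
      rw [gaussian, hE, Complex.ofReal_mul, ← mul_assoc]
      simp only
      congr 1
      rw [hb, Complex.ofReal_exp]
      congr 1
      push_cast
      ring
    have e2 : ∀ ξ : Space n, 𝓕 E ξ = (((4 * A * Real.pi * t) ^ ((n : ℝ) / 2) : ℝ) : ℂ) *
        (Real.exp (-(A * lapSymbol ξ * t)) : ℝ) := fun ξ => by
      rw [hE, fourier_gaussian_innerProductSpace hbre, finrank_euclideanSpace_fin]
      congr 1
      · rw [Complex.ofReal_cpow (by positivity)]
        congr 1
        · rw [hb]
          push_cast
          field_simp
        · push_cast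
          rfl
      · rw [Complex.ofReal_exp, lapSymbol]
        congr 1
        rw [hb]
        push_cast
        field_simp
        ring
    have e3 : ((4 * A * Real.pi * t) ^ (-(n : ℝ) / 2)) * ((4 * A * Real.pi * t) ^ ((n : ℝ) / 2))
        = (1 : ℝ) := by
      rw [← Real.rpow_add (by positivity)]
      ring_nf
      simp
    have e4 : ∫ x, (𝓕 ψ) x * E x = ∫ x, ψ x * 𝓕 E x := by
      rw [← integral_fourier_mul_flip ψ.integrable hEi, SchwartzMap.fourier_coe]
    simp only [e1, mul_left_comm _ (U₀ * _)]
    rw [integral_const_mul, e4, ← integral_const_mul]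
    refine integral_congr_ae (ae_of_all _ fun ξ => ?_)
    simp only [e2, heatSymbol]
    have e5 := congrArg (fun x : ℝ => (x : ℂ)) e3
    simp only [Complex.ofReal_mul, Complex.ofReal_one] at e5
    linear_combination (U₀ * ψ ξ * (Real.exp (-(A * lapSymbol ξ * t)) : ℝ)) * e5
  · have ht0 : t = 0 := le_antisymm (not_lt.1 h) ht
    have h1 : (U₀ • TemperedDistribution.delta (0 : Space n)) (𝓕 ψ) = U₀ * (𝓕 ψ) 0 := rfl
    rw [h1, SchwartzMap.fourier_coe, Real.fourier_eq]
    simp [heatSymbol, ht0, integral_const_mul, mul_comm]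

/-- The Gaussian has total mass ‖U₀‖ at every time. Acting as measures of uniformly bounded mass,
the w(·,t) require only uniform convergence of test functions, which simplifies all arguments with
moving slices. -/
theorem norm_heatFlow_apply_le (hA : 0 < A) {φ : 𝓢(Space n, ℂ)} {M : ℝ}
    (hM : ∀ x, ‖φ x‖ ≤ M) (t : ℝ) : ‖heatFlow U₀ A t φ‖ ≤ ‖U₀‖ * M := by
  rw [heatFlow]
  split_ifs with h
  · rw [ofIntegrable_apply (integrable_gaussian U₀ hA h)]
    set b : ℝ := 1 / (4 * A * t) with hb
    have hb0 : 0 < b := by positivity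
    have e1 : ∀ x : Space n, ‖gaussian U₀ A t x‖
        = ‖U₀‖ * (4 * A * Real.pi * t) ^ (-(n : ℝ) / 2) * Real.exp (-b * ‖x‖ ^ 2) := fun x => by
      rw [gaussian, norm_mul, Complex.norm_real, Real.norm_eq_abs, abs_of_nonneg (by positivity),
        ← mul_assoc, hb]
      congr 2
      ring
    have e2 : ∫ x : Space n, ‖gaussian U₀ A t x‖ = ‖U₀‖ := by
      simp only [e1]
      rw [integral_const_mul, GaussianFourier.integral_rexp_neg_mul_sq_norm hb0,
        finrank_euclideanSpace_fin, mul_assoc, show Real.pi / b = 4 * A * Real.pi * t by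
          rw [hb]; field_simp, ← Real.rpow_add (by positivity)]
      ring_nf
      simp
    rw [← e2, ← integral_mul_const]
    refine norm_integral_le_of_norm_le ((integrable_gaussian U₀ hA h).norm.mul_const M)
      (ae_of_all _ fun x => ?_)
    rw [norm_mul, mul_comm]
    exact mul_le_mul_of_nonneg_left (hM x) (norm_nonneg _)
  · have h1 : (U₀ • TemperedDistribution.delta (0 : Space n)) φ = U₀ * φ 0 := rfl
    rw [h1, norm_mul]
    exact mul_le_mul_of_nonneg_left (hM 0) (norm_nonneg _)

theorem integrable_one_add_norm_sq_rpow {r : ℝ} (hr : r < -(n : ℝ) / 2) :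
    Integrable fun ξ : Space n => (1 + ‖ξ‖ ^ 2) ^ r := by
  have h := integrable_rpow_neg_one_add_norm_sq (E := Space n) (μ := volume) (r := -2 * r) (by
    rw [finrank_euclideanSpace_fin]; linarith)
  simpa only [neg_mul, neg_neg, mul_div_cancel_left₀ r (two_ne_zero' ℝ)] using h

theorem memLp_weight_mul_of_norm_le {r : ℝ} (hr : r < -(n : ℝ) / 2) {g : Space n → ℂ}
    (hg : AEStronglyMeasurable g) {M s : ℝ}
    (hM : ∀ ξ, sobolevWeight s ξ * ‖g ξ‖ ≤ M * sobolevWeight r ξ) :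
    MemLp (fun ξ => (sobolevWeight s ξ : ℂ) * g ξ) 2 := by
  have h1 : MemLp (fun ξ : Space n => sobolevWeight r ξ) 2 := by
    rw [memLp_two_iff_integrable_sq (continuous_sobolevWeight r).aestronglyMeasurable]
    simp only [sobolevWeight_sq]
    exact integrable_one_add_norm_sq_rpow hr
  refine (h1.const_mul M).of_le ((Complex.continuous_ofReal.comp
    (continuous_sobolevWeight s)).aestronglyMeasurable.mul hg) (ae_of_all _ fun ξ => ?_)
  rw [norm_mul, Complex.norm_real, Real.norm_eq_abs, abs_of_pos (sobolevWeight_pos s ξ)]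
  exact (hM ξ).trans (le_abs_self _)

theorem hasSymbol_heatFlow (hA : 0 < A) (ht : 0 ≤ t) {r : ℝ} (hr : r < -(n : ℝ) / 2) :
    HasSymbol r (heatFlow (n := n) U₀ A t) (heatSymbol U₀ A t) where
  memLp := memLp_weight_mul_of_norm_le hr continuous_heatSymbol.aestronglyMeasurable
    (M := ‖U₀‖) fun ξ => by
      rw [mul_comm]
      exact mul_le_mul_of_nonneg_right (norm_heatSymbol_le hA.le ht ξ) (sobolevWeight_pos r ξ).le
  apply_eq := fourier_heatFlow_apply hA ht

theorem exists_rpow_mul_exp_le (p : ℝ) {c : ℝ} (hc : 0 < c) :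
    ∃ C, ∀ x : ℝ, 1 ≤ x → x ^ p * Real.exp (-c * x) ≤ C := by
  have h := tendsto_rpow_mul_exp_neg_mul_atTop_nhds_zero p c hc
  obtain ⟨R, hR⟩ := eventually_atTop.1 (h.eventually (gt_mem_nhds zero_lt_one))
  have hcont : ContinuousOn (fun x : ℝ => x ^ p * Real.exp (-c * x)) (Icc 1 R) := by
    refine ContinuousOn.mul (fun x hx => ?_) (by fun_prop)
    exact (Real.continuousAt_rpow_const x p
      (Or.inl (zero_lt_one.trans_le hx.1).ne')).continuousWithinAt
  obtain ⟨C, hC⟩ := isCompact_Icc.exists_bound_of_continuousOn hcont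
  refine ⟨max C 1, fun x hx => ?_⟩
  rcases le_total x R with hxR | hxR
  · exact (le_abs_self _).trans ((hC x ⟨hx, hxR⟩).trans (le_max_left _ _))
  · exact (hR x hxR).le.trans (le_max_right _ _)

/-- At positive times the Gaussian factor beats any power of 1 + ‖ξ‖², so every Sobolev order is
allowed, in contrast to the time-uniform range r < -n/2. -/
theorem hasSymbol_heatFlow_of_pos (hA : 0 < A) (ht : 0 < t) (s : ℝ) :
    HasSymbol s (heatFlow (n := n) U₀ A t) (heatSymbol U₀ A t) where
  memLp := by
    set r : ℝ := -(n : ℝ) / 2 - 1 with hr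
    set c : ℝ := A * (2 * Real.pi) ^ 2 * t with hc
    obtain ⟨C, hC⟩ := exists_rpow_mul_exp_le (s / 2 - r / 2) (c := c) (by positivity)
    refine memLp_weight_mul_of_norm_le (r := r) (by rw [hr]; linarith)
      continuous_heatSymbol.aestronglyMeasurable (M := ‖U₀‖ * Real.exp c * C) fun ξ => ?_
    have h1 : (1 : ℝ) ≤ 1 + ‖ξ‖ ^ 2 := by linarith [sq_nonneg ‖ξ‖]
    have h := hC _ h1
    rw [heatSymbol, norm_mul, Complex.norm_real, Real.norm_eq_abs, Real.abs_exp, sobolevWeight,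
      sobolevWeight]
    have e1 : (1 + ‖ξ‖ ^ 2) ^ (s / 2)
        = (1 + ‖ξ‖ ^ 2) ^ (s / 2 - r / 2) * (1 + ‖ξ‖ ^ 2) ^ (r / 2) := by
      rw [← Real.rpow_add (by linarith)]
      ring_nf
    have e2 : Real.exp (-(A * lapSymbol ξ * t))
        = Real.exp c * Real.exp (-c * (1 + ‖ξ‖ ^ 2)) := by
      rw [← Real.exp_add, lapSymbol, hc]
      ring_nf
    rw [e1, e2]
    calc _ = ‖U₀‖ * Real.exp c * ((1 + ‖ξ‖ ^ 2) ^ (s / 2 - r / 2) *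
          Real.exp (-c * (1 + ‖ξ‖ ^ 2))) * (1 + ‖ξ‖ ^ 2) ^ (r / 2) := by ring
      _ ≤ _ := by gcongr
  apply_eq := fourier_heatFlow_apply hA ht.le

end HeatSymbol

/-! ### The heat flow tested with a fixed function -/

section HeatEquation

variable {n : ℕ} {U₀ : ℂ} {A : ℝ}

theorem heatFlow_zero : heatFlow (n := n) U₀ A 0 = U₀ • TemperedDistribution.delta 0 :=
  if_neg (lt_irrefl 0)

theorem continuousOn_heatFlow_apply (hA : 0 < A) (φ : 𝓢(Space n, ℂ)) :
    ContinuousOn (fun t => heatFlow U₀ A t φ) (Ici 0) := by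
  have h : Continuous fun t : ℝ => ∫ ξ, (𝓕⁻ φ) ξ * heatSymbol U₀ A (max 0 t) ξ := by
    refine continuous_of_dominated (bound := fun ξ => ‖(𝓕⁻ φ) ξ‖ * ‖U₀‖)
      (fun t => ((𝓕⁻ φ).continuous.mul continuous_heatSymbol).aestronglyMeasurable)
      (fun t => ae_of_all _ fun ξ => ?_) ((𝓕⁻ φ).integrable.norm.mul_const _)
      (ae_of_all _ fun ξ => ?_)
    · rw [norm_mul]
      exact mul_le_mul_of_nonneg_left (norm_heatSymbol_le hA.le (le_max_left _ _) ξ)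
        (norm_nonneg _)
    · unfold heatSymbol
      fun_prop
  refine h.continuousOn.congr fun t ht => ?_
  beta_reduce
  rw [max_eq_right (mem_Ici.1 ht), apply_eq_fourier_apply, fourier_heatFlow_apply hA ht]

/-- Differentiation under the integral on the Fourier side; the symbol stays bounded by ‖U₀‖ and the
test function absorbs the factor λ. -/
theorem hasDerivAt_heatFlow_apply (hA : 0 < A) (φ : 𝓢(Space n, ℂ)) {t : ℝ} (ht : 0 < t) :
    HasDerivAt (fun t => heatFlow U₀ A t φ) (A * heatFlow U₀ A t (Δ φ)) t := by
  set χ := 𝓕⁻ φ with hχ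
  have h := hasDerivAt_integral_of_dominated_loc_of_deriv_le (μ := (volume : Measure (Space n)))
    (F := fun t ξ => χ ξ * heatSymbol U₀ A t ξ)
    (F' := fun t ξ => -A * (lapMul χ ξ * heatSymbol U₀ A t ξ))
    (bound := fun ξ => A * (‖lapMul χ ξ‖ * ‖U₀‖)) (x₀ := t) (s := Ioi 0) (Ioi_mem_nhds ht)
    (Eventually.of_forall fun t =>
      (χ.continuous.mul continuous_heatSymbol).aestronglyMeasurable)
    ((hasSymbol_heatFlow (r := -(n : ℝ) / 2 - 1) hA ht.le (by linarith)).integrable_mul χ)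
    (continuous_const.mul
      ((lapMul χ).continuous.mul continuous_heatSymbol)).aestronglyMeasurable
    (ae_of_all _ fun ξ t ht => by
      rw [norm_mul, norm_neg, norm_mul, Complex.norm_real, Real.norm_eq_abs, abs_of_pos hA]
      have := norm_heatSymbol_le (U₀ := U₀) hA.le (le_of_lt ht) ξ
      gcongr)
    (((lapMul χ).integrable.norm.mul_const _).const_mul _)
    (ae_of_all _ fun ξ t _ => by
      have h1 : HasDerivAt (fun t : ℝ => -(A * lapSymbol ξ * t)) (-(A * lapSymbol ξ)) t := by
        have := (hasDerivAt_id t).const_mul (-(A * lapSymbol ξ))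
        simpa only [neg_mul, mul_one, id_eq] using this
      have h2 := (h1.exp.ofReal_comp.const_mul U₀).const_mul (χ ξ)
      refine h2.congr_deriv ?_
      rw [lapMul_apply, heatSymbol]
      push_cast
      ring)
  have e1 : (A : ℂ) * heatFlow U₀ A t (Δ φ) = ∫ ξ, -A * (lapMul χ ξ * heatSymbol U₀ A t ξ) := by
    have h1 : φ = 𝓕 χ := (FourierTransform.fourier_fourierInv_eq φ).symm
    rw [h1, fourier_laplacian_apply, fourier_heatFlow_apply hA ht.le, integral_const_mul]
    ring
  rw [e1]
  refine h.2.congr_of_eventuallyEq ?_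
  filter_upwards [Ioi_mem_nhds ht] with σ hσ
  rw [apply_eq_fourier_apply, fourier_heatFlow_apply hA (le_of_lt hσ)]

end HeatEquation

/-! ### Time slices of space-time test functions -/

section Slices

variable {n : ℕ} {Φ : Space n × ℝ → ℂ}

theorem exists_norm_slice_sub_le (hΦ : ContDiff ℝ ∞ Φ) (hc : HasCompactSupport Φ) {ε : ℝ}
    (hε : 0 < ε) : ∃ δ > 0, ∀ σ τ : ℝ, |σ - τ| < δ → ∀ x,
      ‖slice Φ hΦ hc σ x - slice Φ hΦ hc τ x‖ ≤ ε := by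
  have hu : UniformContinuous Φ :=
    hΦ.continuous.uniformContinuous_of_tendsto_cocompact hc.is_zero_at_infty
  obtain ⟨δ, hδ, h⟩ := Metric.uniformContinuous_iff.1 hu ε hε
  refine ⟨δ, hδ, fun σ τ hστ x => ?_⟩
  have := h (a := (x, σ)) (b := (x, τ)) (by simpa [Prod.dist_eq, Real.dist_eq, hδ] using hστ)
  rw [dist_eq_norm] at this
  exact this.le

theorem exists_slice_eq_zero (hΦ : ContDiff ℝ ∞ Φ) (hc : HasCompactSupport Φ) :
    ∃ T, ∀ t, T ≤ t → slice Φ hΦ hc t = 0 := by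
  obtain ⟨R, hR⟩ := (hc.isCompact.image continuous_snd).isBounded.subset_closedBall 0
  refine ⟨R + 1, fun t ht => ?_⟩
  ext x
  by_contra h
  have h1 := hR ⟨(x, t), subset_tsupport Φ h, rfl⟩
  rw [mem_closedBall_zero_iff, Real.norm_eq_abs] at h1
  linarith [le_abs_self t]

/-- The derivative of a function of `(x, t)` in the direction `(v, 0)`. -/
def spaceDeriv (v : Space n) (Φ : Space n × ℝ → ℂ) (p : Space n × ℝ) : ℂ :=
  fderiv ℝ Φ p (v, 0)

theorem contDiff_spaceDeriv (v : Space n) (hΦ : ContDiff ℝ ∞ Φ) :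
    ContDiff ℝ ∞ (spaceDeriv v Φ) :=
  (hΦ.fderiv_right (m := ∞) (by simp)).clm_apply contDiff_const

theorem hasCompactSupport_spaceDeriv (v : Space n) (hc : HasCompactSupport Φ) :
    HasCompactSupport (spaceDeriv v Φ) :=
  hc.fderiv_apply (𝕜 := ℝ) (v, 0)

theorem slice_spaceDeriv (v : Space n) (hΦ : ContDiff ℝ ∞ Φ) (hc : HasCompactSupport Φ) (t : ℝ) :
    slice _ (contDiff_spaceDeriv v hΦ) (hasCompactSupport_spaceDeriv v hc) t
      = LineDeriv.lineDerivOp v (slice Φ hΦ hc t) := by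
  ext x
  rw [SchwartzMap.lineDerivOp_apply_eq_fderiv]
  have h1 : HasFDerivAt (fun x => Φ (x, t)) ((fderiv ℝ Φ (x, t)).comp
      ((ContinuousLinearMap.id ℝ (Space n)).prod 0)) x :=
    ((hΦ.differentiable (by simp)) (x, t)).hasFDerivAt.comp x
      ((hasFDerivAt_id x).prodMk (hasFDerivAt_const t x))
  have h2 : fderiv ℝ (slice Φ hΦ hc t) x = _ := h1.fderiv
  rw [h2]
  rfl

/-- Writes the Laplacian through slices of other test functions on space-time, so that continuity in
time of pairings with slices applies to it. -/
theorem laplacian_slice (hΦ : ContDiff ℝ ∞ Φ) (hc : HasCompactSupport Φ) (t : ℝ) :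
    Δ (slice Φ hΦ hc t) = ∑ i : Fin n,
      slice _ (contDiff_spaceDeriv (EuclideanSpace.basisFun (Fin n) ℝ i)
        (contDiff_spaceDeriv (EuclideanSpace.basisFun (Fin n) ℝ i) hΦ))
        (hasCompactSupport_spaceDeriv _ (hasCompactSupport_spaceDeriv _ hc)) t := by
  rw [SchwartzMap.laplacian_eq_sum (EuclideanSpace.basisFun (Fin n) ℝ)]
  refine Finset.sum_congr rfl fun i _ => ?_
  rw [slice_spaceDeriv _ (contDiff_spaceDeriv _ hΦ) (hasCompactSupport_spaceDeriv _ hc),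
    slice_spaceDeriv _ hΦ hc]

/-- Mean value inequality in time; uniform continuity of the time derivative makes the estimate
uniform in x. -/
theorem isLittleO_slice (hΦ : ContDiff ℝ ∞ Φ) (hc : HasCompactSupport Φ) (τ : ℝ) {ε : ℝ}
    (hε : 0 < ε) : ∀ᶠ σ in 𝓝 τ, ∀ x, ‖(slice Φ hΦ hc σ - slice Φ hΦ hc τ - ((σ - τ : ℝ) : ℂ) •
      slice _ (contDiff_timeDeriv hΦ) (hasCompactSupport_timeDeriv hc) τ) x‖ ≤ ε * |σ - τ| := by
  obtain ⟨δ, hδ, h⟩ := exists_norm_slice_sub_le (contDiff_timeDeriv hΦ)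
    (hasCompactSupport_timeDeriv hc) hε
  filter_upwards [Metric.ball_mem_nhds τ hδ] with σ hσ x
  have hd : ∀ y ∈ Metric.ball τ δ, HasDerivWithinAt
      (fun y => Φ (x, y) - ((y : ℝ) : ℂ) * timeDeriv Φ (x, τ))
      (timeDeriv Φ (x, y) - timeDeriv Φ (x, τ)) (Metric.ball τ δ) y := fun y _ => by
    have h1 := timeDeriv_eq_deriv hΦ x y
    have h2 : HasDerivAt (fun y : ℝ => ((y : ℝ) : ℂ) * timeDeriv Φ (x, τ))
        (timeDeriv Φ (x, τ)) y := by
      simpa using (HasDerivAt.ofReal_comp (hasDerivAt_id y)).mul_const (timeDeriv Φ (x, τ))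
    exact (h1.sub h2).hasDerivWithinAt
  have := (convex_ball τ δ).norm_image_sub_le_of_norm_hasDerivWithin_le hd
    (fun y hy => h y τ (by rwa [Metric.mem_ball, Real.dist_eq] at hy) x)
    (Metric.mem_ball_self hδ) hσ
  rw [Real.norm_eq_abs] at this
  refine le_trans (le_of_eq ?_) this
  congr 1
  simp only [sub_apply, smul_apply, slice_apply, smul_eq_mul]
  push_cast
  ring

end Slices

/-! ### The heat flow solves the heat equation weakly -/

section HeatWeak

variable {n : ℕ} {U₀ : ℂ} {A : ℝ} {Φ : Space n × ℝ → ℂ}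

theorem continuousOn_heatFlow_slice (hA : 0 < A) (hΦ : ContDiff ℝ ∞ Φ)
    (hc : HasCompactSupport Φ) :
    ContinuousOn (fun t => heatFlow U₀ A t (slice Φ hΦ hc t)) (Ici 0) := by
  intro τ hτ
  have h1 : Tendsto (fun t => heatFlow U₀ A t (slice Φ hΦ hc t - slice Φ hΦ hc τ)) (𝓝[Ici 0] τ)
      (𝓝 0) := by
    refine Metric.tendsto_nhds.2 fun ε hε => ?_
    obtain ⟨δ, hδ, h⟩ := exists_norm_slice_sub_le hΦ hc
      (show 0 < ε / (‖U₀‖ + 1) by positivity)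
    filter_upwards [mem_nhdsWithin_of_mem_nhds (Metric.ball_mem_nhds τ hδ)] with t ht
    rw [dist_zero_right]
    refine (norm_heatFlow_apply_le hA (h t τ (by rwa [Metric.mem_ball, Real.dist_eq] at ht))
      t).trans_lt ?_
    rw [mul_div_assoc', div_lt_iff₀ (by positivity)]
    nlinarith [norm_nonneg U₀]
  have h2 := h1.add (continuousOn_heatFlow_apply (U₀ := U₀) hA (slice Φ hΦ hc τ) τ hτ)
  rw [zero_add] at h2
  refine h2.congr fun t => ?_
  rw [map_sub, sub_add_cancel]

/-- The slice at t is split into its first-order expansion at τ and a remainder that is uniformly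
o(|t - τ|). The mass bound makes the remainder negligible, and the expansion involves only fixed
test functions. -/
theorem hasDerivAt_heatFlow_slice (hA : 0 < A) (hΦ : ContDiff ℝ ∞ Φ) (hc : HasCompactSupport Φ)
    {τ : ℝ} (hτ : 0 < τ) :
    HasDerivAt (fun t => heatFlow U₀ A t (slice Φ hΦ hc t))
      (heatFlow U₀ A τ (slice _ (contDiff_timeDeriv hΦ) (hasCompactSupport_timeDeriv hc) τ)
        + A * heatFlow U₀ A τ (Δ (slice Φ hΦ hc τ))) τ := by
  set φ := slice Φ hΦ hc τ with hφ
  set χ := slice _ (contDiff_timeDeriv hΦ) (hasCompactSupport_timeDeriv hc) τ with hχ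
  have h1 : HasDerivAt (fun t => heatFlow U₀ A t
      (slice Φ hΦ hc t - φ - ((t - τ : ℝ) : ℂ) • χ)) 0 τ := by
    rw [hasDerivAt_iff_isLittleO]
    refine Asymptotics.isLittleO_iff.2 fun ε hε => ?_
    filter_upwards [isLittleO_slice hΦ hc τ (show 0 < ε / (‖U₀‖ + 1) by positivity)] with t ht
    have e : heatFlow U₀ A τ (slice Φ hΦ hc τ - φ - ((τ - τ : ℝ) : ℂ) • χ) = 0 := by
      simp [hφ]
    rw [e, sub_zero, smul_zero, sub_zero, Real.norm_eq_abs]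
    refine (norm_heatFlow_apply_le hA ht t).trans ?_
    rw [← mul_assoc]
    refine mul_le_mul_of_nonneg_right ?_ (abs_nonneg _)
    rw [mul_div_assoc', div_le_iff₀ (by positivity)]
    nlinarith [norm_nonneg U₀]
  have h2 : HasDerivAt (fun t => ((t - τ : ℝ) : ℂ) * heatFlow U₀ A t χ)
      (heatFlow U₀ A τ χ) τ := by
    have h := (((hasDerivAt_id τ).sub_const τ).ofReal_comp).mul
      (hasDerivAt_heatFlow_apply (U₀ := U₀) hA χ hτ)
    refine h.congr_deriv ?_
    simp
  have h3 := hasDerivAt_heatFlow_apply (U₀ := U₀) hA φ hτ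
  have h4 := (h1.add h2).add h3
  rw [zero_add] at h4
  refine h4.congr_of_eventuallyEq (Eventually.of_forall fun t => ?_)
  simp only [Pi.add_apply, map_sub, map_smul, smul_eq_mul]
  ring

/-- The condition r < -n/2 makes (1+‖ξ‖²)^r integrable, so the bounded symbols lie in H^r and are
continuous in time by dominated convergence, down to t = 0. The weak identity is the fundamental
theorem of calculus for the pairing with the moving slice. -/
theorem isSolution_heatFlow (hA : 0 < A) {r : ℝ} (hr : r < -(n : ℝ) / 2) :
    IsSolution r A 0 (U₀ • TemperedDistribution.delta 0) (heatFlow (n := n) U₀ A) where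
  memSobolev t ht := (hasSymbol_heatFlow hA ht hr).memSobolev
  initial := heatFlow_zero
  continuous t₀ ht₀ := by
    have h : Tendsto (fun t => sobolevNorm r (heatFlow (n := n) U₀ A t - heatFlow U₀ A t₀) ^ 2)
        (𝓝[Ici 0] t₀) (𝓝 0) := by
      have h1 : Tendsto (fun t => ∫ ξ : Space n, (1 + ‖ξ‖ ^ 2) ^ r *
          ‖heatSymbol U₀ A t ξ - heatSymbol U₀ A t₀ ξ‖ ^ 2) (𝓝[Ici 0] t₀)
          (𝓝 (∫ ξ : Space n, (1 + ‖ξ‖ ^ 2) ^ r *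
            ‖heatSymbol U₀ A t₀ ξ - heatSymbol U₀ A t₀ ξ‖ ^ 2)) := by
        refine tendsto_integral_filter_of_dominated_convergence
          (fun ξ => (1 + ‖ξ‖ ^ 2) ^ r * (‖U₀‖ + ‖U₀‖) ^ 2) (Eventually.of_forall fun t => ?_) ?_
          ((integrable_one_add_norm_sq_rpow hr).mul_const _) (ae_of_all _ fun ξ => ?_)
        · refine Continuous.aestronglyMeasurable (Continuous.mul ?_
            ((continuous_heatSymbol.sub continuous_heatSymbol).norm.pow 2))
          exact Continuous.rpow_const (by fun_prop) fun ξ => Or.inl (by positivity)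
        · filter_upwards [self_mem_nhdsWithin] with t ht
          refine ae_of_all _ fun ξ => ?_
          rw [Real.norm_eq_abs, abs_of_nonneg (by positivity)]
          refine mul_le_mul_of_nonneg_left ?_ (by positivity)
          exact pow_le_pow_left₀ (norm_nonneg _) ((norm_sub_le _ _).trans
            (add_le_add (norm_heatSymbol_le hA.le ht ξ) (norm_heatSymbol_le hA.le ht₀ ξ))) 2
        · have hcont : Continuous fun t => (1 + ‖ξ‖ ^ 2) ^ r *
              ‖heatSymbol U₀ A t ξ - heatSymbol U₀ A t₀ ξ‖ ^ 2 := by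
            unfold heatSymbol
            fun_prop
          exact (hcont.tendsto t₀).mono_left nhdsWithin_le_nhds
      simp only [sub_self, norm_zero, ne_eq, OfNat.ofNat_ne_zero, not_false_eq_true, zero_pow,
        mul_zero, integral_zero] at h1
      refine h1.congr' ?_
      filter_upwards [self_mem_nhdsWithin] with t ht
      exact (((hasSymbol_heatFlow hA ht hr).sub (hasSymbol_heatFlow hA ht₀ hr)).sobolevNorm_sq).symm
    have h2 := (Real.continuous_sqrt.tendsto 0).comp h
    rw [Real.sqrt_zero] at h2
    refine h2.congr fun t => ?_
    exact Real.sqrt_sq (sobolevNorm_nonneg _ _)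
  weak Φ hΦ hc := by
    obtain ⟨T, hT⟩ := exists_slice_eq_zero hΦ hc
    have hcont : ContinuousOn (fun τ => heatFlow U₀ A τ
        (slice _ (contDiff_timeDeriv hΦ) (hasCompactSupport_timeDeriv hc) τ)
        + A * heatFlow U₀ A τ (Δ (slice Φ hΦ hc τ))) (Ici 0) := by
      simp only [laplacian_slice, map_sum]
      exact (continuousOn_heatFlow_slice hA _ _).add (continuousOn_const.mul
        (continuousOn_finsetSum _ fun i _ => continuousOn_heatFlow_slice hA _ _))
    have hint : IntegrableOn (fun τ => heatFlow U₀ A τ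
        (slice _ (contDiff_timeDeriv hΦ) (hasCompactSupport_timeDeriv hc) τ)
        + A * heatFlow U₀ A τ (Δ (slice Φ hΦ hc τ))) (Ioi 0) := by
      obtain ⟨T', hT'⟩ := exists_slice_eq_zero (contDiff_timeDeriv hΦ)
        (hasCompactSupport_timeDeriv hc)
      have hz : Δ (0 : 𝓢(Space n, ℂ)) = 0 := by
        have := laplacian_sub (0 : 𝓢(Space n, ℂ)) 0
        rwa [sub_self, sub_self] at this
      refine ((hcont.mono
        (Icc_subset_Ici_self : Icc 0 (max T T') ⊆ Ici 0)).integrableOn_Icc).of_forall_sdiff_eq_zero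
        measurableSet_Ioi fun τ hτ => ?_
      have h1 : max T T' ≤ τ := by
        by_contra h
        exact hτ.2 ⟨le_of_lt hτ.1, (not_le.1 h).le⟩
      rw [hT τ ((le_max_left _ _).trans h1), hT' τ ((le_max_right _ _).trans h1), hz]
      simp
    have h := integral_Ioi_of_hasDerivAt_of_tendsto (a := 0) (m := 0)
      (continuousOn_heatFlow_slice (U₀ := U₀) hA hΦ hc 0 self_mem_Ici)
      (fun τ hτ => hasDerivAt_heatFlow_slice (U₀ := U₀) hA hΦ hc hτ) hint
      (tendsto_const_nhds.congr' (by
        filter_upwards [eventually_ge_atTop T] with t ht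
        rw [hT t ht, map_zero]))
    rw [heatFlow_zero] at h
    simp only [Pi.zero_apply, Complex.ofReal_zero, zero_mul, integral_zero, add_zero]
    rw [h]
    ring

end HeatWeak

/-! ### Uniqueness of solutions -/

section HeatUniqueness

variable {n : ℕ}

/-- The Fourier transform of a solution is the resolvent times that of the datum, hence is
determined by the datum. -/
theorem IsSolution.unique {s a₀ : ℝ} {a : ℝ → ℝ} {u₀ : 𝓢'(Space n, ℂ)}
    {u v : ℝ → 𝓢'(Space n, ℂ)} (hu : IsSolution s a₀ a u₀ u) (hv : IsSolution s a₀ a u₀ v)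
    (ha : IntegrableOn a (Ioi 0)) {t : ℝ} (ht : 0 ≤ t) : u t = v t := by
  obtain ⟨g, hg⟩ := exists_hasSymbol (hu.initial ▸ hu.memSobolev 0 le_rfl)
  refine fourier_injective fun ψ => ?_
  rw [(hu.hasSymbol ha hg ht).apply_eq, (hv.hasSymbol ha hg ht).apply_eq]

end HeatUniqueness


/-! ### Low and high frequency estimates of the error -/

section Asymptotics

variable {n : ℕ} {s A B M : ℝ} {y : ℝ → ℝ → ℝ} {g : Space n → ℂ}

theorem HasSymbol.integrable_sq {f : 𝓢'(Space n, ℂ)} (h : HasSymbol s f g) :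
    Integrable fun ξ => (1 + ‖ξ‖ ^ 2) ^ s * ‖g ξ‖ ^ 2 := by
  refine ((memLp_two_iff_integrable_sq_norm h.memLp.1).1 h.memLp).congr (ae_of_all _ fun ξ => ?_)
  simp only
  rw [norm_mul, mul_pow, Complex.norm_real, Real.norm_eq_abs, sq_abs, sobolevWeight_sq]

/-- The density of the square of the `H^s` norm of the difference between the solution and its
asymptotic profile. -/
def errorDensity (s A : ℝ) (y : ℝ → ℝ → ℝ) (g : Space n → ℂ) (t : ℝ) (ξ : Space n) : ℝ :=
  (1 + ‖ξ‖ ^ 2) ^ s * ‖y (lapSymbol ξ) t * g ξ - heatSymbol (g 0) A t ξ‖ ^ 2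

theorem errorDensity_nonneg (t : ℝ) (ξ : Space n) : 0 ≤ errorDensity s A y g t ξ := by
  unfold errorDensity; positivity

theorem measurable_errorDensity (hg : Continuous g) {t : ℝ}
    (hy : Measurable fun lam => y lam t) : Measurable (errorDensity s A y g t) := by
  have h1 : Measurable fun ξ : Space n => y (lapSymbol ξ) t :=
    hy.comp continuous_lapSymbol.measurable
  have h2 := (continuous_heatSymbol (n := n) (U₀ := g 0) (A := A) (t := t)).measurable
  have h3 := hg.measurable
  have h4 : Measurable fun ξ : Space n => (1 + ‖ξ‖ ^ 2) ^ s :=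
    (Continuous.rpow_const (by fun_prop) fun ξ => Or.inl (by positivity)).measurable
  unfold errorDensity
  exact h4.mul ((((Complex.measurable_ofReal.comp h1).mul h3).sub h2).norm.pow_const 2)

theorem sq_norm_le_lapSymbol (ξ : Space n) : ‖ξ‖ ^ 2 ≤ lapSymbol ξ := by
  have h : (1 : ℝ) ≤ (2 * Real.pi) ^ 2 := by nlinarith [Real.pi_gt_three]
  unfold lapSymbol
  nlinarith [sq_nonneg ‖ξ‖]

theorem lapSymbol_inv_sqrt_smul {t : ℝ} (ht : 0 < t) (ξ : Space n) :
    lapSymbol ((√t)⁻¹ • ξ) = lapSymbol ξ / t := by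
  unfold lapSymbol
  rw [norm_smul, mul_pow ‖_‖ ‖ξ‖, Real.norm_eq_abs, sq_abs, inv_pow, Real.sq_sqrt ht.le]
  ring

theorem heatSymbol_inv_sqrt_smul {U₀ : ℂ} {t : ℝ} (ht : 0 < t) (ξ : Space n) :
    heatSymbol U₀ A t ((√t)⁻¹ • ξ) = U₀ * (Real.exp (-(A * lapSymbol ξ)) : ℝ) := by
  rw [heatSymbol, lapSymbol_inv_sqrt_smul ht]
  congr 4
  field_simp

theorem integrable_exp_neg_mul_sq_norm {c : ℝ} (hc : 0 < c) :
    Integrable fun ξ : Space n => Real.exp (-c * ‖ξ‖ ^ 2) := by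
  have hc' : 0 < (c : ℂ).re := by rwa [Complex.ofReal_re]
  have h := (GaussianFourier.integrable_cexp_neg_mul_sq_norm_add (V := Space n) hc' 0 0).norm
  refine h.congr (ae_of_all _ fun ξ => ?_)
  beta_reduce
  rw [Complex.norm_exp]
  congr 1
  simp [← Complex.ofReal_pow]

/-- For ‖ξ‖ ≤ 1 one has min(1, λ) ≥ ‖ξ‖², so with ξ = η/√t both the resolvent and the heat factor
are bounded by Gaussians in η independent of t. The constant 3M is 2M from the resolvent plus M from
the heat flow. -/
theorem errorDensity_inv_sqrt_smul_le (hs : 0 ≤ s) (hA : 0 < A) (hB : 0 < B)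
    (hM : ∀ ξ, ‖g ξ‖ ≤ M)
    (hy : ∀ lam ≥ 0, ∀ t ≥ 0, |y lam t| ≤ 2 * Real.exp (-(B * min 1 lam * t)))
    {t : ℝ} (ht : 0 < t) {η : Space n} (hη : ‖(√t)⁻¹ • η‖ ≤ 1) :
    errorDensity s A y g t ((√t)⁻¹ • η)
      ≤ 2 ^ s * (3 * M) ^ 2 * Real.exp (-(2 * min A B) * ‖η‖ ^ 2) := by
  have hM0 : 0 ≤ M := (norm_nonneg _).trans (hM 0)
  set c := min A B with hc
  have h1 : (1 + ‖(√t)⁻¹ • η‖ ^ 2) ^ s ≤ 2 ^ s := by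
    refine Real.rpow_le_rpow (by positivity) ?_ hs
    nlinarith [norm_nonneg ((√t)⁻¹ • η)]
  have hlt : 0 ≤ lapSymbol η / t := div_nonneg (lapSymbol_nonneg η) ht.le
  have hsq : ‖η‖ ^ 2 / t = ‖(√t)⁻¹ • η‖ ^ 2 := by
    rw [norm_smul, mul_pow, Real.norm_eq_abs, sq_abs, inv_pow, Real.sq_sqrt ht.le]
    ring
  have h2 : ‖η‖ ^ 2 / t ≤ min 1 (lapSymbol η / t) := by
    refine le_min ?_ (div_le_div_of_nonneg_right (sq_norm_le_lapSymbol η) ht.le)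
    rw [hsq]
    exact pow_le_one₀ (norm_nonneg _) hη
  have h3 : |y (lapSymbol η / t) t| ≤ 2 * Real.exp (-c * ‖η‖ ^ 2) := by
    refine (hy _ hlt t ht.le).trans ?_
    refine mul_le_mul_of_nonneg_left (Real.exp_le_exp.2 ?_) zero_le_two
    have h4 : ‖η‖ ^ 2 ≤ min 1 (lapSymbol η / t) * t := by
      rwa [div_le_iff₀ ht] at h2
    have h5 : c * ‖η‖ ^ 2 ≤ B * (min 1 (lapSymbol η / t) * t) :=
      mul_le_mul (min_le_right _ _) h4 (sq_nonneg _) hB.le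
    linarith
  have h6 : Real.exp (-(A * lapSymbol η)) ≤ Real.exp (-c * ‖η‖ ^ 2) := by
    refine Real.exp_le_exp.2 ?_
    have : c * ‖η‖ ^ 2 ≤ A * lapSymbol η :=
      mul_le_mul (min_le_left _ _) (sq_norm_le_lapSymbol η) (sq_nonneg _) hA.le
    linarith
  have h7 : ‖y (lapSymbol ((√t)⁻¹ • η)) t * g ((√t)⁻¹ • η)
      - heatSymbol (g 0) A t ((√t)⁻¹ • η)‖ ≤ 3 * M * Real.exp (-c * ‖η‖ ^ 2) := by
    rw [lapSymbol_inv_sqrt_smul ht, heatSymbol_inv_sqrt_smul ht]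
    refine (norm_sub_le _ _).trans ?_
    rw [norm_mul, norm_mul, Complex.norm_real, Complex.norm_real, Real.norm_eq_abs,
      Real.norm_eq_abs, Real.abs_exp]
    calc _ ≤ 2 * Real.exp (-c * ‖η‖ ^ 2) * M + M * Real.exp (-c * ‖η‖ ^ 2) := by
          refine add_le_add (mul_le_mul h3 (hM _) (norm_nonneg _) (by positivity))
            (mul_le_mul (hM 0) h6 (Real.exp_pos _).le hM0)
      _ = _ := by ring
  have h8 : Real.exp (-(2 * c) * ‖η‖ ^ 2) = Real.exp (-c * ‖η‖ ^ 2) ^ 2 := by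
    rw [← Real.exp_nat_mul]
    push_cast
    ring_nf
  rw [errorDensity, h8, mul_assoc, ← mul_pow]
  exact mul_le_mul h1 (pow_le_pow_left₀ (norm_nonneg _) h7 2) (by positivity) (by positivity)

theorem tendsto_errorDensity_inv_sqrt_smul (hg : Continuous g)
    (hlim : ∀ lam ≥ 0,
      Tendsto (fun t => y (lam / t) t) atTop (𝓝 (Real.exp (-(A * lam))))) (η : Space n) :
    Tendsto (fun t => errorDensity s A y g t ((√t)⁻¹ • η)) atTop (𝓝 0) := by
  have h0 : Tendsto (fun t : ℝ => (√t)⁻¹ • η) atTop (𝓝 0) := by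
    have := (tendsto_inv_atTop_zero.comp Real.tendsto_sqrt_atTop).smul_const η
    rwa [zero_smul] at this
  have h1 : Tendsto (fun t : ℝ => (1 + ‖(√t)⁻¹ • η‖ ^ 2) ^ s) atTop (𝓝 1) := by
    have hc : Continuous fun x : Space n => (1 + ‖x‖ ^ 2) ^ s :=
      Continuous.rpow_const (by fun_prop) fun ξ => Or.inl (by positivity)
    have := (hc.tendsto 0).comp h0
    simpa only [Function.comp_def, norm_zero, ne_eq, OfNat.ofNat_ne_zero, not_false_eq_true,
      zero_pow, add_zero, Real.one_rpow] using this
  have h2 := (Complex.continuous_ofReal.tendsto _).comp (hlim _ (lapSymbol_nonneg η))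
  have h3 := (h2.mul ((hg.tendsto 0).comp h0)).sub_const
    (g 0 * (Real.exp (-(A * lapSymbol η)) : ℝ))
  have h4 := h1.mul (h3.norm.pow 2)
  have e : (1 : ℝ) * ‖(Real.exp (-(A * lapSymbol η)) : ℂ) * g 0
      - g 0 * (Real.exp (-(A * lapSymbol η)) : ℝ)‖ ^ 2 = 0 := by
    rw [mul_comm (g 0), sub_self]
    simp
  rw [e] at h4
  refine h4.congr' ?_
  filter_upwards [eventually_gt_atTop 0] with t ht
  simp only [errorDensity, lapSymbol_inv_sqrt_smul ht, heatSymbol_inv_sqrt_smul ht,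
    Function.comp_apply]

theorem tendsto_low_frequencies (hs : 0 ≤ s) (hA : 0 < A) (hB : 0 < B) (hg : Continuous g)
    (hM : ∀ ξ, ‖g ξ‖ ≤ M) (hym : ∀ t ≥ 0, Measurable fun lam => y lam t)
    (hy : ∀ lam ≥ 0, ∀ t ≥ 0, |y lam t| ≤ 2 * Real.exp (-(B * min 1 lam * t)))
    (hlim : ∀ lam ≥ 0,
      Tendsto (fun t => y (lam / t) t) atTop (𝓝 (Real.exp (-(A * lam))))) :
    Tendsto (fun t => √t ^ n * ∫ ξ in Metric.closedBall 0 1, errorDensity s A y g t ξ) atTop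
      (𝓝 0) := by
  set S : Set (Space n) := Metric.closedBall 0 1 with hS
  have hSm : MeasurableSet S := measurableSet_closedBall
  -- The factor √t ^ n is exactly the Jacobian of ξ = η/√t.
  have e : ∀ t : ℝ, √t ^ n * ∫ ξ in S, errorDensity s A y g t ξ
      = ∫ η, S.indicator (errorDensity s A y g t) ((√t)⁻¹ • η) := fun t => by
    rw [Measure.integral_comp_inv_smul_of_nonneg _ _ (Real.sqrt_nonneg t),
      finrank_euclideanSpace_fin, integral_indicator hSm, smul_eq_mul]
  simp only [e]
  have h := tendsto_integral_filter_of_dominated_convergence (μ := (volume : Measure (Space n)))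
    (l := atTop) (F := fun t η => S.indicator (errorDensity s A y g t) ((√t)⁻¹ • η))
    (f := fun _ => 0)
    (fun η => 2 ^ s * (3 * M) ^ 2 * Real.exp (-(2 * min A B) * ‖η‖ ^ 2)) ?_ ?_
    ((integrable_exp_neg_mul_sq_norm (by positivity)).const_mul _) (ae_of_all _ fun η => ?_)
  · simpa only [integral_zero] using h
  · filter_upwards [eventually_ge_atTop 0] with t ht
    exact (((measurable_errorDensity hg (hym t ht)).indicator hSm).comp
      (measurable_const_smul _)).aestronglyMeasurable
  · filter_upwards [eventually_gt_atTop 0] with t ht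
    refine ae_of_all _ fun η => ?_
    by_cases hη : (√t)⁻¹ • η ∈ S
    · rw [indicator_of_mem hη, Real.norm_eq_abs, abs_of_nonneg (errorDensity_nonneg _ _)]
      exact errorDensity_inv_sqrt_smul_le hs hA hB hM hy ht (mem_closedBall_zero_iff.1 hη)
    · rw [indicator_of_notMem hη, norm_zero]
      positivity
  · refine squeeze_zero (fun t => indicator_nonneg (fun ξ _ => errorDensity_nonneg _ _) _)
      (fun t => indicator_le_self' (fun ξ _ => errorDensity_nonneg _ _) _)
      (tendsto_errorDensity_inv_sqrt_smul hg hlim η)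

theorem tendsto_sqrt_pow_mul_exp_neg (n : ℕ) {c : ℝ} (hc : 0 < c) :
    Tendsto (fun t : ℝ => √t ^ n * Real.exp (-c * t)) atTop (𝓝 0) := by
  refine (tendsto_rpow_mul_exp_neg_mul_atTop_nhds_zero ((n : ℝ) / 2) c hc).congr' ?_
  filter_upwards [eventually_ge_atTop 0] with t ht
  rw [Real.sqrt_eq_rpow, ← Real.rpow_natCast, ← Real.rpow_mul ht]
  ring_nf

/-- Here min(1, λ) = 1, so the resolvent decays at a fixed rate. For the heat part, λ ≥ 1 and t ≥ 1
give 2λt ≥ t + λ, which splits off e^{-At} and leaves the heat symbol at time 1/2, square integrable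
with the Sobolev weight. -/
theorem errorDensity_le_of_one_le (hA : 0 < A)
    (hy : ∀ lam ≥ 0, ∀ t ≥ 0, |y lam t| ≤ 2 * Real.exp (-(B * min 1 lam * t)))
    {t : ℝ} (ht : 1 ≤ t) {ξ : Space n} (hξ : 1 ≤ ‖ξ‖) :
    errorDensity s A y g t ξ
      ≤ Real.exp (-(2 * B) * t) * (8 * ((1 + ‖ξ‖ ^ 2) ^ s * ‖g ξ‖ ^ 2))
        + Real.exp (-A * t) * (2 * ((1 + ‖ξ‖ ^ 2) ^ s * ‖heatSymbol (g 0) A (1 / 2) ξ‖ ^ 2)) := by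
  have hl : 1 ≤ lapSymbol ξ := by
    have := sq_norm_le_lapSymbol ξ
    nlinarith
  have ht0 : 0 ≤ t := zero_le_one.trans ht
  have h1 := hy _ (lapSymbol_nonneg ξ) t ht0
  rw [min_eq_left hl, mul_one] at h1
  have h2 : ‖(y (lapSymbol ξ) t : ℂ) * g ξ‖ ^ 2 ≤ 4 * Real.exp (-(2 * B) * t) * ‖g ξ‖ ^ 2 := by
    rw [norm_mul, mul_pow, Complex.norm_real, Real.norm_eq_abs]
    refine mul_le_mul_of_nonneg_right ?_ (sq_nonneg _)
    refine (pow_le_pow_left₀ (abs_nonneg _) h1 2).trans (le_of_eq ?_)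
    rw [mul_pow, ← Real.exp_nat_mul]
    push_cast
    ring_nf
  have h3 : ‖heatSymbol (g 0) A t ξ‖ ^ 2
      ≤ Real.exp (-A * t) * ‖heatSymbol (g 0) A (1 / 2) ξ‖ ^ 2 := by
    rw [heatSymbol, heatSymbol, norm_mul, norm_mul, mul_pow, mul_pow, Complex.norm_real,
      Complex.norm_real, Real.norm_eq_abs, Real.norm_eq_abs, Real.abs_exp, Real.abs_exp,
      mul_left_comm]
    refine mul_le_mul_of_nonneg_left ?_ (sq_nonneg _)
    rw [← Real.exp_nat_mul, ← Real.exp_nat_mul, ← Real.exp_add]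
    refine Real.exp_le_exp.2 ?_
    push_cast
    have h4 : A * t + A * lapSymbol ξ ≤ 2 * (A * (lapSymbol ξ * t)) := by
      have : t + lapSymbol ξ ≤ 2 * (lapSymbol ξ * t) := by nlinarith
      nlinarith
    linarith
  have h5 : ‖(y (lapSymbol ξ) t : ℂ) * g ξ - heatSymbol (g 0) A t ξ‖ ^ 2
      ≤ 2 * ‖(y (lapSymbol ξ) t : ℂ) * g ξ‖ ^ 2 + 2 * ‖heatSymbol (g 0) A t ξ‖ ^ 2 := by
    have h6 := norm_sub_le ((y (lapSymbol ξ) t : ℂ) * g ξ) (heatSymbol (g 0) A t ξ)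
    have h7 := pow_le_pow_left₀ (norm_nonneg _) h6 2
    nlinarith [sq_nonneg (‖(y (lapSymbol ξ) t : ℂ) * g ξ‖ - ‖heatSymbol (g 0) A t ξ‖)]
  have hw : 0 ≤ (1 + ‖ξ‖ ^ 2) ^ s := by positivity
  calc errorDensity s A y g t ξ ≤ (1 + ‖ξ‖ ^ 2) ^ s *
        (2 * (4 * Real.exp (-(2 * B) * t) * ‖g ξ‖ ^ 2)
          + 2 * (Real.exp (-A * t) * ‖heatSymbol (g 0) A (1 / 2) ξ‖ ^ 2)) :=
        mul_le_mul_of_nonneg_left (by linarith) hw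
    _ = _ := by ring

theorem tendsto_high_frequencies (hA : 0 < A) (hB : 0 < B)
    (hgi : Integrable fun ξ => (1 + ‖ξ‖ ^ 2) ^ s * ‖g ξ‖ ^ 2)
    (hy : ∀ lam ≥ 0, ∀ t ≥ 0, |y lam t| ≤ 2 * Real.exp (-(B * min 1 lam * t))) :
    Tendsto (fun t => √t ^ n * ∫ ξ in (Metric.closedBall 0 1)ᶜ, errorDensity s A y g t ξ) atTop
      (𝓝 0) := by
  set S : Set (Space n) := (Metric.closedBall 0 1)ᶜ with hS
  have hSm : MeasurableSet S := measurableSet_closedBall.compl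
  have hhi : Integrable fun ξ => (1 + ‖ξ‖ ^ 2) ^ s * ‖heatSymbol (n := n) (g 0) A (1 / 2) ξ‖ ^ 2 :=
    (hasSymbol_heatFlow_of_pos hA one_half_pos s).integrable_sq
  set I := ∫ ξ in S, 8 * ((1 + ‖ξ‖ ^ 2) ^ s * ‖g ξ‖ ^ 2) with hI
  set J := ∫ ξ in S, 2 * ((1 + ‖ξ‖ ^ 2) ^ s * ‖heatSymbol (g 0) A (1 / 2) ξ‖ ^ 2) with hJ
  have h0 := ((tendsto_sqrt_pow_mul_exp_neg n (show 0 < 2 * B by positivity)).mul_const I).add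
    ((tendsto_sqrt_pow_mul_exp_neg n hA).mul_const J)
  simp only [zero_mul, add_zero] at h0
  refine squeeze_zero' (Eventually.of_forall fun t => mul_nonneg (by positivity)
    (integral_nonneg fun ξ => errorDensity_nonneg _ _)) ?_ h0
  filter_upwards [eventually_ge_atTop 1] with t ht
  rw [mul_assoc, mul_assoc, ← mul_add]
  refine mul_le_mul_of_nonneg_left ?_ (by positivity)
  have i1 := ((hgi.const_mul 8).integrableOn (s := S)).const_mul (Real.exp (-(2 * B) * t))
  have i2 := ((hhi.const_mul 2).integrableOn (s := S)).const_mul (Real.exp (-A * t))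
  rw [hI, hJ, ← integral_const_mul, ← integral_const_mul, ← integral_add i1 i2]
  refine integral_mono_of_nonneg (ae_of_all _ fun ξ => errorDensity_nonneg _ _) (i1.add i2) ?_
  refine (ae_restrict_iff' hSm).2 (ae_of_all _ fun ξ hξ => ?_)
  refine errorDensity_le_of_one_le hA hy ht (le_of_lt ?_)
  rw [hS, mem_compl_iff, mem_closedBall_zero_iff, not_le] at hξ
  exact hξ

end Asymptotics

/-! ### The Fourier transform of the initial datum -/

section InitialDatum

variable {n : ℕ}

/-- Integrability selects a continuous representative of the symbol; its value at 0 is meaningful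
and equals the mass. -/
theorem hasSymbol_fourier {s : ℝ} (u₀ : Lp ℂ 1 (volume : Measure (Space n)))
    (hu₀ : MemSobolev s 2 (u₀ : 𝓢'(Space n, ℂ))) :
    Continuous (𝓕 (u₀ : Space n → ℂ)) ∧
      HasSymbol s (u₀ : 𝓢'(Space n, ℂ)) (𝓕 (u₀ : Space n → ℂ)) := by
  have hi : Integrable (u₀ : Space n → ℂ) := L1.integrable_coeFn u₀
  have hc : Continuous (𝓕 (u₀ : Space n → ℂ)) :=
    VectorFourier.fourierIntegral_continuous Real.continuous_fourierChar continuous_inner hi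
  refine ⟨hc, ?_⟩
  obtain ⟨g, hg⟩ := exists_hasSymbol hu₀
  refine hg.congr_ae (ae_eq_of_forall_integral_schwartz_mul hg.locallyIntegrable
    hc.locallyIntegrable fun ψ _ => ?_)
  rw [← hg.apply_eq, TemperedDistribution.fourier_apply, Lp.toTemperedDistribution_apply,
    ← integral_fourier_mul_flip ψ.integrable hi, SchwartzMap.fourier_coe]
  rfl

end InitialDatum

end MemoryDiffusion

end

/-! ### The main theorem -/

open MemoryDiffusion in
theorem corollary5p2 (n : ℕ) (s : ℝ) (hs : 0 ≤ s)
    -- the kernel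
    (a₀ : ℝ) (ha₀ : 0 ≤ a₀) (a : ℝ → ℝ) (α : ℝ) (hα : 0 < α)
    (ha : IntegrableOn (fun t => Real.exp (α * t) * a t) (Ioi 0))
    (hpos : (0 < a₀ ∧ ∀ y : ℝ, 0 < a₀ + (laplace a (y * Complex.I)).re) ∨
      ∀ y : ℝ, 0 ≤ (laplace a (-α + y * Complex.I)).re)
    (hne : a₀ ≠ 0 ∨ ¬ (∀ᵐ t ∂volume.restrict (Ioi (0 : ℝ)), a t = 0))
    -- the initial data, in `L¹ ∩ H^s`
    (u₀ : Lp ℂ 1 (volume : Measure (Space n))) (hu₀ : MemSobolev s 2 (u₀ : 𝓢'(Space n, ℂ)))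
    -- the solution
    (u : ℝ → 𝓢'(Space n, ℂ)) (hu : IsSolution s a₀ a (u₀ : 𝓢'(Space n, ℂ)) u) :
    -- `w` is the solution of `w_t = A_∞ Δw`, `w(·,0) = U₀ δ₀`
    (∀ r : ℝ, r < -(n : ℝ) / 2 →
      IsSolution r (diffusivity a₀ a) 0 ((∫ x, u₀ x) • TemperedDistribution.delta 0)
        (heatFlow (n := n) (∫ x, u₀ x) (diffusivity a₀ a)) ∧
      ∀ v : ℝ → 𝓢'(Space n, ℂ),
        IsSolution r (diffusivity a₀ a) 0 ((∫ x, u₀ x) • TemperedDistribution.delta 0) v →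
        ∀ t, 0 ≤ t → v t = heatFlow (∫ x, u₀ x) (diffusivity a₀ a) t) ∧
    -- the asymptotics
    (∀ t, 0 < t → MemSobolev s 2 (u t - heatFlow (∫ x, u₀ x) (diffusivity a₀ a) t)) ∧
    (fun t => sobolevNorm s (u t - heatFlow (∫ x, u₀ x) (diffusivity a₀ a) t))
      =o[atTop] (fun t : ℝ => t ^ (-(n : ℝ) / 4)) := by
  obtain ⟨b, hb, c, hc, M, hM, hbα, hS⟩ := exists_symbolBound ha₀ hα ha hpos hne
  obtain ⟨B, hB, hdecay⟩ := exists_resolvent_decay hb hc hM hbα ha hS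
  have hA : 0 < diffusivity a₀ a := diffusivity_pos hb.le hc hS
  have hai : IntegrableOn a (Ioi 0) := integrableOn_of_exp_mul hα.le ha
  obtain ⟨hgc, hg⟩ := hasSymbol_fourier u₀ hu₀
  set g : Space n → ℂ := FourierTransform.fourier (u₀ : Space n → ℂ) with hg_def
  have hg0 : g 0 = ∫ x, u₀ x := by simp [hg_def, Real.fourier_eq]
  have hgM : ∀ ξ, ‖g ξ‖ ≤ ∫ x, ‖u₀ x‖ := fun ξ =>
    VectorFourier.norm_fourierIntegral_le_integral_norm _ _ _ _ _
  rw [← hg0]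
  have hsym : ∀ t, 0 < t → HasSymbol s (u t - heatFlow (g 0) (diffusivity a₀ a) t) fun ξ =>
      resolvent a₀ a (lapSymbol ξ) t * g ξ - heatSymbol (g 0) (diffusivity a₀ a) t ξ :=
    fun t ht => (hu.hasSymbol hai hg ht.le).sub (hasSymbol_heatFlow_of_pos hA ht s)
  refine ⟨fun r hr => ⟨isSolution_heatFlow hA hr, fun v hv t ht =>
    hv.unique (isSolution_heatFlow hA hr) integrableOn_zero ht⟩,
    fun t ht => (hsym t ht).memSobolev, ?_⟩
  have hle : ∀ lam ≥ 0, ∀ t ≥ 0, |resolvent a₀ a lam t| ≤ 2 := fun lam hlam t ht =>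
    (hdecay lam hlam t ht).trans (by
      have : 0 ≤ B * min 1 lam * t :=
        mul_nonneg (mul_nonneg hB.le (le_min zero_le_one hlam)) ht
      linarith [Real.exp_le_one_iff.2 (neg_nonpos.2 this)])
  have hlow := tendsto_low_frequencies hs hA hB hgc hgM
    (fun t ht => measurable_resolvent hai ht) hdecay
    (fun lam hlam => tendsto_resolvent_div hα ha hA.le hle hlam)
  have hhigh := tendsto_high_frequencies (n := n) hA hB hg.integrable_sq hdecay
  have hsum := hlow.add hhigh
  rw [add_zero] at hsum
  have hsqrt := (Real.continuous_sqrt.tendsto 0).comp hsum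
  rw [Real.sqrt_zero] at hsqrt
  -- Since √t ^ n is the square of t^{n/4}, the square root of the rescaled squared error is the
  -- norm divided by t^{-n/4}.
  refine (Asymptotics.isLittleO_iff_tendsto' ?_).2 (hsqrt.congr' ?_)
  · filter_upwards [eventually_gt_atTop 0] with t ht h0
    exact absurd h0 (Real.rpow_pos_of_pos ht _).ne'
  · filter_upwards [eventually_gt_atTop 0] with t ht
    have hI : Integrable (errorDensity s (diffusivity a₀ a) (resolvent a₀ a) g t) :=
      (hsym t ht).integrable_sq
    have hpow : √t ^ n = (t ^ ((n : ℝ) / 4)) ^ 2 := by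
      rw [Real.sqrt_eq_rpow, ← Real.rpow_natCast, ← Real.rpow_natCast, ← Real.rpow_mul ht.le,
        ← Real.rpow_mul ht.le]
      congr 1
      push_cast
      ring
    have hsq : sobolevNorm s (u t - heatFlow (g 0) (diffusivity a₀ a) t) ^ 2
        = ∫ ξ, errorDensity s (diffusivity a₀ a) (resolvent a₀ a) g t ξ :=
      (hsym t ht).sobolevNorm_sq
    rw [Function.comp_apply, ← mul_add, integral_add_compl measurableSet_closedBall hI, ← hsq,
      hpow, ← mul_pow, Real.sqrt_sq (mul_nonneg (Real.rpow_nonneg ht.le _)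
        (sobolevNorm_nonneg _ _)), neg_div, Real.rpow_neg ht.le, div_inv_eq_mul, mul_comm]
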